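/- Let $Z$ be a paracompact Hausdorff smooth manifold (of finite dimension, without boundary), and let $E=E_0\oplus E_1\to Z$ be the Whitney sum of two smooth real vector bundles of finite rank, with typical fibre $V=V_0\oplus V_1$. Let $\wedge E^*=\vee E_0^*\otimes\wedge E_1^*$ be the bundle of commutative superalgebras generated by the even elements of $E_0^*$ and the odd elements of $E_1^*$, and let $\mathcal A(U)$ be the superalgebra of its smooth sections over an open set $U\subseteq Z$ (a section is smooth if locally, in a trivialization, it is a finite sum of smooth functions times constant elements of $\wedge V^*$). A graded derivation of $\mathcal A(U)$ of parity $[u]\in\mathbb Z/2$ is an $\mathbb R$-linear endomorphism $u$ of $\mathcal A(U)$ that shifts the Grassman parity by $[u]$ and satisfies $u(ff')=u(f)f'+(-1)^{[u][f]}f\,u(f')$ for homogeneous $f,f'$; let $\mathrm{Der}\,\mathcal A(U)$ be the space of sums of an even and an odd graded derivation. For a chart of $Z$ with coordinates $z^A$ and trivializations of $E_0,E_1$, all taken from given atlases, with dual fibre bases $(e_a)$ of $E$ and $(c^a)$ of $E^*$, consider the typical fibre $\wedge V^*\otimes(V\oplus\mathbb R^{\dim Z})$ with elements written $u=u^A\partial_A+u^a\partial_a$,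 $u^A,u^a\in\wedge V^*$. For a change of trivialization $c'^a=\rho^a_b c^b$ and of coordinates $z\mapsto z'$ set $$u'^A=\frac{\partial z'^A}{\partial z^B}\,u^B,\qquad u'^a=\rho^a_b\,u^b+u^A\,\partial_A(\rho^a_b)\,c^b ,$$ where the coefficients in $\wedge V^*$ on the right are re-expressed in the basis $(c'^a)$. Then: 1. These are the transition functions of a smooth vector bundle $\mathcal V_E\to Z$ with this typical fibre: they are smooth, linear, satisfy the cocycle relations, and preserve an increasing sequence of finite-dimensional subspaces exhausting the typical fibre (so $\mathcal V_E$ is an increasing union of vector bundles of finite rank). Smooth sections of $\mathcal V_E$ are again locally finite sums of smooth functions times constant vectors. 2. For every open $U\subseteq Z$ there is a linear isomorphism $\Phi_U$ from the space of smooth sections of $\mathcal V_E$ over $U$ onto $\mathrm{Der}\,\mathcal A(U)$. It is linear over $\mathcal A(U)$ (multiplication by $\mathcal A(U)$ on the left), and it is given in each trivialization by $$\Phi_U(u)\Big(\sum_k g_kw_k\Big)=\sum_k\Big(u^A\,(\partial_Ag_k)\,w_k+u^a\,g_k\,(\partial_a\rfloor w_k)\Big)$$ for finite sums with smooth functions $g_k$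 and constants $w_k\in\wedge V^*$, where $\partial_a\rfloor$ is the left contraction (the left graded derivation of $\wedge V^*$ with $\partial_a\rfloor c^b=\delta_a^b$). In particular, for $U=Z$, the graded derivations of $\mathcal A(Z)$ are exactly the global sections of $\mathcal V_E$. 3. For open $U'\subseteq U$ every graded derivation of $\mathcal A(U)$ restricts to a unique graded derivation of $\mathcal A(U')$, and the maps $\Phi_U$ commute with restrictions. Consequently the maps $\Phi$ induce an isomorphism from the sheaf of smooth sections of $\mathcal V_E$ onto the sheaf of graded derivations of the sheaf $\mathcal A$, whose sections over $U$ are the families of graded derivations of $\mathcal A(U')$, $U'\subseteq U$ open, that commute with restrictions. -/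

import Mathlib

open Set Filter Topology TensorProduct Bundle Manifold ContDiff TopologicalSpace

noncomputable section

namespace BRST

/-! ### The commutative superalgebra of a vector superspace -/

/-- For a vector superspace `V = V₀ ⊕ V₁`, the commutative superalgebra `∧V* = ∨V₀* ⊗ ∧V₁*`:
the algebra generated by the even elements of `V₀*` and the odd elements of `V₁*`. -/
abbrev SAlg (V₀ V₁ : Type*) [AddCommGroup V₀] [Module ℝ V₀] [AddCommGroup V₁] [Module ℝ V₁] :=
  SymmetricAlgebra ℝ (Module.Dual ℝ V₀) ⊗[ℝ] ExteriorAlgebra ℝ (Module.Dual ℝ V₁)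

section Fibre

variable {V₀ V₁ W₀ W₁ : Type*} [AddCommGroup V₀] [Module ℝ V₀] [AddCommGroup V₁] [Module ℝ V₁]
  [AddCommGroup W₀] [Module ℝ W₀] [AddCommGroup W₁] [Module ℝ W₁]

/-- The even generator given by `c ∈ V₀*`. -/
def evenGen : Module.Dual ℝ V₀ →ₗ[ℝ] SAlg V₀ V₁ :=
  (Algebra.TensorProduct.includeLeft :
    SymmetricAlgebra ℝ (Module.Dual ℝ V₀) →ₐ[ℝ] SAlg V₀ V₁).toLinearMap ∘ₗ
      SymmetricAlgebra.ι ℝ (Module.Dual ℝ V₀)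

/-- The odd generator given by `c ∈ V₁*`. -/
def oddGen : Module.Dual ℝ V₁ →ₗ[ℝ] SAlg V₀ V₁ :=
  (Algebra.TensorProduct.includeRight :
    ExteriorAlgebra ℝ (Module.Dual ℝ V₁) →ₐ[ℝ] SAlg V₀ V₁).toLinearMap ∘ₗ
      ExteriorAlgebra.ι ℝ

/-- The algebra map `∧V* → ∧W*` induced by the transposes of `h₀ : W₀ → V₀`, `h₁ : W₁ → V₁`. -/
def pull (h₀ : W₀ →ₗ[ℝ] V₀) (h₁ : W₁ →ₗ[ℝ] V₁) : SAlg V₀ V₁ →ₐ[ℝ] SAlg W₀ W₁ :=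
  Algebra.TensorProduct.map
    (SymmetricAlgebra.lift (SymmetricAlgebra.ι ℝ (Module.Dual ℝ W₀) ∘ₗ h₀.dualMap))
    (ExteriorAlgebra.map h₁.dualMap)

/-- The parity involution: multiplication by `(-1) ^ k` on `∨V₀* ⊗ ∧ᵏV₁*`. -/
def parityInv : SAlg V₀ V₁ →ₐ[ℝ] SAlg V₀ V₁ :=
  Algebra.TensorProduct.map (AlgHom.id ℝ _) CliffordAlgebra.involute

/-- `c ↦ c + c(v) ε`, as an algebra map to the dual numbers. -/
def symShift (v : V₀) : SymmetricAlgebra ℝ (Module.Dual ℝ V₀) →ₐ[ℝ]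
    DualNumber (SymmetricAlgebra ℝ (Module.Dual ℝ V₀)) :=
  SymmetricAlgebra.lift
    ((TrivSqZeroExt.inlAlgHom ℝ (SymmetricAlgebra ℝ (Module.Dual ℝ V₀))
        (SymmetricAlgebra ℝ (Module.Dual ℝ V₀))).toLinearMap ∘ₗ
        SymmetricAlgebra.ι ℝ (Module.Dual ℝ V₀) +
      (TrivSqZeroExt.inrHom (SymmetricAlgebra ℝ (Module.Dual ℝ V₀))
        (SymmetricAlgebra ℝ (Module.Dual ℝ V₀))).restrictScalars ℝ ∘ₗ
        (Algebra.linearMap ℝ (SymmetricAlgebra ℝ (Module.Dual ℝ V₀))) ∘ₗ Module.Dual.eval ℝ V₀ v)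

theorem symShift_ι (v : V₀) (c : Module.Dual ℝ V₀) :
    symShift v (SymmetricAlgebra.ι ℝ _ c) =
      TrivSqZeroExt.inl (SymmetricAlgebra.ι ℝ _ c) +
        TrivSqZeroExt.inr (algebraMap ℝ _ (c v)) := by
  simp [symShift]

theorem symShift_fst (v : V₀) (x : SymmetricAlgebra ℝ (Module.Dual ℝ V₀)) :
    (symShift v x).fst = x := by
  have : (TrivSqZeroExt.fstHom ℝ _ _).comp (symShift v) = AlgHom.id ℝ _ := by
    apply SymmetricAlgebra.algHom_ext
    ext c
    simp [symShift_ι]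
  exact congrArg (fun φ : _ →ₐ[ℝ] _ => φ x) this

/-- The derivation of `∨V₀*` along `v ∈ V₀`. -/
def symDer (v : V₀) (x : SymmetricAlgebra ℝ (Module.Dual ℝ V₀)) :
    SymmetricAlgebra ℝ (Module.Dual ℝ V₀) := (symShift v x).snd

theorem symDer_ι (v : V₀) (c : Module.Dual ℝ V₀) :
    symDer v (SymmetricAlgebra.ι ℝ _ c) = algebraMap ℝ _ (c v) := by
  simp [symDer, symShift_ι, Algebra.algebraMap_eq_smul_one]

theorem symDer_algebraMap (v : V₀) (r : ℝ) :
    symDer v (algebraMap ℝ _ r) = 0 := by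
  simp only [symDer, AlgHom.commutes]
  rfl

theorem symDer_mul (v : V₀) (x y : SymmetricAlgebra ℝ (Module.Dual ℝ V₀)) :
    symDer v (x * y) = symDer v x * y + x * symDer v y := by
  simp only [symDer, map_mul, TrivSqZeroExt.snd_mul, symShift_fst, smul_eq_mul,
    MulOpposite.smul_eq_mul_unop, MulOpposite.unop_op]
  ring

theorem symDer_add (v : V₀) (x y : SymmetricAlgebra ℝ (Module.Dual ℝ V₀)) :
    symDer v (x + y) = symDer v x + symDer v y := by
  simp [symDer]

theorem symDer_smul (v : V₀) (r : ℝ) (x : SymmetricAlgebra ℝ (Module.Dual ℝ V₀)) :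
    symDer v (r • x) = r • symDer v x := by
  simp [symDer]

/-- The derivation of `∨V₀*` along `v ∈ V₀`, linear in `v`. -/
def symContract : V₀ →ₗ[ℝ] SymmetricAlgebra ℝ (Module.Dual ℝ V₀) →ₗ[ℝ]
    SymmetricAlgebra ℝ (Module.Dual ℝ V₀) :=
  LinearMap.mk₂ ℝ symDer
    (by
      intro v w x
      induction x using SymmetricAlgebra.induction with
      | algebraMap r => simp [symDer_algebraMap]
      | ι c => simp [symDer_ι]
      | mul a b ha hb => rw [symDer_mul, symDer_mul, symDer_mul, ha, hb]; ring
      | add a b ha hb => rw [symDer_add, symDer_add, symDer_add, ha, hb]; abel)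
    (by
      intro r v x
      induction x using SymmetricAlgebra.induction with
      | algebraMap r => simp [symDer_algebraMap]
      | ι c => simp [symDer_ι, Algebra.smul_def]
      | mul a b ha hb => rw [symDer_mul, symDer_mul, ha, hb]; simp [smul_add]
      | add a b ha hb => rw [symDer_add, symDer_add, ha, hb, smul_add])
    symDer_add
    (fun r v x => symDer_smul v r x)

/-- The left contraction `v ⌋ x` of `x ∈ ∧V*` with `v = (v₀, v₁) ∈ V`: the sum of the even
derivation along `v₀` and of the odd derivation (left interior product) along `v₁`. -/
def contract : V₀ × V₁ →ₗ[ℝ] SAlg V₀ V₁ →ₗ[ℝ] SAlg V₀ V₁ :=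
  LinearMap.coprod
    (LinearMap.rTensorHom (R := ℝ) (ExteriorAlgebra ℝ (Module.Dual ℝ V₁)) ∘ₗ symContract)
    (LinearMap.lTensorHom (R := ℝ) (SymmetricAlgebra ℝ (Module.Dual ℝ V₀)) ∘ₗ
      CliffordAlgebra.contractLeft ∘ₗ Module.Dual.eval ℝ V₁)

/-- The value of `a ⊗ (v, t) ∈ ∧V* ⊗ (V ⊕ M)`, read as `a (∂_t + ∂_v)`, on the product `g x` of a
function `g` and a constant `x ∈ ∧V*`, at a point where `g` has value `r` and differential `dg`:
it is `a ((∂_t g) x + g (v ⌋ x))`. -/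
def act {M : Type*} [AddCommGroup M] [Module ℝ M] (dg : M →ₗ[ℝ] ℝ) (r : ℝ) (x : SAlg V₀ V₁) :
    SAlg V₀ V₁ ⊗[ℝ] ((V₀ × V₁) × M) →ₗ[ℝ] SAlg V₀ V₁ :=
  TensorProduct.lift ((LinearMap.mul ℝ (SAlg V₀ V₁)).compl₂
    (LinearMap.coprod (r • (contract (V₀ := V₀) (V₁ := V₁)).flip x) (dg.smulRight x)))

end Fibre

/-! ### Smooth functions with values in a real vector space, smooth vector bundles -/

section Smooth

variable (M : Type*) [NormedAddCommGroup M] [NormedSpace ℝ M]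
  {Z : Type*} [TopologicalSpace Z] [ChartedSpace M Z]
  {W : Type*} [AddCommMonoid W] [Module ℝ W]

/-- Smoothness near `x` of a map to a real vector space `W`, possibly of infinite dimension (the
direct limit of its finite-dimensional subspaces): near `x` the map is a finite sum
`∑ k, g k • w k` with smooth real functions `g k` and constant vectors `w k`. -/
def LFSmoothAt {P : Z → Prop} (h : {z // P z} → W) (x : {z // P z}) : Prop :=
  ∃ (O : Set Z) (κ : Type) (_ : Fintype κ) (g : κ → Z → ℝ) (w : κ → W),
    IsOpen O ∧ (x : Z) ∈ O ∧ (∀ k, ContMDiffOn 𝓘(ℝ, M) 𝓘(ℝ, ℝ) ∞ (g k) O) ∧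
    ∀ z : {z // P z}, (z : Z) ∈ O → h z = ∑ k, g k z • w k

variable {M}

theorem LFSmoothAt.const {P : Z → Prop} (w : W) (x : {z // P z}) :
    LFSmoothAt M (fun _ : {z // P z} => w) x :=
  ⟨univ, Unit, inferInstance, fun _ _ => 1, fun _ => w, isOpen_univ, mem_univ _,
    fun _ => contMDiffOn_const, fun _ _ => by simp⟩

theorem LFSmoothAt.add {P : Z → Prop} {h h' : {z // P z} → W} {x : {z // P z}}
    (H : LFSmoothAt M h x) (H' : LFSmoothAt M h' x) :
    LFSmoothAt M (fun z => h z + h' z) x := by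
  obtain ⟨O, κ, _, g, w, hO, hx, hg, e⟩ := H
  obtain ⟨O', κ', _, g', w', hO', hx', hg', e'⟩ := H'
  refine ⟨O ∩ O', κ ⊕ κ', inferInstance, Sum.elim g g', Sum.elim w w', hO.inter hO', ⟨hx, hx'⟩,
    ?_, fun z hz => ?_⟩
  · rintro (k | k)
    · exact (hg k).mono inter_subset_left
    · exact (hg' k).mono inter_subset_right
  · simp [e z hz.1, e' z hz.2]

theorem LFSmoothAt.map {W' : Type*} [AddCommMonoid W'] [Module ℝ W'] {P : Z → Prop}
    {h : {z // P z} → W} {x : {z // P z}} (H : LFSmoothAt M h x) (φ : W →ₗ[ℝ] W') :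
    LFSmoothAt M (fun z => φ (h z)) x := by
  obtain ⟨O, κ, _, g, w, hO, hx, hg, e⟩ := H
  exact ⟨O, κ, inferInstance, g, fun k => φ (w k), hO, hx, hg, fun z hz => by simp [e z hz]⟩

theorem LFSmoothAt.mul {A : Type*} [Ring A] [Algebra ℝ A] {P : Z → Prop}
    {h h' : {z // P z} → A} {x : {z // P z}} (H : LFSmoothAt M h x) (H' : LFSmoothAt M h' x) :
    LFSmoothAt M (fun z => h z * h' z) x := by
  obtain ⟨O, κ, _, g, w, hO, hx, hg, e⟩ := H
  obtain ⟨O', κ', _, g', w', hO', hx', hg', e'⟩ := H'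
  refine ⟨O ∩ O', κ × κ', inferInstance, fun k z => g k.1 z * g' k.2 z, fun k => w k.1 * w' k.2,
    hO.inter hO', ⟨hx, hx'⟩, fun k => ?_, fun z hz => ?_⟩
  · exact ((hg k.1).mono inter_subset_left).mul ((hg' k.2).mono inter_subset_right)
  · simp [e z hz.1, e' z hz.2, Finset.sum_mul_sum, Fintype.sum_prod_type, smul_smul,
      mul_comm]

theorem LFSmoothAt.restrict {P Q : Z → Prop} {h : {z // P z} → W} (hQ : ∀ z, Q z → P z)
    {x : {z // Q z}} (H : LFSmoothAt M h ⟨x, hQ x x.2⟩) :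
    LFSmoothAt M (fun z : {z // Q z} => h ⟨z, hQ z z.2⟩) x := by
  obtain ⟨O, κ, _, g, w, hO, hx, hg, e⟩ := H
  exact ⟨O, κ, inferInstance, g, w, hO, hx, hg, fun z hz => e ⟨z, hQ z z.2⟩ hz⟩

variable (M)

/-- The family `baseSet i ⊆ Z`, `coordChange i j z : W → W` consists of the trivialization domains
and the transition functions of a smooth vector bundle over `Z` with typical fibre `W`. As `W` may
have infinite dimension, this bundle is required to be the increasing union of vector
subbundles of finite rank. -/
structure IsVectorBundleCocycle {ι : Type*} (baseSet : ι → Set Z)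
    (coordChange : ι → ι → Z → W →ₗ[ℝ] W) : Prop where
  isOpen_baseSet : ∀ i, IsOpen (baseSet i)
  cover : ∀ z, ∃ i, z ∈ baseSet i
  coordChange_self : ∀ i, ∀ z ∈ baseSet i, coordChange i i z = LinearMap.id
  coordChange_comp : ∀ i j k, ∀ z, z ∈ baseSet i → z ∈ baseSet j → z ∈ baseSet k →
    coordChange j k z ∘ₗ coordChange i j z = coordChange i k z
  smooth : ∀ i j (w : W) (x : {z // z ∈ baseSet i ∩ baseSet j}),
    LFSmoothAt M (fun z : {z // z ∈ baseSet i ∩ baseSet j} => coordChange i j z w) x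
  exhaustion : ∃ F : ℕ → Submodule ℝ W, Monotone F ∧ (∀ n, Module.Finite ℝ (F n)) ∧
    ⨆ n, F n = ⊤ ∧ ∀ n i j, ∀ z ∈ baseSet i ∩ baseSet j, (F n).map (coordChange i j z) ≤ F n

/-- The fibre at `z` of the vector bundle with the given transition functions: an element is given
by its coordinates `w i ∈ W` in all trivializations over `z` (with the value `0` for the
trivializations that are not defined at `z`), related by the transition functions. -/
def Fibre {ι : Type*} (baseSet : ι → Set Z) (coordChange : ι → ι → Z → W →ₗ[ℝ] W) (z : Z) :
    Submodule ℝ (ι → W) where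
  carrier := {w | (∀ i, z ∉ baseSet i → w i = 0) ∧
    ∀ i j, z ∈ baseSet i → z ∈ baseSet j → coordChange i j z (w i) = w j}
  add_mem' := by
    rintro a b ⟨ha, ha'⟩ ⟨hb, hb'⟩
    refine ⟨fun i hi => by simp [ha i hi, hb i hi], fun i j hi hj => ?_⟩
    simp [ha' i j hi hj, hb' i j hi hj]
  zero_mem' := by simp
  smul_mem' := by
    rintro r a ⟨ha, ha'⟩
    refine ⟨fun i hi => by simp [ha i hi], fun i j hi hj => ?_⟩
    simp [ha' i j hi hj]

/-- The smooth sections over an open set `U` of that vector bundle. -/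
def Sections {ι : Type*} (baseSet : ι → Set Z) (coordChange : ι → ι → Z → W →ₗ[ℝ] W)
    (U : Opens Z) : Submodule ℝ (∀ z : {z // z ∈ U}, Fibre baseSet coordChange (z : Z)) where
  carrier := {s | ∀ (i : ι) (x : {z // z ∈ U}), (x : Z) ∈ baseSet i →
    LFSmoothAt M (fun z : {z // z ∈ U} => (s z : ι → W) i) x}
  add_mem' := fun ha hb i x hx => (ha i x hx).add (hb i x hx)
  zero_mem' := fun _ x _ => LFSmoothAt.const (0 : W) x
  smul_mem' := fun r _ ha i x hx => (ha i x hx).map (r • LinearMap.id)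

/-- Restriction of sections to a smaller open set. -/
def Sections.res {ι : Type*} {baseSet : ι → Set Z} {coordChange : ι → ι → Z → W →ₗ[ℝ] W}
    {U V : Opens Z} (h : V ≤ U) :
    Sections M baseSet coordChange U →ₗ[ℝ] Sections M baseSet coordChange V where
  toFun s := ⟨fun z => s.1 ⟨z, h z.2⟩, fun i x hx => (s.2 i ⟨x, h x.2⟩ hx).restrict (fun _ q => h q)⟩
  map_add' _ _ := rfl
  map_smul' _ _ := rfl

end Smooth

/-! ### BRST functions, graded derivations, and the bundle `𝒱_E` -/

section Main

variable (M : Type*) [NormedAddCommGroup M] [NormedSpace ℝ M]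
  {Z : Type*} [TopologicalSpace Z] [ChartedSpace M Z]
  (F₀ : Type*) [NormedAddCommGroup F₀] [NormedSpace ℝ F₀] [FiniteDimensional ℝ F₀]
  (F₁ : Type*) [NormedAddCommGroup F₁] [NormedSpace ℝ F₁] [FiniteDimensional ℝ F₁]
  (E₀ : Z → Type*) [TopologicalSpace (TotalSpace F₀ E₀)]
  [∀ z, AddCommGroup (E₀ z)] [∀ z, Module ℝ (E₀ z)] [∀ z, TopologicalSpace (E₀ z)]
  [FiberBundle F₀ E₀] [VectorBundle ℝ F₀ E₀]
  (E₁ : Z → Type*) [TopologicalSpace (TotalSpace F₁ E₁)]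
  [∀ z, AddCommGroup (E₁ z)] [∀ z, Module ℝ (E₁ z)] [∀ z, TopologicalSpace (E₁ z)]
  [FiberBundle F₁ E₁] [VectorBundle ℝ F₁ E₁]

/-- A chart of `Z` together with trivializations of `E₀` and of `E₁`, from the given atlases. -/
structure LocTriv where
  chart : OpenPartialHomeomorph Z M
  chart_mem : chart ∈ atlas M Z
  e₀ : Trivialization F₀ (π F₀ E₀)
  e₁ : Trivialization F₁ (π F₁ E₁)
  e₀_mem : MemTrivializationAtlas e₀
  e₁_mem : MemTrivializationAtlas e₁

attribute [instance] LocTriv.e₀_mem LocTriv.e₁_mem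

variable {M F₀ F₁ E₀ E₁}

/-- The common domain of the chart and of the trivializations. -/
def LocTriv.baseSet (i : LocTriv M F₀ F₁ E₀ E₁) : Set Z :=
  i.chart.source ∩ (i.e₀.baseSet ∩ i.e₁.baseSet)

/-- The trivialization `∧E_z* → ∧F*` of the bundle `∧E*`. -/
def LocTriv.triv (i : LocTriv M F₀ F₁ E₀ E₁) (z : Z) :
    SAlg (E₀ z) (E₁ z) →ₐ[ℝ] SAlg F₀ F₁ :=
  pull (i.e₀.symmₗ ℝ z) (i.e₁.symmₗ ℝ z)

/-- The term `t ↦ ∑ b, cᵇ ⊗ (∂_t g) g⁻¹ e_b` in `W ⊗ F`, where `g` is the transition function from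
`e` to `e'`, `(e_b)` a basis of `F`, `(cᵇ)` the dual basis, mapped to `W` by `gen`. Here `∂_t` is the
derivative in the direction `t` in the chart `φ`. It is applied to `a ⊗ t`, with `a` multiplying on
the left. -/
def twist {F : Type*} [NormedAddCommGroup F] [NormedSpace ℝ F] [FiniteDimensional ℝ F] {E : Z → Type*}
    [TopologicalSpace (TotalSpace F E)]
    [∀ z, AddCommGroup (E z)] [∀ z, Module ℝ (E z)] [∀ z, TopologicalSpace (E z)]
    [FiberBundle F E] [VectorBundle ℝ F E]
    (φ : OpenPartialHomeomorph Z M) (e e' : Trivialization F (π F E))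
    [MemTrivializationAtlas e] [MemTrivializationAtlas e']
    {A : Type*} [Ring A] [Algebra ℝ A] (gen : Module.Dual ℝ F →ₗ[ℝ] A) (z : Z) :
    A ⊗[ℝ] M →ₗ[ℝ] A ⊗[ℝ] F :=
  ∑ b, TensorProduct.map
    (LinearMap.mulRight ℝ (gen ((Module.finBasis ℝ F).coord b)))
    (((fderiv ℝ (fun y => (e.coordChangeL ℝ e' (φ.symm y) : F →L[ℝ] F)) (φ z)).flip
      ((e.coordChangeL ℝ e' z).symm (Module.finBasis ℝ F b)) : M →L[ℝ] F) : M →ₗ[ℝ] F)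

/-- The algebra isomorphism `∧F* → ∧F*` which the transition functions of `E` induce on the typical
fibre of `∧E*`. -/
def algChange (i j : LocTriv M F₀ F₁ E₀ E₁) (z : Z) : SAlg F₀ F₁ →ₐ[ℝ] SAlg F₀ F₁ :=
  pull ((i.e₀.coordChangeL ℝ j.e₀ z).symm : F₀ →ₗ[ℝ] F₀)
    ((i.e₁.coordChangeL ℝ j.e₁ z).symm : F₁ →ₗ[ℝ] F₁)

/-- The derivative at `z` of the change of charts of `Z`. -/
def jac (i j : LocTriv M F₀ F₁ E₀ E₁) (z : Z) : M →ₗ[ℝ] M :=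
  (fderiv ℝ (fun y => j.chart (i.chart.symm y)) (i.chart z) : M →L[ℝ] M)

/-- The transition functions of `𝒱_E`, with typical fibre `∧F* ⊗ (F ⊕ M)`: the element
`a ⊗ (v, t)`, that is `a (v^a ∂_a + t^A ∂_A)`, is taken to
`R a ⊗ (g v, J t) + ∑ b, (R a) cᵇ ⊗ ((∂_t g) g⁻¹ e_b, 0)`,
where `g` is the transition function of `E`, `R` that of `∧E*`, and `J` that of `TZ`. -/
def coordChange (i j : LocTriv M F₀ F₁ E₀ E₁) (z : Z) :
    SAlg F₀ F₁ ⊗[ℝ] ((F₀ × F₁) × M) →ₗ[ℝ] SAlg F₀ F₁ ⊗[ℝ] ((F₀ × F₁) × M) :=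
  TensorProduct.map (algChange i j z).toLinearMap
      (LinearMap.prodMap
        (LinearMap.prodMap (i.e₀.coordChangeL ℝ j.e₀ z : F₀ →ₗ[ℝ] F₀)
          (i.e₁.coordChangeL ℝ j.e₁ z : F₁ →ₗ[ℝ] F₁))
        (jac i j z)) +
    (LinearMap.lTensor _ (LinearMap.inl ℝ (F₀ × F₁) M ∘ₗ LinearMap.inl ℝ F₀ F₁) ∘ₗ
        twist i.chart i.e₀ j.e₀ (evenGen (V₁ := F₁)) z +
      LinearMap.lTensor _ (LinearMap.inl ℝ (F₀ × F₁) M ∘ₗ LinearMap.inr ℝ F₀ F₁) ∘ₗ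
        twist i.chart i.e₁ j.e₁ (oddGen (V₀ := F₀)) z) ∘ₗ
      TensorProduct.map (algChange i j z).toLinearMap (LinearMap.snd ℝ (F₀ × F₁) M)

variable (M F₀ F₁ E₀ E₁)

/-- The real vector space of sections of `𝒱_E` over `U`. -/
abbrev VSections (U : Opens Z) :=
  Sections M (LocTriv.baseSet (M := M) (F₀ := F₀) (F₁ := F₁) (E₀ := E₀) (E₁ := E₁))
    (coordChange (M := M) (F₀ := F₀) (F₁ := F₁) (E₀ := E₀) (E₁ := E₁)) U

/-- The superalgebra `𝒜(U)` of (smooth) sections of `∧E*` over `U`. -/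
def BFun (U : Opens Z) : Subalgebra ℝ (∀ z : {z // z ∈ U}, SAlg (E₀ z) (E₁ z)) where
  carrier := {f | ∀ (i : LocTriv M F₀ F₁ E₀ E₁) (x : {z // z ∈ U}), (x : Z) ∈ i.baseSet →
    LFSmoothAt M (fun z : {z // z ∈ U} => i.triv z (f z)) x}
  add_mem' := fun ha hb i x hx => by
    simpa only [Pi.add_apply, map_add] using (ha i x hx).add (hb i x hx)
  mul_mem' := fun ha hb i x hx => by
    simpa only [Pi.mul_apply, map_mul] using (ha i x hx).mul (hb i x hx)
  algebraMap_mem' := fun r i x _ => by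
    simpa only [Pi.algebraMap_apply, AlgHom.commutes] using
      LFSmoothAt.const (M := M) (algebraMap ℝ (SAlg F₀ F₁) r) x

variable {M F₀ F₁ E₀ E₁}

/-- Restriction of sections of `∧E*` to a smaller open set. -/
def BFun.res {U V : Opens Z} (h : V ≤ U) :
    BFun M F₀ F₁ E₀ E₁ U →ₐ[ℝ] BFun M F₀ F₁ E₀ E₁ V where
  toFun f := ⟨fun z => f.1 ⟨z, h z.2⟩, fun i x hx =>
    LFSmoothAt.restrict (M := M) (W := SAlg F₀ F₁) (h := fun z : {z // z ∈ U} => i.triv z (f.1 z))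
      (fun _ q => h q) (f.2 i ⟨x, h x.2⟩ hx)⟩
  map_one' := rfl
  map_mul' _ _ := rfl
  map_zero' := rfl
  map_add' _ _ := rfl
  commutes' _ := rfl

/-- `f` is homogeneous of Grassman parity `p`. -/
def HasParity {U : Opens Z} (p : ZMod 2) (f : BFun M F₀ F₁ E₀ E₁ U) : Prop :=
  ∀ z, parityInv (f.1 z) = (-1 : ℝ) ^ p.val • f.1 z

variable (M F₀ F₁ E₀ E₁)

/-- The homogeneous graded derivations of `𝒜(U)` of parity `p`. -/
def HomDer (U : Opens Z) (p : ZMod 2) :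
    Submodule ℝ (BFun M F₀ F₁ E₀ E₁ U →ₗ[ℝ] BFun M F₀ F₁ E₀ E₁ U) where
  carrier := {u | (∀ q f, HasParity q f → HasParity (p + q) (u f)) ∧
    ∀ q q' f f', HasParity q f → HasParity q' f' →
      u (f * f') = u f * f' + (-1 : ℝ) ^ (p.val * q.val) • (f * u f')}
  add_mem' := by
    rintro u v ⟨hu, hu'⟩ ⟨hv, hv'⟩
    refine ⟨fun q f hf z => ?_, fun q q' f f' hf hf' => ?_⟩
    · have h1 := hu q f hf z
      have h2 := hv q f hf z
      simp only [LinearMap.add_apply, Subalgebra.coe_add, Pi.add_apply, map_add, smul_add]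
      rw [h1, h2]
    · simp only [LinearMap.add_apply, hu' q q' f f' hf hf', hv' q q' f f' hf hf', add_mul, mul_add,
        smul_add]
      abel
  zero_mem' := by
    refine ⟨fun q f _ z => ?_, fun q q' f f' _ _ => ?_⟩
    · simp
    · simp
  smul_mem' := by
    rintro r u ⟨hu, hu'⟩
    refine ⟨fun q f hf z => ?_, fun q q' f f' hf hf' => ?_⟩
    · have h1 := hu q f hf z
      simp only [LinearMap.smul_apply, Subalgebra.coe_smul, Pi.smul_apply, map_smul]
      rw [h1, smul_comm]
    · simp only [LinearMap.smul_apply, hu' q q' f f' hf hf', smul_add, smul_mul_assoc,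
        mul_smul_comm]
      rw [smul_comm]

/-- The graded derivations of `𝒜(U)`: sums of an even and an odd one. -/
def GDer (U : Opens Z) :
    Submodule ℝ (BFun M F₀ F₁ E₀ E₁ U →ₗ[ℝ] BFun M F₀ F₁ E₀ E₁ U) :=
  HomDer M F₀ F₁ E₀ E₁ U 0 ⊔ HomDer M F₀ F₁ E₀ E₁ U 1

/-- Sections over `U` of the sheaf of graded derivations of the sheaf `𝒜`: families of graded
derivations of `𝒜(V)`, for `V ⊆ U` open, that commute with restrictions. -/
def DerSheaf (U : Opens Z) :
    Submodule ℝ (∀ V : {V : Opens Z // V ≤ U}, GDer M F₀ F₁ E₀ E₁ V.1) where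
  carrier := {u | ∀ (V V' : {V : Opens Z // V ≤ U}) (h : V'.1 ≤ V.1)
    (f : BFun M F₀ F₁ E₀ E₁ V.1),
      (u V').1 (BFun.res h f) = BFun.res h ((u V).1 f)}
  add_mem' := by
    intro u v hu hv V V' h f
    simp [hu V V' h f, hv V V' h f]
  zero_mem' := by
    intro V V' h f
    simp
  smul_mem' := by
    intro r u hu V V' h f
    simp [hu V V' h f]

end Main

end BRST

end

set_option linter.unusedSectionVars false

noncomputable section

namespace BRST

/-! ### Homomorphism-class instances for real algebra maps and linear maps. -/

section HomClass

variable {A B : Type*} [Semiring A] [Semiring B] [Algebra ℝ A] [Algebra ℝ B]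

/-! A graded derivation sees only first-order data. In a trivialization, an element `a ⊗ (v, t)` of
the typical fibre acts on a one-jet `(x, D)` with values in `∧V*` by `a (v ⌋ x + D t)`; this is
`jetAct`. The action is faithful, because the jets of the generators and of the coordinates recover
all coefficients (`ofValues_jetAct`, `jetAct_ext`).

The transition functions of `𝒱_E` are those that make this action equivariant
(`jetAct_coordChange`). If `R` is the change of trivialization of `∧E*`, then `∂_t (R h)` is `R (∂_t
h)` plus a derivation of the fibre applied to `R h`, namely `twistDer`. It carries a minus sign
because generators transform by `g⁻¹` and `d(g⁻¹) = -g⁻¹ (dg) g⁻¹`; the twist terms of `coordChange`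
cancel it. Equivariance and faithfulness together give the cocycle relations without matrix
computations, and show that sections of `𝒱_E` act on sections of `∧E*` independently of the
trivialization. The graded Leibniz rule is checked on the fibre: elements that are even or odd for
`parityW` act as derivations of that parity (`jetAct_mul_even`, `jetAct_mul_odd`).

Conversely, a homogeneous graded derivation composed with evaluation at a point `x` is a point
derivation, twisted by the identity or by `parityInv`. Bump functions make it local. Near `x` a
section of `∧E*` is a finite sum of functions times constants; the Leibniz rule reduces constants to
generators, and Hadamard's lemma reduces functions to coordinates. So a point derivation is
determined by finitely many values (`IsPointDer.ext`), and `ofValues` builds a fibre element with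
these values and the right parity (`IsPointDer.exists_secAct`). The resulting coefficients are
smooth because near `x` they are values of the derivation on fixed sections (`lfAt_derCoeff`). All
of this is pointwise, so no partition of unity enters.

Restriction of derivations is then restriction of sections. It is unique since the test sections
needed at a point of the smaller set can be taken over the larger one (`eq_of_secDer_res_eq`). The
sheaf statement follows formally by `exists_linearEquiv_compatible`.

The fibres are infinite-dimensional as soon as `E₀` has positive rank. Smoothness is therefore
expressed by local finite sums (`LFAt`), and differentials are defined algebraically (`HasLD`); they
are unique because linear functionals separate points. -/

theorem algHom_addHomClass : AddHomClass (A →ₐ[ℝ] B) A B := inferInstance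

theorem algHom_addMonoidHomClass : AddMonoidHomClass (A →ₐ[ℝ] B) A B := inferInstance

theorem algHom_mulHomClass : MulHomClass (A →ₐ[ℝ] B) A B := inferInstance

theorem algHom_mulActionHomClass : MulActionHomClass (A →ₐ[ℝ] B) ℝ A B := inferInstance

theorem algHom_zeroHomClass : ZeroHomClass (A →ₐ[ℝ] B) A B := inferInstance

theorem algHom_oneHomClass : OneHomClass (A →ₐ[ℝ] B) A B := inferInstance

variable {P Q : Type*} [AddCommMonoid P] [AddCommMonoid Q] [Module ℝ P] [Module ℝ Q]

theorem linearMap_addHomClass : AddHomClass (P →ₗ[ℝ] Q) P Q := inferInstance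

theorem linearMap_addMonoidHomClass : AddMonoidHomClass (P →ₗ[ℝ] Q) P Q := inferInstance

theorem linearMap_mulActionHomClass : MulActionHomClass (P →ₗ[ℝ] Q) ℝ P Q := inferInstance

theorem linearMap_zeroHomClass : ZeroHomClass (P →ₗ[ℝ] Q) P Q := inferInstance

end HomClass

attribute [local instance] algHom_addHomClass algHom_addMonoidHomClass algHom_mulHomClass
  algHom_mulActionHomClass algHom_zeroHomClass algHom_oneHomClass linearMap_addHomClass
  linearMap_addMonoidHomClass linearMap_mulActionHomClass linearMap_zeroHomClass

/-! ### The superalgebra `∧V*`: generators, functoriality, parity, contractions. -/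

section Algebra

variable {V₀ V₁ W₀ W₁ X₀ X₁ : Type*} [AddCommGroup V₀] [Module ℝ V₀] [AddCommGroup V₁] [Module ℝ V₁]
  [AddCommGroup W₀] [Module ℝ W₀] [AddCommGroup W₁] [Module ℝ W₁]
  [AddCommGroup X₀] [Module ℝ X₀] [AddCommGroup X₁] [Module ℝ X₁]

theorem evenGen_apply (c : Module.Dual ℝ V₀) :
    evenGen (V₁ := V₁) c = SymmetricAlgebra.ι ℝ _ c ⊗ₜ[ℝ] 1 := rfl

theorem oddGen_apply (c : Module.Dual ℝ V₁) :
    oddGen (V₀ := V₀) c = 1 ⊗ₜ[ℝ] ExteriorAlgebra.ι ℝ c := rfl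

theorem SAlg.neg_one_smul (x : SAlg V₀ V₁) : (-1 : ℝ) • x = -x := _root_.neg_one_smul ℝ x

@[simp] theorem SAlg.neg_one_smul_neg_one_smul (x : SAlg V₀ V₁) :
    (-1 : ℝ) • (-1 : ℝ) • x = x := by
  rw [smul_smul]; simp

-- Splitting `a ⊗ b` as `(a ⊗ 1) (1 ⊗ b)` reduces to the induction principles of the two factors.
-- Any identity whose two sides are compatible with sums and products thus needs checking on
-- generators only.
@[elab_as_elim]
theorem SAlg.induction {motive : SAlg V₀ V₁ → Prop}
    (smul_one : ∀ r : ℝ, motive (r • (1 : SAlg V₀ V₁)))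
    (even : ∀ c, motive (evenGen c)) (odd : ∀ c, motive (oddGen c))
    (mul : ∀ a b, motive a → motive b → motive (a * b))
    (add : ∀ a b, motive a → motive b → motive (a + b)) (x : SAlg V₀ V₁) : motive x := by
  induction x using TensorProduct.induction_on with
  | zero => simpa using smul_one 0
  | add a b ha hb => exact add a b ha hb
  | tmul a b =>
    have h : a ⊗ₜ[ℝ] b = (a ⊗ₜ 1 : SAlg V₀ V₁) * (1 ⊗ₜ b) := by simp
    rw [h]
    apply mul
    · induction a using SymmetricAlgebra.induction with
      | algebraMap r =>
        rw [Algebra.algebraMap_eq_smul_one, ← TensorProduct.smul_tmul']; exact smul_one r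
      | ι c => exact even c
      | mul a b ha hb => simpa using mul _ _ (ha (by simp)) (hb (by simp))
      | add a b ha hb => simpa [TensorProduct.add_tmul] using add _ _ (ha (by simp)) (hb (by simp))
    · induction b using ExteriorAlgebra.induction with
      | algebraMap r =>
        rw [Algebra.algebraMap_eq_smul_one, TensorProduct.tmul_smul]; exact smul_one r
      | ι c => exact odd c
      | mul a b ha hb => simpa using mul _ _ (ha (by simp)) (hb (by simp))
      | add a b ha hb => simpa [TensorProduct.tmul_add] using add _ _ (ha (by simp)) (hb (by simp))

theorem SAlg.algHom_ext {A : Type*} [Ring A] [Algebra ℝ A] {f g : SAlg V₀ V₁ →ₐ[ℝ] A}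
    (h₀ : ∀ c, f (evenGen c) = g (evenGen c)) (h₁ : ∀ c, f (oddGen c) = g (oddGen c)) : f = g := by
  ext x
  · exact h₀ _
  · exact h₁ _

@[simp] theorem pull_evenGen (h₀ : W₀ →ₗ[ℝ] V₀) (h₁ : W₁ →ₗ[ℝ] V₁) (c) :
    pull h₀ h₁ (evenGen c) = evenGen (c ∘ₗ h₀) := by
  simp [pull, evenGen_apply]; rfl

@[simp] theorem pull_oddGen (h₀ : W₀ →ₗ[ℝ] V₀) (h₁ : W₁ →ₗ[ℝ] V₁) (c) :
    pull h₀ h₁ (oddGen c) = oddGen (c ∘ₗ h₁) := by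
  simp [pull, oddGen_apply]; rfl

@[simp] theorem parityInv_evenGen (c : Module.Dual ℝ V₀) :
    parityInv (evenGen (V₁ := V₁) c) = evenGen c := by
  simp [parityInv, evenGen_apply]

@[simp] theorem parityInv_oddGen (c : Module.Dual ℝ V₁) :
    parityInv (oddGen (V₀ := V₀) c) = (-1 : ℝ) • oddGen c := by
  simp only [parityInv, oddGen_apply, Algebra.TensorProduct.map_tmul, map_one]
  erw [CliffordAlgebra.involute_ι]
  rw [TensorProduct.tmul_neg, SAlg.neg_one_smul]

@[simp] theorem parityInv_parityInv (x : SAlg V₀ V₁) : parityInv (parityInv x) = x := by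
  have : (parityInv (V₀ := V₀) (V₁ := V₁)).comp parityInv = AlgHom.id ℝ _ :=
    SAlg.algHom_ext (by simp) (by simp)
  exact congrArg (fun φ : _ →ₐ[ℝ] _ => φ x) this

theorem parityInv_pull (h₀ : W₀ →ₗ[ℝ] V₀) (h₁ : W₁ →ₗ[ℝ] V₁) (x) :
    parityInv (pull h₀ h₁ x) = pull h₀ h₁ (parityInv x) := by
  have : (parityInv (V₀ := W₀) (V₁ := W₁)).comp (pull h₀ h₁) = (pull h₀ h₁).comp parityInv :=
    SAlg.algHom_ext (by simp) (by simp)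
  exact congrArg (fun φ : _ →ₐ[ℝ] _ => φ x) this

theorem pull_pull (h₀ : W₀ →ₗ[ℝ] V₀) (h₁ : W₁ →ₗ[ℝ] V₁) (k₀ : X₀ →ₗ[ℝ] W₀) (k₁ : X₁ →ₗ[ℝ] W₁) (x) :
    pull k₀ k₁ (pull h₀ h₁ x) = pull (h₀ ∘ₗ k₀) (h₁ ∘ₗ k₁) x := by
  have : (pull k₀ k₁).comp (pull h₀ h₁) = pull (h₀ ∘ₗ k₀) (h₁ ∘ₗ k₁) :=
    SAlg.algHom_ext (by simp [LinearMap.comp_assoc]) (by simp [LinearMap.comp_assoc])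
  exact congrArg (fun φ : _ →ₐ[ℝ] _ => φ x) this

theorem pull_id (x : SAlg V₀ V₁) : pull LinearMap.id LinearMap.id x = x := by
  have : (pull LinearMap.id LinearMap.id) = AlgHom.id ℝ (SAlg V₀ V₁) :=
    SAlg.algHom_ext (by simp) (by simp)
  exact congrArg (fun φ : _ →ₐ[ℝ] _ => φ x) this

theorem evenGen_mul_comm (c : Module.Dual ℝ V₀) (a : SAlg V₀ V₁) :
    evenGen c * a = a * evenGen c := by
  induction a using TensorProduct.induction_on with
  | zero => simp
  | tmul x y => simp [evenGen_apply, mul_comm]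
  | add x y hx hy => rw [mul_add, add_mul, hx, hy]

/-- Both sides are compatible with products in `a`, so generators suffice: even ones are central,
and two odd ones anticommute. -/
theorem mul_oddGen (c : Module.Dual ℝ V₁) (a : SAlg V₀ V₁) :
    a * oddGen c = oddGen c * parityInv a := by
  induction a using SAlg.induction with
  | smul_one r => simp
  | even d => rw [parityInv_evenGen, evenGen_mul_comm]
  | odd d =>
    rw [parityInv_oddGen, mul_smul_comm, SAlg.neg_one_smul, eq_neg_iff_add_eq_zero]
    simp only [oddGen_apply, Algebra.TensorProduct.tmul_mul_tmul, ← TensorProduct.tmul_add,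
      ExteriorAlgebra.ι_add_mul_swap, TensorProduct.tmul_zero]
  | mul x y hx hy => rw [mul_assoc, hy, ← mul_assoc, hx, map_mul, mul_assoc]
  | add x y hx hy => rw [add_mul, hx, hy, map_add, mul_add]

/-- The induction runs over the arbitrary factor `h`, so no expansion of `a` into monomials is
needed; evenness enters only when `a` passes an odd generator. -/
theorem even_mul_comm {a : SAlg V₀ V₁} (ha : parityInv a = a) (h : SAlg V₀ V₁) : a * h = h * a := by
  induction h using SAlg.induction with
  | smul_one r => simp
  | even d => rw [evenGen_mul_comm]
  | odd d => rw [mul_oddGen, ha]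
  | mul x y hx hy => rw [← mul_assoc, hx, mul_assoc, hy, mul_assoc]
  | add x y hx hy => rw [mul_add, hx, hy, add_mul]

theorem odd_mul_comm {a : SAlg V₀ V₁} (ha : parityInv a = (-1 : ℝ) • a) (h : SAlg V₀ V₁) :
    a * h = parityInv h * a := by
  induction h using SAlg.induction with
  | smul_one r => simp
  | even d => rw [parityInv_evenGen, evenGen_mul_comm]
  | odd d => rw [mul_oddGen, ha, parityInv_oddGen, mul_smul_comm, smul_mul_assoc]
  | mul x y hx hy => rw [← mul_assoc, hx, mul_assoc, hy, map_mul, mul_assoc]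
  | add x y hx hy => rw [mul_add, hx, hy, map_add, add_mul]

/-! #### Contractions -/

theorem contract_fst_tmul (v : V₀) (x : SymmetricAlgebra ℝ (Module.Dual ℝ V₀))
    (y : ExteriorAlgebra ℝ (Module.Dual ℝ V₁)) :
    contract (v, (0 : V₁)) (x ⊗ₜ[ℝ] y) = symDer v x ⊗ₜ y := by
  simp [contract, symContract]

theorem contract_snd_tmul (v : V₁) (x : SymmetricAlgebra ℝ (Module.Dual ℝ V₀))
    (y : ExteriorAlgebra ℝ (Module.Dual ℝ V₁)) :
    contract ((0 : V₀), v) (x ⊗ₜ[ℝ] y) =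
      x ⊗ₜ CliffordAlgebra.contractLeft (Module.Dual.eval ℝ V₁ v) y := by
  simp [contract]

/-- Generators are peeled off the left factor one at a time. Each passage of the contraction past a
generator costs a sign, and `involute` collects these signs. -/
theorem contractLeft_mul {N : Type*} [AddCommGroup N] [Module ℝ N] (d : Module.Dual ℝ N)
    (x y : ExteriorAlgebra ℝ N) :
    CliffordAlgebra.contractLeft (Q := (0 : QuadraticForm ℝ N)) d (x * y) =
      CliffordAlgebra.contractLeft d x * y +
        CliffordAlgebra.involute x * CliffordAlgebra.contractLeft d y := by
  induction x using CliffordAlgebra.left_induction generalizing y with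
  | algebraMap r =>
    rw [CliffordAlgebra.contractLeft_algebraMap_mul, CliffordAlgebra.contractLeft_algebraMap,
      AlgHom.commutes, zero_mul, zero_add]
  | add a b ha hb => simp only [add_mul, map_add, ha, hb]; abel
  | ι_mul x m hx =>
    rw [mul_assoc, CliffordAlgebra.contractLeft_ι_mul, hx, CliffordAlgebra.contractLeft_ι_mul,
      map_mul, CliffordAlgebra.involute_ι]
    simp only [mul_add, sub_mul, smul_mul_assoc, mul_assoc, neg_mul]
    abel

theorem contract_fst_mul (v : V₀) (x y : SAlg V₀ V₁) :
    contract (v, (0 : V₁)) (x * y) = contract (v, (0 : V₁)) x * y + x * contract (v, (0 : V₁)) y := by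
  induction x using TensorProduct.induction_on with
  | zero => simp
  | add a b ha hb => simp only [add_mul, map_add, ha, hb]; abel
  | tmul a b =>
    induction y using TensorProduct.induction_on with
    | zero => simp
    | add c d hc hd => simp only [mul_add, map_add, hc, hd]; abel
    | tmul c d =>
      simp [contract_fst_tmul, symDer_mul, TensorProduct.add_tmul]

theorem contract_snd_mul (v : V₁) (x y : SAlg V₀ V₁) :
    contract ((0 : V₀), v) (x * y) =
      contract ((0 : V₀), v) x * y + parityInv x * contract ((0 : V₀), v) y := by
  induction x using TensorProduct.induction_on with
  | zero => simp
  | add a b ha hb => simp only [add_mul, map_add, ha, hb]; abel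
  | tmul a b =>
    induction y using TensorProduct.induction_on with
    | zero => simp
    | add c d hc hd => simp only [mul_add, map_add, hc, hd]; abel
    | tmul c d =>
      simp [contract_snd_tmul, contractLeft_mul, TensorProduct.tmul_add, parityInv]

@[simp] theorem contract_one (v : V₀ × V₁) : contract v (1 : SAlg V₀ V₁) = 0 := by
  have h : v = (v.1, 0) + (0, v.2) := by simp
  have h0 : symDer v.1 1 = 0 := by simpa using symDer_algebraMap v.1 1
  rw [h, map_add, LinearMap.add_apply, Algebra.TensorProduct.one_def, contract_fst_tmul,
    contract_snd_tmul, CliffordAlgebra.contractLeft_one, h0, TensorProduct.zero_tmul,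
    TensorProduct.tmul_zero, add_zero]

theorem contract_evenGen (v : V₀ × V₁) (c) :
    contract v (evenGen c : SAlg V₀ V₁) = c v.1 • 1 := by
  have h : v = (v.1, 0) + (0, v.2) := by simp
  conv_lhs => rw [h, map_add, LinearMap.add_apply, evenGen_apply, contract_fst_tmul,
    contract_snd_tmul, CliffordAlgebra.contractLeft_one, symDer_ι]
  rw [TensorProduct.tmul_zero, add_zero, Algebra.algebraMap_eq_smul_one, ← TensorProduct.smul_tmul']
  rfl

theorem contract_oddGen (v : V₀ × V₁) (c) :
    contract v (oddGen c : SAlg V₀ V₁) = c v.2 • 1 := by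
  have h : v = (v.1, 0) + (0, v.2) := by simp
  have h0 : symDer v.1 1 = 0 := by simpa using symDer_algebraMap v.1 1
  conv_lhs => rw [h, map_add, LinearMap.add_apply, oddGen_apply, contract_fst_tmul,
    contract_snd_tmul, h0]
  erw [CliffordAlgebra.contractLeft_ι]
  rw [TensorProduct.zero_tmul, zero_add, Algebra.algebraMap_eq_smul_one, TensorProduct.tmul_smul]
  rfl

theorem parityInv_contract_fst (v : V₀) (x : SAlg V₀ V₁) :
    parityInv (contract (v, (0 : V₁)) x) = contract (v, (0 : V₁)) (parityInv x) := by
  induction x using SAlg.induction with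
  | smul_one r => simp
  | even c => simp [contract_evenGen]
  | odd c => simp [contract_oddGen]
  | mul x y hx hy => simp [contract_fst_mul, hx, hy]
  | add x y hx hy => simp [hx, hy]

/-- Contraction with an odd vector lowers the exterior degree by one, hence the sign. -/
theorem parityInv_contract_snd (v : V₁) (x : SAlg V₀ V₁) :
    parityInv (contract ((0 : V₀), v) x) = (-1 : ℝ) • contract ((0 : V₀), v) (parityInv x) := by
  induction x using SAlg.induction with
  | smul_one r => simp
  | even c => simp [contract_evenGen]
  | odd c =>
    rw [parityInv_oddGen, map_smul, SAlg.neg_one_smul_neg_one_smul, contract_oddGen, map_smul, map_one]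
  | mul x y hx hy => rw [contract_snd_mul, map_add, map_mul, map_mul, hx, hy, map_mul,
      contract_snd_mul, smul_add, smul_mul_assoc, mul_smul_comm]
  | add x y hx hy => simp only [map_add, hx, hy, smul_add]

/-- Contractions are natural under isomorphisms. -/
theorem pull_contract (h₀ : W₀ →ₗ[ℝ] V₀) (h₁ : W₁ →ₗ[ℝ] V₁) (v : V₀ × V₁) (w : W₀ × W₁)
    (e₀ : h₀ w.1 = v.1) (e₁ : h₁ w.2 = v.2) (x : SAlg V₀ V₁) :
    pull h₀ h₁ (contract v x) = contract w (pull h₀ h₁ x) := by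
  obtain ⟨v₀, v₁⟩ := v
  obtain ⟨w₀, w₁⟩ := w
  simp only at e₀ e₁
  subst e₀ e₁
  have H₀ : pull h₀ h₁ (contract (h₀ w₀, (0 : V₁)) x) = contract (w₀, (0 : W₁)) (pull h₀ h₁ x) := by
    induction x using SAlg.induction with
    | smul_one r => simp
    | even c => simp [contract_evenGen]
    | odd c => simp [contract_oddGen]
    | mul x y hx hy => simp [contract_fst_mul, hx, hy]
    | add x y hx hy => simp [hx, hy]
  have H₁ : pull h₀ h₁ (contract ((0 : V₀), h₁ w₁) x) = contract ((0 : W₀), w₁) (pull h₀ h₁ x) := by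
    clear H₀
    induction x using SAlg.induction with
    | smul_one r => simp
    | even c => simp [contract_evenGen]
    | odd c => simp [contract_oddGen]
    | mul x y hx hy => simp [contract_snd_mul, hx, hy, parityInv_pull]
    | add x y hx hy => simp [hx, hy]
  have h : (h₀ w₀, h₁ w₁) = (h₀ w₀, (0 : V₁)) + ((0 : V₀), h₁ w₁) := by simp
  have h' : (w₀, w₁) = (w₀, (0 : W₁)) + ((0 : W₀), w₁) := by simp
  rw [h, h', map_add, map_add, LinearMap.add_apply, LinearMap.add_apply, map_add, H₀, H₁]

/-- The even derivation `∑ᵇ cᵇ ∂_{T e_b}` obtained from an endomorphism of `V₀ ⊕ V₁`. -/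
theorem even_contract_mul {β₀ β₁ : Type*} [Fintype β₀] [Fintype β₁] (c₀ : β₀ → Module.Dual ℝ V₀)
    (c₁ : β₁ → Module.Dual ℝ V₁) (X₀ : β₀ → V₀) (X₁ : β₁ → V₁) (x y : SAlg V₀ V₁) :
    (∑ b, evenGen (c₀ b) * contract (X₀ b, (0 : V₁)) (x * y) +
        ∑ b, oddGen (c₁ b) * contract ((0 : V₀), X₁ b) (x * y)) =
      (∑ b, evenGen (c₀ b) * contract (X₀ b, (0 : V₁)) x +
        ∑ b, oddGen (c₁ b) * contract ((0 : V₀), X₁ b) x) * y +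
      x * (∑ b, evenGen (c₀ b) * contract (X₀ b, (0 : V₁)) y +
        ∑ b, oddGen (c₁ b) * contract ((0 : V₀), X₁ b) y) := by
  -- Moving `x` past an odd generator produces `parityInv x`, the same factor that the odd
  -- contraction produces in front of `y`. The two signs cancel, and the total is an even
  -- derivation.
  simp only [contract_fst_mul, contract_snd_mul, mul_add, Finset.sum_add_distrib, add_mul,
    Finset.sum_mul, Finset.mul_sum, ← mul_assoc, evenGen_mul_comm _ x, mul_oddGen _ x]
  abel

end Algebra

/-! ### The fibre `∧V* ⊗ (V ⊕ M)` acting on one-jets. -/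

section JetAction

variable {V₀ V₁ W₀ W₁ : Type*} [AddCommGroup V₀] [Module ℝ V₀] [AddCommGroup V₁] [Module ℝ V₁]
  [AddCommGroup W₀] [Module ℝ W₀] [AddCommGroup W₁] [Module ℝ W₁]
  {M : Type*} [AddCommGroup M] [Module ℝ M]

/-- The value of `a ⊗ (v, t)`, read as `a (∂_t + ∂_v)`, on a function with value `x` and
differential `D`. -/
def jetAct (x : SAlg V₀ V₁) (D : M →ₗ[ℝ] SAlg V₀ V₁) :
    SAlg V₀ V₁ ⊗[ℝ] ((V₀ × V₁) × M) →ₗ[ℝ] SAlg V₀ V₁ :=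
  TensorProduct.lift ((LinearMap.mul ℝ (SAlg V₀ V₁)).compl₂
    (LinearMap.coprod ((contract (V₀ := V₀) (V₁ := V₁)).flip x) D))

theorem jetAct_tmul (x : SAlg V₀ V₁) (D : M →ₗ[ℝ] SAlg V₀ V₁) (a : SAlg V₀ V₁)
    (p : (V₀ × V₁) × M) : jetAct x D (a ⊗ₜ p) = a * (contract p.1 x + D p.2) := rfl

theorem act_eq_jetAct (dg : M →ₗ[ℝ] ℝ) (r : ℝ) (x : SAlg V₀ V₁) :
    act dg r x = jetAct (r • x) (dg.smulRight x) := by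
  rw [act, jetAct, map_smul]

theorem jetAct_add (x y : SAlg V₀ V₁) (D D' : M →ₗ[ℝ] SAlg V₀ V₁)
    (u : SAlg V₀ V₁ ⊗[ℝ] ((V₀ × V₁) × M)) :
    jetAct (x + y) (D + D') u = jetAct x D u + jetAct y D' u := by
  induction u using TensorProduct.induction_on with
  | zero => simp only [map_zero, add_zero]
  | add u v hu hv => rw [map_add, hu, hv, map_add, map_add]; abel
  | tmul a p => simp only [jetAct_tmul, map_add, LinearMap.add_apply, mul_add]; abel

theorem jetAct_smul (r : ℝ) (x : SAlg V₀ V₁) (D : M →ₗ[ℝ] SAlg V₀ V₁)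
    (u : SAlg V₀ V₁ ⊗[ℝ] ((V₀ × V₁) × M)) :
    jetAct (r • x) (r • D) u = r • jetAct x D u := by
  induction u using TensorProduct.induction_on with
  | zero => simp only [map_zero, smul_zero]
  | add u v hu hv => rw [map_add, hu, hv, map_add, smul_add]
  | tmul a p =>
    simp only [jetAct_tmul, map_smul, LinearMap.smul_apply, mul_add, smul_add, mul_smul_comm]

theorem jetAct_zero (u : SAlg V₀ V₁ ⊗[ℝ] ((V₀ × V₁) × M)) :
    jetAct (0 : SAlg V₀ V₁) (0 : M →ₗ[ℝ] SAlg V₀ V₁) u = 0 := by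
  have := jetAct_smul 0 (0 : SAlg V₀ V₁) (0 : M →ₗ[ℝ] SAlg V₀ V₁) u
  rwa [zero_smul, zero_smul, zero_smul] at this

theorem jetAct_sum {κ : Type*} (s : Finset κ) (x : κ → SAlg V₀ V₁) (D : κ → M →ₗ[ℝ] SAlg V₀ V₁)
    (u : SAlg V₀ V₁ ⊗[ℝ] ((V₀ × V₁) × M)) :
    jetAct (∑ k ∈ s, x k) (∑ k ∈ s, D k) u = ∑ k ∈ s, jetAct (x k) (D k) u := by
  classical
  induction s using Finset.induction_on with
  | empty => simp only [Finset.sum_empty, jetAct_zero]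
  | insert a s ha ih => simp only [Finset.sum_insert ha, jetAct_add, ih]

/-- The sum on the left depends only on the one-jet of `∑ g w`. This is why the local formula for a
derivation does not depend on how a section is decomposed. -/
theorem sum_act {κ : Type*} [Fintype κ] (dg : κ → M →ₗ[ℝ] ℝ) (r : κ → ℝ) (x : κ → SAlg V₀ V₁)
    (u : SAlg V₀ V₁ ⊗[ℝ] ((V₀ × V₁) × M)) :
    ∑ k, act (dg k) (r k) (x k) u =
      jetAct (∑ k, r k • x k) (∑ k, (dg k).smulRight (x k)) u := by
  simp only [act_eq_jetAct, jetAct_sum]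

theorem jetAct_rTensor_mulLeft (x : SAlg V₀ V₁) (D : M →ₗ[ℝ] SAlg V₀ V₁) (a : SAlg V₀ V₁)
    (u : SAlg V₀ V₁ ⊗[ℝ] ((V₀ × V₁) × M)) :
    jetAct x D (LinearMap.rTensor _ (LinearMap.mulLeft ℝ a) u) = a * jetAct x D u := by
  induction u using TensorProduct.induction_on with
  | zero => simp only [map_zero, mul_zero]
  | add u v hu hv => rw [map_add, map_add, hu, hv, map_add, mul_add]
  | tmul b p => rw [LinearMap.rTensor_tmul, jetAct_tmul, jetAct_tmul, LinearMap.mulLeft_apply, mul_assoc]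

/-- The parity involution of `∧V* ⊗ (V ⊕ M)`. -/
def parityW : SAlg V₀ V₁ ⊗[ℝ] ((V₀ × V₁) × M) →ₗ[ℝ] SAlg V₀ V₁ ⊗[ℝ] ((V₀ × V₁) × M) :=
  TensorProduct.map parityInv.toLinearMap
    (LinearMap.prodMap (LinearMap.prodMap LinearMap.id ((-1 : ℝ) • LinearMap.id)) LinearMap.id)

theorem parityW_tmul (a : SAlg V₀ V₁) (v₀ : V₀) (v₁ : V₁) (t : M) :
    parityW (a ⊗ₜ[ℝ] ((v₀, v₁), t)) = parityInv a ⊗ₜ[ℝ] ((v₀, (-1 : ℝ) • v₁), t) := rfl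

theorem contract_eq_add (v₀ : V₀) (v₁ : V₁) (x : SAlg V₀ V₁) :
    contract (v₀, v₁) x = contract (v₀, (0 : V₁)) x + contract ((0 : V₀), v₁) x := by
  rw [← LinearMap.add_apply, ← map_add]; simp

theorem jetAct_parityW (x : SAlg V₀ V₁) (D : M →ₗ[ℝ] SAlg V₀ V₁)
    (u : SAlg V₀ V₁ ⊗[ℝ] ((V₀ × V₁) × M)) :
    jetAct x D (parityW u) =
      parityInv (jetAct (parityInv x) (parityInv.toLinearMap ∘ₗ D) u) := by
  induction u using TensorProduct.induction_on with
  | zero => simp only [map_zero]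
  | add u v hu hv => rw [map_add, map_add, hu, hv, map_add, map_add]
  | tmul a p =>
    obtain ⟨⟨v₀, v₁⟩, t⟩ := p
    have h : contract ((0 : V₀), (-1 : ℝ) • v₁) x = (-1 : ℝ) • contract ((0 : V₀), v₁) x := by
      rw [← LinearMap.smul_apply, ← map_smul]; simp
    rw [parityW_tmul, jetAct_tmul, jetAct_tmul, map_mul, map_add, contract_eq_add,
      contract_eq_add v₀ v₁, map_add, parityInv_contract_fst, parityInv_contract_snd,
      parityInv_parityInv, h, LinearMap.comp_apply, AlgHom.toLinearMap_apply, parityInv_parityInv]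

/-- The differential of a product of functions with given values and differentials. -/
def mulDeriv {A : Type*} [Ring A] [Algebra ℝ A] (x : A) (D : M →ₗ[ℝ] A) (y : A)
    (D' : M →ₗ[ℝ] A) : M →ₗ[ℝ] A :=
  LinearMap.mulRight ℝ y ∘ₗ D + LinearMap.mulLeft ℝ x ∘ₗ D'

theorem mulDeriv_apply {A : Type*} [Ring A] [Algebra ℝ A] (x : A) (D : M →ₗ[ℝ] A) (y : A)
    (D' : M →ₗ[ℝ] A) (t : M) : mulDeriv x D y D' t = D t * y + x * D' t := rfl

/-- Here `σ` is what `x` becomes when `a` is moved past it; keeping it abstract lets one computation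
serve even and odd `a`. -/
theorem jetAct_mul_tmul_fst (x y : SAlg V₀ V₁) (D D' : M →ₗ[ℝ] SAlg V₀ V₁) {a : SAlg V₀ V₁} {σ}
    (hσ : a * x = σ * a) (v₀ : V₀) (t : M) :
    jetAct (x * y) (mulDeriv x D y D') (a ⊗ₜ ((v₀, 0), t)) =
      jetAct x D (a ⊗ₜ ((v₀, 0), t)) * y + σ * jetAct y D' (a ⊗ₜ ((v₀, 0), t)) := by
  simp only [jetAct_tmul, contract_fst_mul, mulDeriv_apply, mul_add, add_mul, ← mul_assoc, ← hσ]
  abel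

theorem jetAct_mul_tmul_snd (x y : SAlg V₀ V₁) (D D' : M →ₗ[ℝ] SAlg V₀ V₁) {a : SAlg V₀ V₁} {σ}
    (hσ : a * parityInv x = σ * a) (v₁ : V₁) :
    jetAct (x * y) (mulDeriv x D y D') (a ⊗ₜ ((0, v₁), 0)) =
      jetAct x D (a ⊗ₜ ((0, v₁), 0)) * y + σ * jetAct y D' (a ⊗ₜ ((0, v₁), 0)) := by
  simp only [jetAct_tmul, contract_snd_mul, mul_add, map_zero, add_zero, ← mul_assoc, ← hσ]

/-- For `r = ±1` the even and the odd directions receive coefficients of opposite parities, so both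
summands act as derivations of the same total parity. -/
theorem add_parityW_tmul (r : ℝ) (a : SAlg V₀ V₁) (v₀ : V₀) (v₁ : V₁) (t : M) :
    a ⊗ₜ[ℝ] ((v₀, v₁), t) + r • parityW (a ⊗ₜ[ℝ] ((v₀, v₁), t)) =
      (a + r • parityInv a) ⊗ₜ[ℝ] ((v₀, 0), t) + (a + (-r) • parityInv a) ⊗ₜ ((0, v₁), 0) := by
  have h1 : ((v₀, v₁), t) = ((v₀, (0 : V₁)), t) + (((0 : V₀), v₁), (0 : M)) := by simp
  have h2 : ((v₀, (-1 : ℝ) • v₁), t) =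
      ((v₀, (0 : V₁)), t) + (-1 : ℝ) • (((0 : V₀), v₁), (0 : M)) := by simp
  rw [parityW_tmul, h2, h1]
  simp only [TensorProduct.tmul_add, TensorProduct.add_tmul, TensorProduct.tmul_smul,
    ← TensorProduct.smul_tmul', smul_add, smul_smul, mul_neg, mul_one]
  abel

theorem parityInv_add_smul (r : ℝ) (hr : r * r = 1) (a : SAlg V₀ V₁) :
    parityInv (a + r • parityInv a) = r • (a + r • parityInv a) := by
  rw [map_add, map_smul, parityInv_parityInv, smul_add, smul_smul, hr, one_smul, add_comm]

/-- An even element of `∧V* ⊗ (V ⊕ M)` acts as an even derivation. -/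
theorem jetAct_mul_even {u : SAlg V₀ V₁ ⊗[ℝ] ((V₀ × V₁) × M)} (hu : parityW u = u)
    (x y : SAlg V₀ V₁) (D D' : M →ₗ[ℝ] SAlg V₀ V₁) :
    jetAct (x * y) (mulDeriv x D y D') u = jetAct x D u * y + x * jetAct y D' u := by
  -- The claim is proved for symmetrized tensors, where induction on pure tensors is possible: the
  -- condition `parityW u = u` itself does not pass to the summands of `u`.
  have key : ∀ u : SAlg V₀ V₁ ⊗[ℝ] ((V₀ × V₁) × M),
      jetAct (x * y) (mulDeriv x D y D') (u + (1 : ℝ) • parityW u) =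
        jetAct x D (u + (1 : ℝ) • parityW u) * y + x * jetAct y D' (u + (1 : ℝ) • parityW u) := by
    intro u
    induction u using TensorProduct.induction_on with
    | zero => simp only [map_zero, smul_zero, add_zero, zero_mul, mul_zero]
    | add u v hu hv =>
      have : u + v + (1 : ℝ) • parityW (u + v) =
        (u + (1 : ℝ) • parityW u) + (v + (1 : ℝ) • parityW v) := by rw [map_add, smul_add]; abel
      rw [this]
      generalize u + (1 : ℝ) • parityW u = u' at hu ⊢
      generalize v + (1 : ℝ) • parityW v = v' at hv ⊢
      rw [map_add, hu, hv, map_add, map_add, add_mul, mul_add]; abel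
    | tmul a p =>
      obtain ⟨⟨v₀, v₁⟩, t⟩ := p
      have h0 := (parityInv_add_smul 1 (by norm_num) a).trans (one_smul _ _)
      have h1 := parityInv_add_smul (-1) (by norm_num) a
      rw [add_parityW_tmul, map_add, jetAct_mul_tmul_fst x y D D' (even_mul_comm h0 x),
        jetAct_mul_tmul_snd (σ := x) x y D D' (by rw [odd_mul_comm h1, parityInv_parityInv]), map_add,
        map_add, add_mul, mul_add]
      abel
  -- A fixed vector of `parityW` is the symmetrization of its half.
  have h := key ((1 / 2 : ℝ) • u)
  have e : (1 / 2 : ℝ) • u + (1 : ℝ) • parityW ((1 / 2 : ℝ) • u) = u := by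
    rw [map_smul, hu, one_smul, ← add_smul]; norm_num
  rwa [e] at h

/-- An odd element of `∧V* ⊗ (V ⊕ M)` acts as an odd derivation. -/
theorem jetAct_mul_odd {u : SAlg V₀ V₁ ⊗[ℝ] ((V₀ × V₁) × M)} (hu : parityW u = (-1 : ℝ) • u)
    (x y : SAlg V₀ V₁) (D D' : M →ₗ[ℝ] SAlg V₀ V₁) :
    jetAct (x * y) (mulDeriv x D y D') u = jetAct x D u * y + parityInv x * jetAct y D' u := by
  have key : ∀ u : SAlg V₀ V₁ ⊗[ℝ] ((V₀ × V₁) × M),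
      jetAct (x * y) (mulDeriv x D y D') (u + (-1 : ℝ) • parityW u) =
        jetAct x D (u + (-1 : ℝ) • parityW u) * y +
          parityInv x * jetAct y D' (u + (-1 : ℝ) • parityW u) := by
    intro u
    induction u using TensorProduct.induction_on with
    | zero => simp only [map_zero, smul_zero, add_zero, zero_mul, mul_zero]
    | add u v hu hv =>
      have : u + v + (-1 : ℝ) • parityW (u + v) =
        (u + (-1 : ℝ) • parityW u) + (v + (-1 : ℝ) • parityW v) := by rw [map_add, smul_add]; abel
      rw [this]
      generalize u + (-1 : ℝ) • parityW u = u' at hu ⊢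
      generalize v + (-1 : ℝ) • parityW v = v' at hv ⊢
      rw [map_add, hu, hv, map_add, map_add, add_mul, mul_add]; abel
    | tmul a p =>
      obtain ⟨⟨v₀, v₁⟩, t⟩ := p
      have h0 := (parityInv_add_smul 1 (by norm_num) a).trans (one_smul _ _)
      have h1 := parityInv_add_smul (-1) (by norm_num) a
      rw [add_parityW_tmul, neg_neg, map_add, jetAct_mul_tmul_fst x y D D' (odd_mul_comm h1 x),
        jetAct_mul_tmul_snd x y D D' (even_mul_comm h0 _), map_add,
        map_add, add_mul, mul_add]
      abel
  -- A vector negated by `parityW` is the antisymmetrization of its half.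
  have h := key ((1 / 2 : ℝ) • u)
  have e : (1 / 2 : ℝ) • u + (-1 : ℝ) • parityW ((1 / 2 : ℝ) • u) = u := by
    rw [map_smul, hu, smul_smul, smul_smul, ← add_smul]; norm_num
  rwa [e] at h

/-! ### Recovering a fibre element from its values on generators and coordinates. -/

section FiniteDim

variable [FiniteDimensional ℝ V₀] [FiniteDimensional ℝ V₁] [FiniteDimensional ℝ M]

/-- An element of `∧V* ⊗ (V ⊕ M)` with given values on the fibre coordinates and on the coordinates
of `M`. -/
def ofValues {A : Type*} [AddCommGroup A] [Module ℝ A] (p : Module.Dual ℝ V₀ → A)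
    (q : Module.Dual ℝ V₁ → A) (r : Module.Dual ℝ M → A) : A ⊗[ℝ] ((V₀ × V₁) × M) :=
  ∑ b, p ((Module.finBasis ℝ V₀).coord b) ⊗ₜ[ℝ] ((Module.finBasis ℝ V₀ b, (0 : V₁)), (0 : M)) +
  ∑ b, q ((Module.finBasis ℝ V₁).coord b) ⊗ₜ[ℝ] (((0 : V₀), Module.finBasis ℝ V₁ b), (0 : M)) +
  ∑ b, r ((Module.finBasis ℝ M).coord b) ⊗ₜ[ℝ] (((0 : V₀), (0 : V₁)), Module.finBasis ℝ M b)

/-- On the jet of a generator `c`, the element `a ⊗ (v, t)` gives `a` times the value of `c` on `v`;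
on the jet of a linear coordinate `l` it gives `a` times `l t`. Expanding `(v, t)` in bases then
rebuilds the tensor. -/
theorem ofValues_jetAct (u : SAlg V₀ V₁ ⊗[ℝ] ((V₀ × V₁) × M)) :
    ofValues (fun c => jetAct (evenGen c) 0 u) (fun c => jetAct (oddGen c) 0 u)
      (fun l => jetAct 0 (l.smulRight 1) u) = u := by
  induction u using TensorProduct.induction_on with
  | zero => simp [ofValues]
  | add u v hu hv =>
    conv_rhs => rw [← hu, ← hv]
    simp only [ofValues, map_add, TensorProduct.add_tmul, Finset.sum_add_distrib]
    abel
  | tmul a p =>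
    obtain ⟨⟨v₀, v₁⟩, t⟩ := p
    simp only [ofValues, jetAct_tmul, contract_evenGen, contract_oddGen, LinearMap.zero_apply,
      add_zero, zero_add, map_zero, LinearMap.smulRight_apply, mul_smul_comm, mul_one,
      TensorProduct.smul_tmul, ← TensorProduct.tmul_sum, ← TensorProduct.tmul_add]
    congr 1
    refine Prod.ext (Prod.ext ?_ ?_) ?_
    all_goals simp [Prod.fst_sum, Prod.snd_sum]

theorem jetAct_ext {u u' : SAlg V₀ V₁ ⊗[ℝ] ((V₀ × V₁) × M)}
    (h₀ : ∀ c, jetAct (evenGen c) 0 u = jetAct (evenGen c) 0 u')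
    (h₁ : ∀ c, jetAct (oddGen c) 0 u = jetAct (oddGen c) 0 u')
    (h : ∀ l : Module.Dual ℝ M, jetAct 0 (l.smulRight 1) u = jetAct 0 (l.smulRight 1) u') :
    u = u' := by
  rw [← ofValues_jetAct u, ← ofValues_jetAct u']
  simp only [h₀, h₁, h]

/-- The construction uses `p`, `q`, `r` on dual bases only; their linearity extends the agreement to
all functionals. -/
theorem jetAct_ofValues (p : Module.Dual ℝ V₀ →ₗ[ℝ] SAlg V₀ V₁)
    (q : Module.Dual ℝ V₁ →ₗ[ℝ] SAlg V₀ V₁) (r : Module.Dual ℝ M →ₗ[ℝ] SAlg V₀ V₁)  :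
    (∀ c, jetAct (evenGen c) 0 (ofValues p q r) = p c) ∧
    (∀ c, jetAct (oddGen c) 0 (ofValues p q r) = q c) ∧
    ∀ l : Module.Dual ℝ M, jetAct 0 (l.smulRight 1) (ofValues p q r) = r l := by
  refine ⟨fun c => ?_, fun c => ?_, fun c => ?_⟩
  · simp only [ofValues, map_add, map_sum, jetAct_tmul, contract_evenGen, LinearMap.zero_apply,
      add_zero, map_zero, zero_smul, mul_zero, Finset.sum_const_zero, mul_smul_comm, mul_one]
    simp only [← map_smul, ← map_sum]
    congr 1
    exact (Module.finBasis ℝ V₀).sum_dual_apply_smul_coord c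
  · simp only [ofValues, map_add, map_sum, jetAct_tmul, contract_oddGen, LinearMap.zero_apply,
      add_zero, zero_add, map_zero, zero_smul, mul_zero, Finset.sum_const_zero, mul_smul_comm, mul_one]
    simp only [← map_smul, ← map_sum]
    congr 1
    exact (Module.finBasis ℝ V₁).sum_dual_apply_smul_coord c
  · simp only [ofValues, map_add, map_sum, jetAct_tmul, LinearMap.smulRight_apply,
      add_zero, zero_add, map_zero, mul_zero, Finset.sum_const_zero, mul_smul_comm, mul_one]
    simp only [← map_smul, ← map_sum]
    congr 1
    exact (Module.finBasis ℝ M).sum_dual_apply_smul_coord c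

/-- The sign for `q` is opposite because `parityW` also negates the odd basis vectors. -/
theorem parityW_ofValues (ε : ℝ) {p : Module.Dual ℝ V₀ → SAlg V₀ V₁}
    {q : Module.Dual ℝ V₁ → SAlg V₀ V₁} {r : Module.Dual ℝ M → SAlg V₀ V₁}
    (hp : ∀ c, parityInv (p c) = ε • p c) (hq : ∀ c, parityInv (q c) = (-ε) • q c)
    (hr : ∀ c, parityInv (r c) = ε • r c) :
    parityW (ofValues p q r) = ε • ofValues p q r := by
  have hs : ∀ (v : V₁), ((((0 : V₀), (-1 : ℝ) • v), (0 : M)) : (V₀ × V₁) × M) =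
    (-1 : ℝ) • (((0 : V₀), v), (0 : M)) := by simp
  simp only [ofValues, map_add, map_sum, parityW_tmul, hp, hq, hr, smul_add, Finset.smul_sum,
    TensorProduct.smul_tmul', smul_zero, hs, TensorProduct.tmul_smul, smul_smul]
  simp

end FiniteDim

/-! ### The filtration of `∧V*` by powers of the span of `1` and the generators. -/

section Filtration

theorem monotone_submodule_pow {A : Type*} [Semiring A] [Algebra ℝ A] {D : Submodule ℝ A}
    (h : 1 ≤ D) : Monotone fun n : ℕ => D ^ n :=
  monotone_nat_of_le_succ fun n => by
    rw [pow_succ]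
    calc D ^ n = D ^ n * 1 := (mul_one _).symm
      _ ≤ _ := mul_le_mul' le_rfl h

theorem mul_mem_submodule_pow {A : Type*} [Semiring A] [Algebra ℝ A] {D : Submodule ℝ A}
    {x y : A} {n m : ℕ} (hx : x ∈ D ^ n) (hy : y ∈ D ^ m) : x * y ∈ D ^ (n + m) := by
  rw [pow_add]; exact Submodule.mul_mem_mul hx hy

theorem mem_submodule_pow_one {A : Type*} [Semiring A] [Algebra ℝ A] {D : Submodule ℝ A}
    {x : A} (hx : x ∈ D) : x ∈ D ^ 1 := by
  rwa [pow_one]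

theorem smul_one_mem_submodule_pow_zero {A : Type*} [Semiring A] [Algebra ℝ A] {D : Submodule ℝ A}
    (r : ℝ) : r • (1 : A) ∈ D ^ 0 := by
  rw [pow_zero]; exact Submodule.smul_mem _ _ (Submodule.one_le.mp le_rfl)

theorem algHom_mem_submodule_pow {A B : Type*} [Semiring A] [Algebra ℝ A] [Semiring B] [Algebra ℝ B]
    {D : Submodule ℝ A} {D' : Submodule ℝ B} (f : A →ₐ[ℝ] B) (h : D.map f.toLinearMap ≤ D')
    {x : A} {n : ℕ} (hx : x ∈ D ^ n) : f x ∈ D' ^ n := by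
  have h2 := Submodule.mem_map_of_mem (f := f.toLinearMap) hx
  rw [Submodule.map_pow] at h2
  exact pow_left_mono n h h2

theorem fg_submodule_one {A : Type*} [Semiring A] [Algebra ℝ A] : (1 : Submodule ℝ A).FG := by
  rw [Submodule.one_eq_span]; exact Submodule.fg_span_singleton _

variable (V₀ V₁)

/-- The span of `1` and of the generators of `∧V*`. -/
def genSpan : Submodule ℝ (SAlg V₀ V₁) :=
  1 ⊔ (LinearMap.range evenGen ⊔ LinearMap.range oddGen)

theorem one_le_genSpan : 1 ≤ genSpan V₀ V₁ := le_sup_left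

variable {V₀ V₁}

theorem evenGen_mem_genSpan (c) : evenGen c ∈ genSpan V₀ V₁ :=
  (le_sup_left.trans le_sup_right : LinearMap.range evenGen ≤ genSpan V₀ V₁) ⟨c, rfl⟩

theorem oddGen_mem_genSpan (c) : oddGen c ∈ genSpan V₀ V₁ :=
  (le_sup_right.trans le_sup_right : LinearMap.range oddGen ≤ genSpan V₀ V₁) ⟨c, rfl⟩

theorem monotone_genSpan_pow : Monotone fun n : ℕ => genSpan V₀ V₁ ^ n :=
  monotone_submodule_pow (one_le_genSpan V₀ V₁)

theorem exists_mem_genSpan_pow (x : SAlg V₀ V₁) : ∃ n : ℕ, x ∈ genSpan V₀ V₁ ^ n := by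
  induction x using SAlg.induction with
  | smul_one r =>
    exact ⟨0, smul_one_mem_submodule_pow_zero r⟩
  | even c => exact ⟨1, mem_submodule_pow_one (evenGen_mem_genSpan c)⟩
  | odd c => exact ⟨1, mem_submodule_pow_one (oddGen_mem_genSpan c)⟩
  | mul x y hx hy =>
    obtain ⟨n, hn⟩ := hx
    obtain ⟨m, hm⟩ := hy
    exact ⟨n + m, mul_mem_submodule_pow hn hm⟩
  | add x y hx hy =>
    obtain ⟨n, hn⟩ := hx
    obtain ⟨m, hm⟩ := hy
    exact ⟨max n m, Submodule.add_mem _ (monotone_genSpan_pow (le_max_left n m) hn)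
      (monotone_genSpan_pow (le_max_right n m) hm)⟩

theorem fg_genSpan [FiniteDimensional ℝ V₀] [FiniteDimensional ℝ V₁] : (genSpan V₀ V₁).FG := by
  refine Submodule.FG.sup fg_submodule_one (Submodule.FG.sup ?_ ?_)
  · rw [LinearMap.range_eq_map]; exact Module.Finite.fg_top.map _
  · rw [LinearMap.range_eq_map]; exact Module.Finite.fg_top.map _

/-- An algebra map that takes generators to generators does not increase the length of words. -/
theorem pull_mem_genSpan_pow (h₀ : W₀ →ₗ[ℝ] V₀) (h₁ : W₁ →ₗ[ℝ] V₁) {n : ℕ} {x : SAlg V₀ V₁}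
    (hx : x ∈ genSpan V₀ V₁ ^ n) : pull h₀ h₁ x ∈ genSpan W₀ W₁ ^ n := by
  have h : (genSpan V₀ V₁).map (pull h₀ h₁).toLinearMap ≤ genSpan W₀ W₁ := by
    rw [genSpan, Submodule.map_sup, Submodule.map_sup]
    refine sup_le ?_ (sup_le ?_ ?_)
    · rw [Submodule.map_one]; exact one_le_genSpan _ _
    · rintro _ ⟨_, ⟨c, rfl⟩, rfl⟩
      simpa using evenGen_mem_genSpan _
    · rintro _ ⟨_, ⟨c, rfl⟩, rfl⟩
      simpa using oddGen_mem_genSpan _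
  exact algHom_mem_submodule_pow _ h hx

end Filtration

end JetAction

/-! ### Germs of smooth maps into arbitrary real vector spaces. -/

section LocallyFinite

variable (M : Type*) [NormedAddCommGroup M] [NormedSpace ℝ M]
  {Z : Type*} [TopologicalSpace Z] [ChartedSpace M Z]
  {W W' W'' : Type*} [AddCommMonoid W] [Module ℝ W] [AddCommMonoid W'] [Module ℝ W']
  [AddCommMonoid W''] [Module ℝ W'']

/-- Smoothness near `x` of a map `h : Z → W` to a real vector space. -/
def LFAt (h : Z → W) (x : Z) : Prop :=
  ∃ (κ : Type) (_ : Fintype κ) (g : κ → Z → ℝ) (w : κ → W),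
    (∀ k, ∀ᶠ y in 𝓝 x, ContMDiffAt 𝓘(ℝ, M) 𝓘(ℝ, ℝ) ∞ (g k) y) ∧
    ∀ᶠ y in 𝓝 x, h y = ∑ k, g k y • w k

/-- Extension by zero of a map defined on a subset. -/
def ext0 {P : Z → Prop} (h : {z // P z} → W) (z : Z) : W :=
  open Classical in if hz : P z then h ⟨z, hz⟩ else 0

variable {M}

theorem ext0_of_mem {P : Z → Prop} (h : {z // P z} → W) (z : {z // P z}) :
    ext0 h z = h z := by
  simp [ext0, z.2]

/-- Smoothness depends on germs only, so near an interior point of the domain a partial map may be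
replaced by any total extension `H`. This avoids carrying subtypes through the calculus below. -/
theorem lfSmoothAt_iff {P : Z → Prop} {h : {z // P z} → W} {H : Z → W} {x : {z // P z}}
    (hP : ∀ᶠ z in 𝓝 (x : Z), P z) (hH : ∀ z : {z // P z}, H z = h z) :
    LFSmoothAt M h x ↔ LFAt M H (x : Z) := by
  constructor
  · rintro ⟨O, κ, _, g, w, hO, hx, hg, e⟩
    have hO' : ∀ᶠ y in 𝓝 (x : Z), y ∈ O := hO.mem_nhds hx
    refine ⟨κ, inferInstance, g, w, fun k => ?_, ?_⟩
    · filter_upwards [hO'] with y hy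
      exact (hg k).contMDiffAt (hO.mem_nhds hy)
    · filter_upwards [hO', hP] with y hy hy'
      rw [hH ⟨y, hy'⟩]; exact e ⟨y, hy'⟩ hy
  · rintro ⟨κ, _, g, w, hg, e⟩
    have h1 : ∀ᶠ y in 𝓝 (x : Z), (∀ k, ContMDiffAt 𝓘(ℝ, M) 𝓘(ℝ, ℝ) ∞ (g k) y) ∧
      H y = ∑ k, g k y • w k := (eventually_all.2 hg).and e
    obtain ⟨O, hO, hOo, hx⟩ := eventually_nhds_iff.1 h1
    exact ⟨O, κ, inferInstance, g, w, hOo, hx, fun k y hy => ((hO y hy).1 k).contMDiffWithinAt,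
      fun z hz => by rw [← hH]; exact (hO z hz).2⟩

theorem LFAt.lfSmoothAt {P : Z → Prop} {H : Z → W} {x : {z // P z}} (h : LFAt M H (x : Z))
    (hP : ∀ᶠ z in 𝓝 (x : Z), P z) : LFSmoothAt M (fun z : {z // P z} => H z) x :=
  (lfSmoothAt_iff hP fun _ => rfl).2 h

theorem LFSmoothAt.lfAt {P : Z → Prop} {h : {z // P z} → W} {x : {z // P z}}
    (H : LFSmoothAt M h x) (hP : ∀ᶠ z in 𝓝 (x : Z), P z) : LFAt M (ext0 h) (x : Z) :=
  (lfSmoothAt_iff hP (ext0_of_mem h)).1 H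

theorem LFAt.eventually {h : Z → W} {x : Z} (H : LFAt M h x) : ∀ᶠ y in 𝓝 x, LFAt M h y := by
  obtain ⟨κ, _, g, w, hg, e⟩ := H
  have h1 := (eventually_all.2 hg).eventually_nhds
  filter_upwards [h1, e.eventually_nhds] with y hy hy'
  exact ⟨κ, inferInstance, g, w, fun k => hy.mono fun z hz => hz k, hy'⟩

theorem LFAt.congr {h h' : Z → W} {x : Z} (H : LFAt M h x) (e : ∀ᶠ y in 𝓝 x, h' y = h y) :
    LFAt M h' x := by
  obtain ⟨κ, _, g, w, hg, e'⟩ := H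
  refine ⟨κ, inferInstance, g, w, hg, ?_⟩
  filter_upwards [e, e'] with y h1 h2
  rw [h1, h2]

theorem LFAt.smul_const {g : Z → ℝ} {x : Z}
    (hg : ∀ᶠ y in 𝓝 x, ContMDiffAt 𝓘(ℝ, M) 𝓘(ℝ, ℝ) ∞ g y) (w : W) :
    LFAt M (fun y => g y • w) x :=
  ⟨Unit, inferInstance, fun _ => g, fun _ => w, fun _ => hg, Eventually.of_forall fun _ => by simp⟩

theorem LFAt.const (w : W) (x : Z) : LFAt M (fun _ : Z => w) x :=
  (LFAt.smul_const (g := fun _ => 1) (Eventually.of_forall fun _ => contMDiffAt_const) w).congr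
    (Eventually.of_forall fun _ => (one_smul _ _).symm)

theorem LFAt.add {h h' : Z → W} {x : Z} (H : LFAt M h x) (H' : LFAt M h' x) :
    LFAt M (fun y => h y + h' y) x := by
  obtain ⟨κ, _, g, w, hg, e⟩ := H
  obtain ⟨κ', _, g', w', hg', e'⟩ := H'
  refine ⟨κ ⊕ κ', inferInstance, Sum.elim g g', Sum.elim w w', ?_, ?_⟩
  · rintro (k | k)
    exacts [hg k, hg' k]
  · filter_upwards [e, e'] with y h1 h2
    simp [h1, h2]

theorem LFAt.sum {β : Type*} (s : Finset β) {h : β → Z → W} {x : Z}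
    (H : ∀ b ∈ s, LFAt M (h b) x) : LFAt M (fun y => ∑ b ∈ s, h b y) x := by
  classical
  induction s using Finset.induction_on with
  | empty => simpa using LFAt.const (M := M) (0 : W) x
  | insert b s hb ih =>
    simp only [Finset.sum_insert hb]
    exact (H b (by simp)).add (ih fun c hc => H c (by simp [hc]))

theorem LFAt.bilin {h : Z → W} {h' : Z → W'} {x : Z} (B : W →ₗ[ℝ] W' →ₗ[ℝ] W'')
    (H : LFAt M h x) (H' : LFAt M h' x) : LFAt M (fun y => B (h y) (h' y)) x := by
  obtain ⟨κ, _, g, w, hg, e⟩ := H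
  obtain ⟨κ', _, g', w', hg', e'⟩ := H'
  refine ⟨κ × κ', inferInstance, fun k y => g k.1 y * g' k.2 y, fun k => B (w k.1) (w' k.2), ?_, ?_⟩
  · intro k
    filter_upwards [hg k.1, hg' k.2] with y h1 h2
    exact h1.mul h2
  · filter_upwards [e, e'] with y h1 h2
    rw [h1, h2, map_sum B, LinearMap.sum_apply, Fintype.sum_prod_type]
    refine Finset.sum_congr rfl fun k _ => ?_
    rw [map_sum]
    refine Finset.sum_congr rfl fun k' _ => ?_
    rw [map_smul, map_smul, LinearMap.smul_apply, smul_smul, mul_comm]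

theorem LFAt.map {h : Z → W} {x : Z} (H : LFAt M h x) (φ : W →ₗ[ℝ] W') :
    LFAt M (fun y => φ (h y)) x := by
  obtain ⟨κ, _, g, w, hg, e⟩ := H
  exact ⟨κ, inferInstance, g, fun k => φ (w k), hg, e.mono fun y hy => by simp [hy]⟩

theorem LFAt.mul {A : Type*} [Ring A] [Algebra ℝ A] {h h' : Z → A} {x : Z} (H : LFAt M h x)
    (H' : LFAt M h' x) : LFAt M (fun y => h y * h' y) x :=
  H.bilin (LinearMap.mul ℝ A) H'

theorem LFAt.smul {h : Z → W} {g : Z → ℝ} {x : Z}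
    (hg : ∀ᶠ y in 𝓝 x, ContMDiffAt 𝓘(ℝ, M) 𝓘(ℝ, ℝ) ∞ g y) (H : LFAt M h x) :
    LFAt M (fun y => g y • h y) x := by
  have h1 := LFAt.smul_const (M := M) hg (1 : ℝ)
  exact (h1.bilin (LinearMap.lsmul ℝ W) H).congr
    (Eventually.of_forall fun y => by simp)

theorem LFAt.of_contMDiffAt {F : Type*} [NormedAddCommGroup F] [NormedSpace ℝ F]
    [FiniteDimensional ℝ F] {f : Z → F} {x : Z}
    (hf : ∀ᶠ y in 𝓝 x, ContMDiffAt 𝓘(ℝ, M) 𝓘(ℝ, F) ∞ f y) : LFAt M f x := by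
  refine ⟨Fin (Module.finrank ℝ F), inferInstance, fun k y => (Module.finBasis ℝ F).coord k (f y),
    fun k => Module.finBasis ℝ F k, fun k => ?_,
    Eventually.of_forall fun y => ((Module.finBasis ℝ F).sum_repr (f y)).symm⟩
  filter_upwards [hf] with y hy
  exact (((Module.finBasis ℝ F).coord k).toContinuousLinearMap.contMDiff.contMDiffAt).comp y hy

end LocallyFinite

/-! ### Differentials of such maps in a chart. -/

section Differential

variable {M : Type*} [NormedAddCommGroup M] [NormedSpace ℝ M]
  {Z : Type*} [TopologicalSpace Z] [ChartedSpace M Z]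
  {W W' : Type*} [AddCommMonoid W] [Module ℝ W] [AddCommMonoid W'] [Module ℝ W']

/-- The differential at `z` of a real function, in the chart `φ`. -/
def chartDeriv (φ : OpenPartialHomeomorph Z M) (g : Z → ℝ) (z : Z) : M →ₗ[ℝ] ℝ :=
  (fderiv ℝ (fun y => g (φ.symm y)) (φ z) : M →L[ℝ] ℝ)

/-- `D` is the differential at `z`, in the chart `φ`, of the map `h`, which near `z` is a finite sum
of smooth functions times constant vectors. -/
def HasLD (φ : OpenPartialHomeomorph Z M) (h : Z → W) (z : Z) (D : M →ₗ[ℝ] W) : Prop :=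
  ∃ (κ : Type) (_ : Fintype κ) (g : κ → Z → ℝ) (w : κ → W),
    (∀ k, ContMDiffAt 𝓘(ℝ, M) 𝓘(ℝ, ℝ) ∞ (g k) z) ∧ (∀ᶠ y in 𝓝 z, h y = ∑ k, g k y • w k) ∧
    D = ∑ k, (chartDeriv φ (g k) z).smulRight (w k)

/-- The differential at `z` in the chart `φ`. -/
def lDeriv (φ : OpenPartialHomeomorph Z M) (h : Z → W) (z : Z) : M →ₗ[ℝ] W :=
  -- The default value `0` is never met where `LFAt M h z` holds.
  open Classical in if H : ∃ D, HasLD φ h z D then H.choose else 0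

theorem LFAt.hasLD {h : Z → W} {z : Z} (H : LFAt M h z) (φ : OpenPartialHomeomorph Z M) :
    HasLD φ h z (lDeriv φ h z) := by
  have : ∃ D, HasLD φ h z D := by
    obtain ⟨κ, _, g, w, hg, e⟩ := H
    exact ⟨_, κ, inferInstance, g, w, fun k => (hg k).self_of_nhds, e, rfl⟩
  rw [lDeriv, dif_pos this]
  exact this.choose_spec

theorem HasLD.congr {φ : OpenPartialHomeomorph Z M} {h h' : Z → W} {z : Z} {D : M →ₗ[ℝ] W}
    (H : HasLD φ h z D) (e : ∀ᶠ y in 𝓝 z, h' y = h y) : HasLD φ h' z D := by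
  obtain ⟨κ, _, g, w, hg, e', hD⟩ := H
  refine ⟨κ, inferInstance, g, w, hg, ?_, hD⟩
  filter_upwards [e, e'] with y h1 h2
  rw [h1, h2]

theorem HasLD.smul_const (φ : OpenPartialHomeomorph Z M) {g : Z → ℝ} {z : Z}
    (hg : ContMDiffAt 𝓘(ℝ, M) 𝓘(ℝ, ℝ) ∞ g z) (w : W) :
    HasLD φ (fun y => g y • w) z ((chartDeriv φ g z).smulRight w) :=
  ⟨Unit, inferInstance, fun _ => g, fun _ => w, fun _ => hg, Eventually.of_forall fun _ => by simp,
    by simp⟩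

theorem chartDeriv_const (φ : OpenPartialHomeomorph Z M) (r : ℝ) (z : Z) :
    chartDeriv φ (fun _ => r) z = 0 := by
  simp [chartDeriv]

theorem HasLD.const (φ : OpenPartialHomeomorph Z M) (w : W) (z : Z) :
    HasLD φ (fun _ => w) z 0 := by
  have := HasLD.smul_const φ (g := fun _ => 1) (z := z) contMDiffAt_const w
  rw [chartDeriv_const] at this
  have h0 : (0 : M →ₗ[ℝ] ℝ).smulRight w = 0 := by ext; simp
  rw [h0] at this
  exact this.congr (Eventually.of_forall fun _ => (one_smul _ _).symm)

theorem HasLD.add {φ : OpenPartialHomeomorph Z M} {h h' : Z → W} {z : Z} {D D' : M →ₗ[ℝ] W}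
    (H : HasLD φ h z D) (H' : HasLD φ h' z D') : HasLD φ (fun y => h y + h' y) z (D + D') := by
  obtain ⟨κ, _, g, w, hg, e, rfl⟩ := H
  obtain ⟨κ', _, g', w', hg', e', rfl⟩ := H'
  refine ⟨κ ⊕ κ', inferInstance, Sum.elim g g', Sum.elim w w', ?_, ?_, ?_⟩
  · rintro (k | k)
    exacts [hg k, hg' k]
  · filter_upwards [e, e'] with y h1 h2
    simp [h1, h2]
  · simp

theorem HasLD.sum {β : Type*} (s : Finset β) {φ : OpenPartialHomeomorph Z M} {h : β → Z → W} {z : Z}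
    {D : β → M →ₗ[ℝ] W} (H : ∀ b ∈ s, HasLD φ (h b) z (D b)) :
    HasLD φ (fun y => ∑ b ∈ s, h b y) z (∑ b ∈ s, D b) := by
  classical
  induction s using Finset.induction_on with
  | empty => simpa using HasLD.const φ (0 : W) z
  | insert b s hb ih =>
    simp only [Finset.sum_insert hb]
    exact (H b (by simp)).add (ih fun c hc => H c (by simp [hc]))

theorem HasLD.map {φ : OpenPartialHomeomorph Z M} {h : Z → W} {z : Z} {D : M →ₗ[ℝ] W}
    (H : HasLD φ h z D) (ψ : W →ₗ[ℝ] W') : HasLD φ (fun y => ψ (h y)) z (ψ ∘ₗ D) := by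
  obtain ⟨κ, _, g, w, hg, e, rfl⟩ := H
  refine ⟨κ, inferInstance, g, fun k => ψ (w k), hg, e.mono fun y hy => by simp [hy], ?_⟩
  ext t
  simp

section Atlas

variable [IsManifold 𝓘(ℝ, M) ∞ Z] {φ φ' : OpenPartialHomeomorph Z M}

theorem contDiffAt_comp_chart_symm {G : Type*} [NormedAddCommGroup G] [NormedSpace ℝ G]
    (hφ : φ ∈ atlas M Z) {g : Z → G} {z : Z} (hz : z ∈ φ.source)
    (hg : ContMDiffAt 𝓘(ℝ, M) 𝓘(ℝ, G) ∞ g z) :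
    ContDiffAt ℝ ∞ (fun y => g (φ.symm y)) (φ z) := by
  rw [← contMDiffAt_iff_contDiffAt]
  have h1 : ContMDiffAt 𝓘(ℝ, M) 𝓘(ℝ, M) ∞ φ.symm (φ z) :=
    contMDiffAt_symm_of_mem_maximalAtlas (IsManifold.subset_maximalAtlas hφ) (φ.map_source hz)
  have h2 : ContMDiffAt 𝓘(ℝ, M) 𝓘(ℝ, G) ∞ g (φ.symm (φ z)) := by rwa [φ.left_inv hz]
  exact h2.comp (φ z) h1

theorem contMDiffAt_chart (hφ : φ ∈ atlas M Z) {z : Z} (hz : z ∈ φ.source) :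
    ContMDiffAt 𝓘(ℝ, M) 𝓘(ℝ, M) ∞ φ z :=
  contMDiffAt_of_mem_maximalAtlas (IsManifold.subset_maximalAtlas hφ) hz

theorem differentiableAt_comp_chart_symm {G : Type*} [NormedAddCommGroup G] [NormedSpace ℝ G]
    (hφ : φ ∈ atlas M Z) {g : Z → G} {z : Z} (hz : z ∈ φ.source)
    (hg : ContMDiffAt 𝓘(ℝ, M) 𝓘(ℝ, G) ∞ g z) :
    DifferentiableAt ℝ (fun y => g (φ.symm y)) (φ z) :=
  (contDiffAt_comp_chart_symm hφ hz hg).differentiableAt (by simp)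

theorem contMDiffAt_fderiv_chart {G : Type*} [NormedAddCommGroup G] [NormedSpace ℝ G]
    (hφ : φ ∈ atlas M Z) {g : Z → G} {z : Z} (hz : z ∈ φ.source)
    (hg : ContMDiffAt 𝓘(ℝ, M) 𝓘(ℝ, G) ∞ g z) :
    ContMDiffAt 𝓘(ℝ, M) 𝓘(ℝ, M →L[ℝ] G) ∞
      (fun z => fderiv ℝ (fun y => g (φ.symm y)) (φ z)) z := by
  have h1 : ContDiffAt ℝ ∞ (fderiv ℝ (fun y => g (φ.symm y))) (φ z) :=
    (contDiffAt_comp_chart_symm hφ hz hg).fderiv_right (by simp)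
  exact (contMDiffAt_iff_contDiffAt.2 h1).comp z (contMDiffAt_chart hφ hz)

theorem chartDeriv_congr {g g' : Z → ℝ} {z : Z} (hz : z ∈ φ.source)
    (e : ∀ᶠ y in 𝓝 z, g y = g' y) : chartDeriv φ g z = chartDeriv φ g' z := by
  have : (fun y => g (φ.symm y)) =ᶠ[𝓝 (φ z)] fun y => g' (φ.symm y) :=
    (φ.tendsto_symm hz).eventually e
  simp [chartDeriv, this.fderiv_eq]

theorem chartDeriv_mul (hφ : φ ∈ atlas M Z) {g g' : Z → ℝ} {z : Z} (hz : z ∈ φ.source)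
    (hg : ContMDiffAt 𝓘(ℝ, M) 𝓘(ℝ, ℝ) ∞ g z) (hg' : ContMDiffAt 𝓘(ℝ, M) 𝓘(ℝ, ℝ) ∞ g' z) :
    chartDeriv φ (fun y => g y * g' y) z = g z • chartDeriv φ g' z + g' z • chartDeriv φ g z := by
  have := fderiv_fun_mul (differentiableAt_comp_chart_symm hφ hz hg)
    (differentiableAt_comp_chart_symm hφ hz hg')
  ext t
  simp [chartDeriv, this, φ.left_inv hz]

/-- Pairing with functionals determines the differential. -/
theorem HasLD.dual_apply (hφ : φ ∈ atlas M Z) {h : Z → W} {z : Z} (hz : z ∈ φ.source)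
    {D : M →ₗ[ℝ] W} (H : HasLD φ h z D) (l : Module.Dual ℝ W) (t : M) :
    l (D t) = chartDeriv φ (fun y => l (h y)) z t := by
  obtain ⟨κ, _, g, w, hg, e, rfl⟩ := H
  rw [chartDeriv_congr (g' := fun y => ∑ k, l (w k) * g k y) hz
    (e.mono fun y hy => by simp [hy, mul_comm])]
  have h1 : ∀ k ∈ Finset.univ, DifferentiableAt ℝ (fun y => l (w k) * g k (φ.symm y)) (φ z) :=
    fun k _ => (differentiableAt_comp_chart_symm hφ hz (hg k)).const_mul _
  have h2 := fderiv_fun_sum h1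
  have h3 : ∀ k, fderiv ℝ (fun y => l (w k) * g k (φ.symm y)) (φ z) =
    l (w k) • fderiv ℝ (fun y => g k (φ.symm y)) (φ z) := fun k =>
    fderiv_const_mul (differentiableAt_comp_chart_symm hφ hz (hg k)) _
  rw [chartDeriv, ContinuousLinearMap.coe_coe, h2, Finset.sum_congr rfl fun k _ => h3 k]
  simp [chartDeriv, mul_comm]

/-- A decomposition of `h` into functions times constants is not unique, but each `l (D t)` is the
derivative of the scalar function `l ∘ h`, and linear functionals separate the points of a real
vector space. -/
theorem HasLD.unique {W : Type*} [AddCommGroup W] [Module ℝ W] (hφ : φ ∈ atlas M Z) {h : Z → W}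
    {z : Z} (hz : z ∈ φ.source) {D D' : M →ₗ[ℝ] W} (H : HasLD φ h z D) (H' : HasLD φ h z D') :
    D = D' := by
  ext t
  rw [← sub_eq_zero, ← Module.forall_dual_apply_eq_zero_iff ℝ]
  intro l
  rw [map_sub, H.dual_apply hφ hz, H'.dual_apply hφ hz, sub_self]

theorem HasLD.mul {A : Type*} [Ring A] [Algebra ℝ A] (hφ : φ ∈ atlas M Z) {h h' : Z → A}
    {z : Z} (hz : z ∈ φ.source) {D D' : M →ₗ[ℝ] A} (H : HasLD φ h z D) (H' : HasLD φ h' z D') :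
    HasLD φ (fun y => h y * h' y) z (mulDeriv (h z) D (h' z) D') := by
  obtain ⟨κ, _, g, w, hg, e, rfl⟩ := H
  obtain ⟨κ', _, g', w', hg', e', rfl⟩ := H'
  refine ⟨κ × κ', inferInstance, fun k y => g k.1 y * g' k.2 y, fun k => w k.1 * w' k.2,
    fun k => (hg k.1).mul (hg' k.2), ?_, ?_⟩
  · filter_upwards [e, e'] with y h1 h2
    simp [h1, h2, Finset.sum_mul_sum, Fintype.sum_prod_type, smul_smul, mul_comm]
  · ext t
    simp only [mulDeriv_apply, LinearMap.sum_apply, LinearMap.smulRight_apply, e.self_of_nhds,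
      e'.self_of_nhds, Finset.sum_mul_sum, Fintype.sum_prod_type, ← Finset.sum_add_distrib]
    refine Finset.sum_congr rfl fun k _ => Finset.sum_congr rfl fun k' _ => ?_
    rw [chartDeriv_mul hφ hz (hg k) (hg' k'), LinearMap.add_apply, LinearMap.smul_apply,
      LinearMap.smul_apply, smul_mul_smul_comm, smul_mul_smul_comm, add_smul, smul_eq_mul,
      smul_eq_mul, mul_comm (g' k' z)]
    abel

theorem HasLD.smul {W : Type*} [AddCommGroup W] [Module ℝ W] (hφ : φ ∈ atlas M Z) {h : Z → W}
    {g : Z → ℝ} {z : Z} (hz : z ∈ φ.source) {D : M →ₗ[ℝ] W}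
    (hg : ContMDiffAt 𝓘(ℝ, M) 𝓘(ℝ, ℝ) ∞ g z) (H : HasLD φ h z D) :
    HasLD φ (fun y => g y • h y) z (g z • D + (chartDeriv φ g z).smulRight (h z)) := by
  obtain ⟨κ, _, g', w, hg', e, rfl⟩ := H
  refine ⟨κ, inferInstance, fun k y => g y * g' k y, w, fun k => hg.mul (hg' k), ?_, ?_⟩
  · filter_upwards [e] with y h1
    simp [h1, Finset.smul_sum, smul_smul]
  · ext t
    simp only [LinearMap.add_apply, LinearMap.smul_apply, LinearMap.sum_apply,
      LinearMap.smulRight_apply, e.self_of_nhds, Finset.smul_sum, ← Finset.sum_add_distrib]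
    refine Finset.sum_congr rfl fun k _ => ?_
    rw [chartDeriv_mul hφ hz hg (hg' k), LinearMap.add_apply, LinearMap.smul_apply,
      LinearMap.smul_apply, add_smul, smul_eq_mul, smul_eq_mul, smul_smul, smul_smul,
      mul_comm (g' k z)]

theorem differentiableAt_chart_comp (hφ : φ ∈ atlas M Z) (hφ' : φ' ∈ atlas M Z) {z : Z}
    (hz : z ∈ φ.source) (hz' : z ∈ φ'.source) :
    DifferentiableAt ℝ (fun y => φ' (φ.symm y)) (φ z) :=
  differentiableAt_comp_chart_symm hφ hz (contMDiffAt_chart hφ' hz')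

/-- The chain rule for `g ∘ φ⁻¹ = (g ∘ φ'⁻¹) ∘ (φ' ∘ φ⁻¹)`, which holds near the image of `z`. -/
theorem chartDeriv_comp (hφ : φ ∈ atlas M Z) (hφ' : φ' ∈ atlas M Z) {g : Z → ℝ} {z : Z}
    (hz : z ∈ φ.source) (hz' : z ∈ φ'.source) (hg : ContMDiffAt 𝓘(ℝ, M) 𝓘(ℝ, ℝ) ∞ g z) :
    chartDeriv φ g z = chartDeriv φ' g z ∘ₗ
      (fderiv ℝ (fun y => φ' (φ.symm y)) (φ z) : M →L[ℝ] M).toLinearMap := by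
  have h1 := differentiableAt_chart_comp hφ hφ' hz hz'
  have h2 := differentiableAt_comp_chart_symm hφ' hz' hg
  have h3 : DifferentiableAt ℝ (fun y => g (φ'.symm y)) (φ' (φ.symm (φ z))) := by
    rwa [φ.left_inv hz]
  have h4 : (fun y => g (φ.symm y)) =ᶠ[𝓝 (φ z)]
      (fun y => g (φ'.symm y)) ∘ fun y => φ' (φ.symm y) := by
    have : ∀ᶠ y in 𝓝 z, y ∈ φ'.source := φ'.open_source.mem_nhds hz'
    filter_upwards [(φ.tendsto_symm hz).eventually this] with y hy
    simp [φ'.left_inv hy]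
  have h5 := h4.fderiv_eq (𝕜 := ℝ)
  rw [fderiv_comp (φ z) h3 h1, φ.left_inv hz] at h5
  ext t
  simp [chartDeriv, h5]

theorem HasLD.change_chart (hφ : φ ∈ atlas M Z) (hφ' : φ' ∈ atlas M Z) {h : Z → W} {z : Z}
    (hz : z ∈ φ.source) (hz' : z ∈ φ'.source) {D : M →ₗ[ℝ] W} (H : HasLD φ h z D) :
    ∃ D', HasLD φ' h z D' ∧ D = D' ∘ₗ
      (fderiv ℝ (fun y => φ' (φ.symm y)) (φ z) : M →L[ℝ] M).toLinearMap := by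
  obtain ⟨κ, _, g, w, hg, e, rfl⟩ := H
  refine ⟨_, ⟨κ, inferInstance, g, w, hg, e, rfl⟩, ?_⟩
  ext t
  simp only [LinearMap.sum_apply, LinearMap.comp_apply, LinearMap.smulRight_apply,
    chartDeriv_comp hφ hφ' hz hz' (hg _)]

/-- The differential of a scalar function takes values in a finite-dimensional space, where ordinary
smoothness gives a finite sum through a basis. -/
theorem lfAt_chartDeriv [FiniteDimensional ℝ M] (hφ : φ ∈ atlas M Z) {g : Z → ℝ} {z : Z}
    (hz : z ∈ φ.source) (hg : ∀ᶠ y in 𝓝 z, ContMDiffAt 𝓘(ℝ, M) 𝓘(ℝ, ℝ) ∞ g y) :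
    LFAt M (fun y => chartDeriv φ g y) z := by
  have h1 : LFAt M (fun z => fderiv ℝ (fun y => g (φ.symm y)) (φ z)) z := by
    apply LFAt.of_contMDiffAt
    filter_upwards [φ.open_source.mem_nhds hz, hg] with y hy hgy
    exact contMDiffAt_fderiv_chart hφ hy hgy
  exact h1.map (W' := M →ₗ[ℝ] ℝ)
    { toFun := fun L => (L : M →ₗ[ℝ] ℝ), map_add' := fun _ _ => rfl, map_smul' := fun _ _ => rfl }

/-- The differential of a smooth map is smooth. -/
theorem LFAt.lDeriv {W : Type*} [AddCommGroup W] [Module ℝ W] [FiniteDimensional ℝ M]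
    (hφ : φ ∈ atlas M Z) {h : Z → W} {z : Z} (hz : z ∈ φ.source) (H : LFAt M h z) :
    LFAt M (fun y => lDeriv φ h y) z := by
  have H0 := H
  obtain ⟨κ, _, g, w, hg, e⟩ := H0
  have h1 : LFAt M (fun y => ∑ k, (BRST.chartDeriv φ (g k) y).smulRight (w k)) z :=
    LFAt.sum _ fun k _ => (lfAt_chartDeriv hφ hz (hg k)).map
      ((LinearMap.smulRightₗ : Module.Dual ℝ M →ₗ[ℝ] W →ₗ[ℝ] M →ₗ[ℝ] W).flip (w k))
  -- `lDeriv` is a separate choice at every point; by uniqueness it agrees near `z` with the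
  -- differential of one fixed decomposition.
  refine h1.congr ?_
  filter_upwards [H.eventually, φ.open_source.mem_nhds hz,
    (eventually_all.2 hg), e.eventually_nhds] with y hy hys hgy hey
  exact (hy.hasLD φ).unique hφ hys ⟨κ, inferInstance, g, w, hgy, hey, rfl⟩

end Atlas

end Differential

/-! ### Derivatives of the transition functions and equivariance of the action. -/

section Transition

variable {M : Type*} [NormedAddCommGroup M] [NormedSpace ℝ M]
  {Z : Type*} [TopologicalSpace Z]

section OneBundle

variable {F : Type*} [NormedAddCommGroup F] [NormedSpace ℝ F]
  {E : Z → Type*} [TopologicalSpace (TotalSpace F E)]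
  [∀ z, AddCommGroup (E z)] [∀ z, Module ℝ (E z)] [∀ z, TopologicalSpace (E z)]
  [FiberBundle F E] [VectorBundle ℝ F E]
  (e e' e'' : Trivialization F (π F E))
  [MemTrivializationAtlas e] [MemTrivializationAtlas e'] [MemTrivializationAtlas e'']

theorem coordChangeL_symm_apply' {z : Z} (h : z ∈ e.baseSet) (h' : z ∈ e'.baseSet) (v : F) :
    (e.coordChangeL ℝ e' z).symm v = e'.coordChangeL ℝ e z v := by
  rw [e.symm_coordChangeL e' ⟨h', h⟩]

theorem symmₗ_coordChangeL {z : Z} (h : z ∈ e.baseSet) (h' : z ∈ e'.baseSet) (v : F) :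
    e.symmₗ ℝ z ((e.coordChangeL ℝ e' z).symm v) = e'.symmₗ ℝ z v := by
  rw [coordChangeL_symm_apply' e e' h h', e'.coordChangeL_apply e ⟨h', h⟩, e.symmₗ_apply h,
    e'.symmₗ_apply h', e.symm_apply_apply_mk h]

theorem coordChangeL_self {z : Z} (h : z ∈ e.baseSet) (v : F) :
    e.coordChangeL ℝ e z v = v := by
  rw [e.coordChangeL_apply e ⟨h, h⟩, e.apply_mk_symm h]

theorem coordChangeL_coordChangeL {z : Z} (h : z ∈ e.baseSet) (h' : z ∈ e'.baseSet)
    (h'' : z ∈ e''.baseSet) (v : F) :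
    e'.coordChangeL ℝ e'' z (e.coordChangeL ℝ e' z v) = e.coordChangeL ℝ e'' z v := by
  rw [e.coordChangeL_apply e' ⟨h, h'⟩, e'.coordChangeL_apply e'' ⟨h', h''⟩,
    e.coordChangeL_apply e'' ⟨h, h''⟩, e'.symm_apply_apply_mk h']

/-- The map `t ↦ (∂_t g) g⁻¹ e_b`. -/
def twistVec [FiniteDimensional ℝ F] (φ : OpenPartialHomeomorph Z M) (z : Z)
    (b : Fin (Module.finrank ℝ F)) : M →ₗ[ℝ] F :=
  (((fderiv ℝ (fun y => (e.coordChangeL ℝ e' (φ.symm y) : F →L[ℝ] F)) (φ z)).flip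
      ((e.coordChangeL ℝ e' z).symm (Module.finBasis ℝ F b)) : M →L[ℝ] F) : M →ₗ[ℝ] F)

theorem twist_tmul [FiniteDimensional ℝ F] (φ : OpenPartialHomeomorph Z M) {A : Type*} [Ring A]
    [Algebra ℝ A] (gen : Module.Dual ℝ F →ₗ[ℝ] A) (z : Z) (a : A) (t : M) :
    twist φ e e' gen z (a ⊗ₜ t) =
      ∑ b, (a * gen ((Module.finBasis ℝ F).coord b)) ⊗ₜ[ℝ] twistVec e e' φ z b t := by
  simp [twist, LinearMap.sum_apply, twistVec]

variable [ChartedSpace M Z] [IsManifold 𝓘(ℝ, M) ∞ Z] [ContMDiffVectorBundle ∞ F E 𝓘(ℝ, M)]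

/-- Differentiate `g ∘ g⁻¹ = 1`, valid near `z`, and apply `g⁻¹` on the left. -/
theorem fderiv_coordChangeL_symm {φ : OpenPartialHomeomorph Z M} (hφ : φ ∈ atlas M Z) {z : Z}
    (hz : z ∈ φ.source) (h : z ∈ e.baseSet) (h' : z ∈ e'.baseSet) (t : M) (v : F) :
    fderiv ℝ (fun y => (e'.coordChangeL ℝ e (φ.symm y) : F →L[ℝ] F)) (φ z) t v =
      -e'.coordChangeL ℝ e z (fderiv ℝ (fun y => (e.coordChangeL ℝ e' (φ.symm y) : F →L[ℝ] F))
        (φ z) t (e'.coordChangeL ℝ e z v)) := by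
  have hk := differentiableAt_comp_chart_symm hφ hz
    (contMDiffAt_coordChangeL (n := ∞) (IB := 𝓘(ℝ, M)) h' h)
  have hg := differentiableAt_comp_chart_symm hφ hz
    (contMDiffAt_coordChangeL (n := ∞) (IB := 𝓘(ℝ, M)) h h')
  have h1 := hg.hasFDerivAt.clm_comp hk.hasFDerivAt
  have h2 : (fun y => (e.coordChangeL ℝ e' (φ.symm y) : F →L[ℝ] F).comp
      (e'.coordChangeL ℝ e (φ.symm y) : F →L[ℝ] F)) =ᶠ[𝓝 (φ z)]
      fun _ => ContinuousLinearMap.id ℝ F := by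
    have : ∀ᶠ y in 𝓝 z, y ∈ e.baseSet ∩ e'.baseSet :=
      (e.open_baseSet.inter e'.open_baseSet).mem_nhds ⟨h, h'⟩
    filter_upwards [(φ.tendsto_symm hz).eventually this] with y hy
    ext v
    simp [coordChangeL_coordChangeL e' e e' hy.2 hy.1 hy.2, coordChangeL_self e' hy.2]
  have h3 := h1.unique ((hasFDerivAt_const (ContinuousLinearMap.id ℝ F) (φ z)).congr_of_eventuallyEq h2)
  have h4 := congrArg (fun L => L t v) h3
  simp only [φ.left_inv hz, add_apply, ContinuousLinearMap.comp_apply,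
    ContinuousLinearMap.compL_apply, ContinuousLinearMap.flip_apply, zero_apply,
    ContinuousLinearEquiv.coe_coe] at h4
  have h5 := congrArg (e'.coordChangeL ℝ e z) h4
  rw [map_add, map_zero, coordChangeL_coordChangeL e e' e h h' h, coordChangeL_self e h] at h5
  exact eq_neg_of_add_eq_zero_left h5

/-- Expanding `c ∘ g⁻¹` in the dual basis leaves the scalar functions `c (g⁻¹ e_b)`, to which the
formula for the derivative of an inverse applies. This is the case of a generator in
`hasLD_algChange`. -/
theorem hasLD_gen_comp [FiniteDimensional ℝ F] {φ : OpenPartialHomeomorph Z M}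
    (hφ : φ ∈ atlas M Z) {z : Z}
    (hz : z ∈ φ.source) (h : z ∈ e.baseSet) (h' : z ∈ e'.baseSet) {A : Type*} [Ring A]
    [Algebra ℝ A] (gen : Module.Dual ℝ F →ₗ[ℝ] A) (c : Module.Dual ℝ F) :
    LFAt M (fun y => gen (c ∘ₗ ((e.coordChangeL ℝ e' y).symm : F →ₗ[ℝ] F))) z ∧
    HasLD φ (fun y => gen (c ∘ₗ ((e.coordChangeL ℝ e' y).symm : F →ₗ[ℝ] F))) z
      ((-1 : ℝ) • ∑ b, (c ∘ₗ ((e.coordChangeL ℝ e' z).symm : F →ₗ[ℝ] F) ∘ₗ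
        twistVec e e' φ z b).smulRight (gen ((Module.finBasis ℝ F).coord b))) := by
  have hmem : ∀ᶠ y in 𝓝 z, y ∈ e.baseSet ∩ e'.baseSet :=
    (e.open_baseSet.inter e'.open_baseSet).mem_nhds ⟨h, h'⟩
  have key : ∀ᶠ y in 𝓝 z, gen (c ∘ₗ ((e.coordChangeL ℝ e' y).symm : F →ₗ[ℝ] F)) =
      ∑ b, c (e'.coordChangeL ℝ e y (Module.finBasis ℝ F b)) •
        gen ((Module.finBasis ℝ F).coord b) := by
    filter_upwards [hmem] with y hy
    rw [← (Module.finBasis ℝ F).sum_dual_apply_smul_coord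
      (c ∘ₗ ((e.coordChangeL ℝ e' y).symm : F →ₗ[ℝ] F)), map_sum]
    refine Finset.sum_congr rfl fun b _ => ?_
    rw [map_smul]
    congr 1
    exact congrArg c (coordChangeL_symm_apply' e e' hy.1 hy.2 _)
  have hc : ∀ b, ∀ y ∈ e.baseSet ∩ e'.baseSet, ContMDiffAt 𝓘(ℝ, M) 𝓘(ℝ, ℝ) ∞
      (fun y => c (e'.coordChangeL ℝ e y (Module.finBasis ℝ F b))) y := by
    intro b y hy
    have h1 := contMDiffAt_coordChangeL (n := ∞) (IB := 𝓘(ℝ, M)) hy.2 hy.1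
    exact ((c.toContinuousLinearMap.comp
      (ContinuousLinearMap.apply ℝ F (Module.finBasis ℝ F b))).contMDiff.contMDiffAt).comp y h1
  refine ⟨?_, ?_⟩
  · refine LFAt.congr (LFAt.sum _ fun b _ => LFAt.smul_const ?_ _) key
    filter_upwards [hmem] with y hy using hc b y hy
  · have h1 := (HasLD.sum Finset.univ fun b _ => HasLD.smul_const φ (hc b z ⟨h, h'⟩)
      (gen ((Module.finBasis ℝ F).coord b))).congr key
    convert h1 using 1
    rw [Finset.smul_sum]
    refine Finset.sum_congr rfl fun b _ => ?_
    ext t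
    have hk := differentiableAt_comp_chart_symm hφ hz
      (contMDiffAt_coordChangeL (n := ∞) (IB := 𝓘(ℝ, M)) h' h)
    have h2 : chartDeriv φ (fun y => c (e'.coordChangeL ℝ e y (Module.finBasis ℝ F b))) z t =
        c (fderiv ℝ (fun y => (e'.coordChangeL ℝ e (φ.symm y) : F →L[ℝ] F)) (φ z) t
          (Module.finBasis ℝ F b)) := by
      have := ((c.toContinuousLinearMap.comp
        (ContinuousLinearMap.apply ℝ F (Module.finBasis ℝ F b))).hasFDerivAt.comp (φ z)
        hk.hasFDerivAt).fderiv
      exact congrArg (fun L : M →L[ℝ] ℝ => L t) this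
    rw [LinearMap.smul_apply, LinearMap.smulRight_apply, LinearMap.smulRight_apply, h2,
      fderiv_coordChangeL_symm e e' hφ hz h h', map_neg, smul_smul]
    congr 1
    rw [neg_one_mul]
    congr 1
    simp only [LinearMap.comp_apply, twistVec]
    refine congrArg c ?_
    refine (coordChangeL_symm_apply' e e' h h' _).trans ?_
    congr 1
    simp only [ContinuousLinearMap.coe_coe, ContinuousLinearMap.flip_apply]
    rw [coordChangeL_symm_apply' e e' h h']

end OneBundle

section TwoBundles

variable [ChartedSpace M Z]
  {F₀ : Type*} [NormedAddCommGroup F₀] [NormedSpace ℝ F₀] [FiniteDimensional ℝ F₀]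
  {F₁ : Type*} [NormedAddCommGroup F₁] [NormedSpace ℝ F₁] [FiniteDimensional ℝ F₁]
  {E₀ : Z → Type*} [TopologicalSpace (TotalSpace F₀ E₀)]
  [∀ z, AddCommGroup (E₀ z)] [∀ z, Module ℝ (E₀ z)] [∀ z, TopologicalSpace (E₀ z)]
  [FiberBundle F₀ E₀] [VectorBundle ℝ F₀ E₀]
  {E₁ : Z → Type*} [TopologicalSpace (TotalSpace F₁ E₁)]
  [∀ z, AddCommGroup (E₁ z)] [∀ z, Module ℝ (E₁ z)] [∀ z, TopologicalSpace (E₁ z)]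
  [FiberBundle F₁ E₁] [VectorBundle ℝ F₁ E₁]
  (i j k : LocTriv M F₀ F₁ E₀ E₁)

theorem LocTriv.isOpen_baseSet : IsOpen i.baseSet :=
  i.chart.open_source.inter (i.e₀.open_baseSet.inter i.e₁.open_baseSet)

variable {i j k} {z : Z}

/-- `algChange` compares two trivializations of the same fibre `∧E_z*`; its cocycle relations follow
by passing through that fibre. -/
theorem algChange_triv (hi : z ∈ i.baseSet) (hj : z ∈ j.baseSet) (x : SAlg (E₀ z) (E₁ z)) :
    algChange i j z (i.triv z x) = j.triv z x := by
  rw [algChange, LocTriv.triv, pull_pull, LocTriv.triv]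
  congr 2
  · ext v; exact symmₗ_coordChangeL i.e₀ j.e₀ hi.2.1 hj.2.1 v
  · ext v; exact symmₗ_coordChangeL i.e₁ j.e₁ hi.2.2 hj.2.2 v

variable (i) in
/-- The inverse of the trivialization of `∧E*`. -/
def LocTriv.trivInv (z : Z) : SAlg F₀ F₁ →ₐ[ℝ] SAlg (E₀ z) (E₁ z) :=
  pull (i.e₀.linearMapAt ℝ z) (i.e₁.linearMapAt ℝ z)

theorem trivInv_triv (hi : z ∈ i.baseSet) (x : SAlg (E₀ z) (E₁ z)) :
    i.trivInv z (i.triv z x) = x := by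
  rw [LocTriv.trivInv, LocTriv.triv, pull_pull]
  convert pull_id x using 3
  · ext v; exact i.e₀.symmₗ_linearMapAt hi.2.1 v
  · ext v; exact i.e₁.symmₗ_linearMapAt hi.2.2 v

theorem triv_trivInv (hi : z ∈ i.baseSet) (x : SAlg F₀ F₁) :
    i.triv z (i.trivInv z x) = x := by
  rw [LocTriv.trivInv, LocTriv.triv, pull_pull]
  convert pull_id x using 3
  · ext v; exact i.e₀.linearMapAt_symmₗ hi.2.1 v
  · ext v; exact i.e₁.linearMapAt_symmₗ hi.2.2 v

theorem triv_injective (hi : z ∈ i.baseSet) : Function.Injective (i.triv z) :=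
  Function.LeftInverse.injective (trivInv_triv hi)

theorem parityInv_triv (x : SAlg (E₀ z) (E₁ z)) :
    parityInv (i.triv z x) = i.triv z (parityInv x) := parityInv_pull _ _ _

theorem algChange_self (hi : z ∈ i.baseSet) (x : SAlg F₀ F₁) : algChange i i z x = x := by
  rw [← triv_trivInv hi x, algChange_triv hi hi]

theorem algChange_algChange (hi : z ∈ i.baseSet) (hj : z ∈ j.baseSet) (hk : z ∈ k.baseSet)
    (x : SAlg F₀ F₁) : algChange j k z (algChange i j z x) = algChange i k z x := by
  rw [← triv_trivInv hi x, algChange_triv hi hj, algChange_triv hj hk, algChange_triv hi hk]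

variable (i j) in
theorem coordChange_tmul (z : Z) (a : SAlg F₀ F₁) (v₀ : F₀) (v₁ : F₁) (t : M) :
    coordChange i j z (a ⊗ₜ ((v₀, v₁), t)) =
      algChange i j z a ⊗ₜ ((i.e₀.coordChangeL ℝ j.e₀ z v₀, i.e₁.coordChangeL ℝ j.e₁ z v₁),
        jac i j z t) +
      (∑ b, (algChange i j z a * evenGen ((Module.finBasis ℝ F₀).coord b)) ⊗ₜ
          ((twistVec i.e₀ j.e₀ i.chart z b t, (0 : F₁)), (0 : M)) +
       ∑ b, (algChange i j z a * oddGen ((Module.finBasis ℝ F₁).coord b)) ⊗ₜ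
          (((0 : F₀), twistVec i.e₁ j.e₁ i.chart z b t), (0 : M))) := by
  rw [coordChange, LinearMap.add_apply, LinearMap.comp_apply, LinearMap.add_apply,
    LinearMap.comp_apply, LinearMap.comp_apply, TensorProduct.map_tmul, TensorProduct.map_tmul,
    LinearMap.snd_apply, twist_tmul, twist_tmul, map_sum, map_sum]
  rfl

variable (i j) in
/-- The derivative of the transition function of `∧E*` in a direction `t`, as a derivation of the
typical fibre. -/
def twistDer (z : Z) (t : M) : SAlg F₀ F₁ →ₗ[ℝ] SAlg F₀ F₁ :=
  (-1 : ℝ) • (∑ b, LinearMap.mulLeft ℝ (evenGen ((Module.finBasis ℝ F₀).coord b)) ∘ₗ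
      contract (twistVec i.e₀ j.e₀ i.chart z b t, (0 : F₁)) +
    ∑ b, LinearMap.mulLeft ℝ (oddGen ((Module.finBasis ℝ F₁).coord b)) ∘ₗ
      contract ((0 : F₀), twistVec i.e₁ j.e₁ i.chart z b t))

variable (i j) in
theorem twistDer_apply (z : Z) (t : M) (x : SAlg F₀ F₁) : twistDer i j z t x =
    (-1 : ℝ) • (∑ b, evenGen ((Module.finBasis ℝ F₀).coord b) *
      contract (twistVec i.e₀ j.e₀ i.chart z b t, (0 : F₁)) x +
    ∑ b, oddGen ((Module.finBasis ℝ F₁).coord b) *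
      contract ((0 : F₀), twistVec i.e₁ j.e₁ i.chart z b t) x) := by
  simp only [twistDer, LinearMap.smul_apply, LinearMap.add_apply, LinearMap.sum_apply,
    LinearMap.comp_apply, LinearMap.mulLeft_apply]

variable (i j) in
-- An infinitesimal linear change of generators that preserves `V₀` and `V₁` acts as an even
-- derivation.
theorem twistDer_mul (z : Z) (t : M) (x y : SAlg F₀ F₁) : twistDer i j z t (x * y) =
    twistDer i j z t x * y + x * twistDer i j z t y := by
  rw [twistDer_apply, even_contract_mul, smul_add, ← smul_mul_assoc, ← mul_smul_comm,
    ← twistDer_apply, ← twistDer_apply]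

variable [IsManifold 𝓘(ℝ, M) ∞ Z] [ContMDiffVectorBundle ∞ F₀ E₀ 𝓘(ℝ, M)]
  [ContMDiffVectorBundle ∞ F₁ E₁ 𝓘(ℝ, M)]

/-- As functions of `x`, the derivative of `algChange` and `twistDer` after `algChange` satisfy the
same Leibniz rule, because `algChange` is multiplicative at every point. So only generators have to
be computed. -/
theorem hasLD_algChange (hi : z ∈ i.baseSet) (hj : z ∈ j.baseSet) (x : SAlg F₀ F₁) :
    LFAt M (fun y => algChange i j y x) z ∧
    ∃ D, HasLD i.chart (fun y => algChange i j y x) z D ∧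
      ∀ t, D t = twistDer i j z t (algChange i j z x) := by
  induction x using SAlg.induction with
  | smul_one r =>
    simp only [map_smul, map_one]
    refine ⟨LFAt.const _ _, 0, HasLD.const _ _ _, fun t => ?_⟩
    rw [twistDer_apply]
    simp only [contract_one, mul_zero, Finset.sum_const_zero, add_zero, smul_zero,
      LinearMap.zero_apply]
  | even c =>
    have H := hasLD_gen_comp i.e₀ j.e₀ i.chart_mem hi.1 hi.2.1 hj.2.1 (evenGen (V₁ := F₁)) c
    simp only [algChange, pull_evenGen]
    refine ⟨H.1, _, H.2, fun t => ?_⟩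
    rw [twistDer_apply]
    simp only [contract_evenGen, map_zero, zero_smul, mul_zero, Finset.sum_const_zero, add_zero,
      LinearMap.smul_apply, LinearMap.sum_apply, LinearMap.smulRight_apply, mul_smul_comm, mul_one]
    rfl
  | odd c =>
    have H := hasLD_gen_comp i.e₁ j.e₁ i.chart_mem hi.1 hi.2.2 hj.2.2 (oddGen (V₀ := F₀)) c
    simp only [algChange, pull_oddGen]
    refine ⟨H.1, _, H.2, fun t => ?_⟩
    rw [twistDer_apply]
    simp only [contract_oddGen, map_zero, zero_smul, mul_zero, Finset.sum_const_zero, zero_add,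
      LinearMap.smul_apply, LinearMap.sum_apply, LinearMap.smulRight_apply, mul_smul_comm, mul_one]
    rfl
  | mul x y hx hy =>
    obtain ⟨h1, D, hD, hDt⟩ := hx
    obtain ⟨h1', D', hD', hDt'⟩ := hy
    simp only [map_mul]
    refine ⟨h1.mul h1', _, hD.mul i.chart_mem hi.1 hD', fun t => ?_⟩
    rw [mulDeriv_apply, twistDer_mul, hDt, hDt']
  | add x y hx hy =>
    obtain ⟨h1, D, hD, hDt⟩ := hx
    obtain ⟨h1', D', hD', hDt'⟩ := hy
    simp only [map_add]
    refine ⟨h1.add h1', _, hD.add hD', fun t => ?_⟩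
    rw [LinearMap.add_apply, hDt, hDt']

theorem LFAt.algChange {h : Z → SAlg F₀ F₁} (H : LFAt M h z) (hi : z ∈ i.baseSet)
    (hj : z ∈ j.baseSet) : LFAt M (fun y => algChange i j y (h y)) z := by
  obtain ⟨κ, _, g, w, hg, e⟩ := H
  refine (LFAt.sum (M := M) Finset.univ (h := fun k y => g k y • BRST.algChange i j y (w k))
    fun k _ => LFAt.smul (hg k) (hasLD_algChange hi hj (w k)).1).congr ?_
  filter_upwards [e] with y hy
  rw [hy, map_sum]
  simp only [map_smul]

/-- The fundamental property of the transition functions of `𝒱_E`. -/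
theorem jetAct_coordChange {h : Z → SAlg F₀ F₁} {D : M →ₗ[ℝ] SAlg F₀ F₁} (hi : z ∈ i.baseSet)
    (hj : z ∈ j.baseSet) (H : HasLD i.chart h z D) :
    ∃ D', HasLD j.chart (fun y => algChange i j y (h y)) z D' ∧ ∀ u,
      jetAct (algChange i j z (h z)) D' (coordChange i j z u) =
        algChange i j z (jetAct (h z) D u) := by
  obtain ⟨κ, _, g, w, hg, e, rfl⟩ := H
  choose D₀ hD₀ hD₀' using fun k => (hasLD_algChange hi hj (w k)).2
  have h1 : HasLD i.chart (fun y => algChange i j y (h y)) z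
      (∑ k, (g k z • D₀ k + (chartDeriv i.chart (g k) z).smulRight (algChange i j z (w k)))) := by
    refine (HasLD.sum Finset.univ (h := fun k y => g k y • algChange i j y (w k))
      fun k _ => (hD₀ k).smul i.chart_mem hi.1 (hg k)).congr ?_
    filter_upwards [e] with y hy
    rw [hy, map_sum]
    simp only [map_smul]
  obtain ⟨D', hD', hJ⟩ := h1.change_chart i.chart_mem j.chart_mem hi.1 hj.1
  refine ⟨D', hD', fun u => ?_⟩
  -- The product rule for the transported map: differentiating the transition function gives
  -- `twistDer`, differentiating the coefficients of `h` gives the image of the old differential.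
  -- The chain rule for charts accounts for `jac`.
  have hJ' : ∀ t, D' (jac i j z t) = twistDer i j z t (algChange i j z (h z)) +
      algChange i j z ((∑ k, (chartDeriv i.chart (g k) z).smulRight (w k)) t) := by
    intro t
    have := congrArg (fun L : M →ₗ[ℝ] SAlg F₀ F₁ => L t) hJ
    simp only [LinearMap.comp_apply] at this
    rw [jac, ← this, e.self_of_nhds, map_sum, map_sum, LinearMap.sum_apply, LinearMap.sum_apply,
      map_sum, ← Finset.sum_add_distrib]
    refine Finset.sum_congr rfl fun k _ => ?_
    rw [LinearMap.add_apply, LinearMap.smul_apply, hD₀', map_smul, map_smul,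
      LinearMap.smulRight_apply, LinearMap.smulRight_apply, map_smul]
  induction u using TensorProduct.induction_on with
  | zero => simp only [map_zero]
  | add u v hu hv => rw [map_add, map_add, hu, hv, map_add, map_add]
  | tmul a p =>
    obtain ⟨⟨v₀, v₁⟩, t⟩ := p
    have hc : algChange i j z (contract (v₀, v₁) (h z)) =
        contract (i.e₀.coordChangeL ℝ j.e₀ z v₀, i.e₁.coordChangeL ℝ j.e₁ z v₁)
          (algChange i j z (h z)) :=
      pull_contract _ _ _ _ ((i.e₀.coordChangeL ℝ j.e₀ z).symm_apply_apply v₀)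
        ((i.e₁.coordChangeL ℝ j.e₁ z).symm_apply_apply v₁) _
    rw [coordChange_tmul, map_add, map_add, map_sum, map_sum]
    simp only [jetAct_tmul, map_zero, add_zero]
    rw [hJ', map_mul, map_add, hc, twistDer_apply]
    simp only [mul_assoc, ← Finset.mul_sum, ← mul_add]
    congr 1
    -- The twist terms of `coordChange` contribute `Y` and `twistDer` contributes `-Y`.
    generalize (∑ b, evenGen ((Module.finBasis ℝ F₀).coord b) *
      contract (twistVec i.e₀ j.e₀ i.chart z b t, (0 : F₁)) (algChange i j z (h z)) +
    ∑ b, oddGen ((Module.finBasis ℝ F₁).coord b) *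
      contract ((0 : F₀), twistVec i.e₁ j.e₁ i.chart z b t) (algChange i j z (h z))) = Y
    rw [SAlg.neg_one_smul]
    abel

theorem jetAct_coordChange_of_eq {h h' : Z → SAlg F₀ F₁} {D D' : M →ₗ[ℝ] SAlg F₀ F₁}
    (hi : z ∈ i.baseSet) (hj : z ∈ j.baseSet) (H : HasLD i.chart h z D)
    (H' : HasLD j.chart h' z D') (e : ∀ᶠ y in 𝓝 z, h' y = algChange i j y (h y)) (u) :
    jetAct (h' z) D' (coordChange i j z u) = algChange i j z (jetAct (h z) D u) := by
  obtain ⟨D'', hD'', h1⟩ := jetAct_coordChange hi hj H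
  rw [H'.unique j.chart_mem hj.1 (hD''.congr e), e.self_of_nhds]
  exact h1 u

end TwoBundles

end Transition

/-! ### The cocycle relations, smoothness and exhaustion for `𝒱_E`. -/

section Cocycle

variable {M : Type*} [NormedAddCommGroup M] [NormedSpace ℝ M] [FiniteDimensional ℝ M]
  {Z : Type*} [TopologicalSpace Z] [ChartedSpace M Z] [IsManifold 𝓘(ℝ, M) ∞ Z]
  {F₀ : Type*} [NormedAddCommGroup F₀] [NormedSpace ℝ F₀] [FiniteDimensional ℝ F₀]
  {F₁ : Type*} [NormedAddCommGroup F₁] [NormedSpace ℝ F₁] [FiniteDimensional ℝ F₁]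
  {E₀ : Z → Type*} [TopologicalSpace (TotalSpace F₀ E₀)]
  [∀ z, AddCommGroup (E₀ z)] [∀ z, Module ℝ (E₀ z)] [∀ z, TopologicalSpace (E₀ z)]
  [FiberBundle F₀ E₀] [VectorBundle ℝ F₀ E₀] [ContMDiffVectorBundle ∞ F₀ E₀ 𝓘(ℝ, M)]
  {E₁ : Z → Type*} [TopologicalSpace (TotalSpace F₁ E₁)]
  [∀ z, AddCommGroup (E₁ z)] [∀ z, Module ℝ (E₁ z)] [∀ z, TopologicalSpace (E₁ z)]
  [FiberBundle F₁ E₁] [VectorBundle ℝ F₁ E₁] [ContMDiffVectorBundle ∞ F₁ E₁ 𝓘(ℝ, M)]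
  {i j k : LocTriv M F₀ F₁ E₀ E₁} {z : Z}

theorem lfAt_chart_smul {φ : OpenPartialHomeomorph Z M} (hφ : φ ∈ atlas M Z) (hz : z ∈ φ.source)
    {W : Type*} [AddCommMonoid W] [Module ℝ W] (l : Module.Dual ℝ M) (w : W) :
    LFAt M (fun y => l (φ y - φ z) • w) z := by
  refine LFAt.smul_const ?_ w
  filter_upwards [φ.open_source.mem_nhds hz] with y hy
  exact (l.toContinuousLinearMap.contMDiff.contMDiffAt).comp y
    ((contMDiffAt_chart hφ hy).sub contMDiffAt_const)

theorem hasLD_chart_smul {φ : OpenPartialHomeomorph Z M} (hφ : φ ∈ atlas M Z) (hz : z ∈ φ.source)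
    {W : Type*} [AddCommMonoid W] [Module ℝ W] (l : Module.Dual ℝ M) (w : W) :
    HasLD φ (fun y => l (φ y - φ z) • w) z (l.smulRight w) := by
  have h1 : ContMDiffAt 𝓘(ℝ, M) 𝓘(ℝ, ℝ) ∞ (fun y => l (φ y - φ z)) z :=
    (l.toContinuousLinearMap.contMDiff.contMDiffAt).comp z
      ((contMDiffAt_chart hφ hz).sub contMDiffAt_const)
  have h2 := HasLD.smul_const φ h1 w
  have h3 : chartDeriv φ (fun y => l (φ y - φ z)) z = l := by
    have h4 : (fun y => l (φ (φ.symm y) - φ z)) =ᶠ[𝓝 (φ z)] fun y => l.toContinuousLinearMap (y - φ z) := by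
      filter_upwards [φ.open_target.mem_nhds (φ.map_source hz)] with y hy
      simp [φ.right_inv hy]
    have h5 : HasFDerivAt (fun y => l.toContinuousLinearMap (y - φ z)) l.toContinuousLinearMap (φ z) :=
      l.toContinuousLinearMap.hasFDerivAt.comp (φ z) ((hasFDerivAt_id (φ z)).sub_const (φ z))
    rw [chartDeriv, h4.fderiv_eq, h5.fderiv]
    ext; simp
  rwa [h3] at h2

/-- An element of the typical fibre is determined by its action on the jets of smooth maps. -/
theorem eq_of_jetAct_eq {φ : OpenPartialHomeomorph Z M} (hφ : φ ∈ atlas M Z) (hz : z ∈ φ.source)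
    {u u' : SAlg F₀ F₁ ⊗[ℝ] ((F₀ × F₁) × M)}
    (H : ∀ (h : Z → SAlg F₀ F₁) (D : M →ₗ[ℝ] SAlg F₀ F₁), LFAt M h z → HasLD φ h z D →
      jetAct (h z) D u = jetAct (h z) D u') : u = u' := by
  refine jetAct_ext (fun c => H (fun _ => evenGen c) 0 (LFAt.const _ z) (HasLD.const φ _ z))
    (fun c => H (fun _ => oddGen c) 0 (LFAt.const _ z) (HasLD.const φ _ z)) fun l => ?_
  have := H (fun y => l (φ y - φ z) • (1 : SAlg F₀ F₁)) (l.smulRight 1)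
    (lfAt_chart_smul hφ hz l _) (hasLD_chart_smul hφ hz l _)
  have h0 : l (φ z - φ z) • (1 : SAlg F₀ F₁) = 0 := by rw [sub_self, map_zero, zero_smul]
  rwa [h0] at this

theorem coordChange_self (hi : z ∈ i.baseSet) (u) : coordChange i i z u = u := by
  refine eq_of_jetAct_eq i.chart_mem hi.1 fun h D _ HD => ?_
  rw [jetAct_coordChange_of_eq hi hi HD HD, algChange_self hi]
  filter_upwards [i.isOpen_baseSet.mem_nhds hi] with y hy
  rw [algChange_self hy]

/-- By faithfulness it is enough to compare actions on a jet given in the trivialization `k`. Its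
transports to `i` and `j` are local expressions of one section, so equivariance reduces the claim to
the cocycle relation of `∧E*`. -/
theorem coordChange_coordChange (hi : z ∈ i.baseSet) (hj : z ∈ j.baseSet) (hk : z ∈ k.baseSet) (u) :
    coordChange j k z (coordChange i j z u) = coordChange i k z u := by
  refine eq_of_jetAct_eq k.chart_mem hk.1 fun h D Hh HD => ?_
  have Hi := (Hh.algChange hk hi).hasLD i.chart
  have Hj := (Hh.algChange hk hj).hasLD j.chart
  have mem : ∀ᶠ y in 𝓝 z, y ∈ i.baseSet ∧ y ∈ j.baseSet ∧ y ∈ k.baseSet :=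
    (i.isOpen_baseSet.inter (j.isOpen_baseSet.inter k.isOpen_baseSet)).mem_nhds ⟨hi, hj, hk⟩
  rw [jetAct_coordChange_of_eq hj hk Hj HD, jetAct_coordChange_of_eq hi hj Hi Hj,
    jetAct_coordChange_of_eq hi hk Hi HD, algChange_algChange hi hj hk]
  · filter_upwards [mem] with y hy
    rw [algChange_algChange hy.2.2 hy.1 hy.2.2, algChange_self hy.2.2]
  · filter_upwards [mem] with y hy
    rw [algChange_algChange hy.2.2 hy.1 hy.2.1]
  · filter_upwards [mem] with y hy
    rw [algChange_algChange hy.2.2 hy.2.1 hy.2.2, algChange_self hy.2.2]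

theorem lfAt_twistVec {F : Type*} [NormedAddCommGroup F] [NormedSpace ℝ F] [FiniteDimensional ℝ F]
    {E : Z → Type*} [TopologicalSpace (TotalSpace F E)]
    [∀ z, AddCommGroup (E z)] [∀ z, Module ℝ (E z)] [∀ z, TopologicalSpace (E z)]
    [FiberBundle F E] [VectorBundle ℝ F E] [ContMDiffVectorBundle ∞ F E 𝓘(ℝ, M)]
    (e e' : Trivialization F (π F E))
    [MemTrivializationAtlas e] [MemTrivializationAtlas e']
    {φ : OpenPartialHomeomorph Z M} (hφ : φ ∈ atlas M Z)
    (hz : z ∈ φ.source) (h : z ∈ e.baseSet) (h' : z ∈ e'.baseSet) (b) (t : M) :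
    LFAt M (fun y => twistVec e e' φ y b t) z := by
  apply LFAt.of_contMDiffAt
  filter_upwards [φ.open_source.mem_nhds hz, e.open_baseSet.mem_nhds h,
    e'.open_baseSet.mem_nhds h'] with y hy hye hye'
  have h1 := contMDiffAt_fderiv_chart hφ hy
    (contMDiffAt_coordChangeL (n := ∞) (IB := 𝓘(ℝ, M)) hye hye')
  have h2 := contMDiffAt_coordChangeL (n := ∞) (IB := 𝓘(ℝ, M)) hye' hye
  have h3 := (h1.clm_apply (contMDiffAt_const (c := t))).clm_apply
    (h2.clm_apply (contMDiffAt_const (c := Module.finBasis ℝ F b)))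
  refine h3.congr_of_eventuallyEq ?_
  filter_upwards [e.open_baseSet.mem_nhds hye, e'.open_baseSet.mem_nhds hye'] with x hx hx'
  simp only [twistVec, ContinuousLinearMap.coe_coe, ContinuousLinearMap.flip_apply]
  rw [coordChangeL_symm_apply' e e' hx hx']
  rfl

theorem lfAt_coordChangeL {F : Type*} [NormedAddCommGroup F] [NormedSpace ℝ F] [FiniteDimensional ℝ F]
    {E : Z → Type*} [TopologicalSpace (TotalSpace F E)]
    [∀ z, AddCommGroup (E z)] [∀ z, Module ℝ (E z)] [∀ z, TopologicalSpace (E z)]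
    [FiberBundle F E] [VectorBundle ℝ F E] [ContMDiffVectorBundle ∞ F E 𝓘(ℝ, M)]
    (e e' : Trivialization F (π F E))
    [MemTrivializationAtlas e] [MemTrivializationAtlas e']
    (h : z ∈ e.baseSet) (h' : z ∈ e'.baseSet) (v : F) :
    LFAt M (fun y => e.coordChangeL ℝ e' y v) z := by
  apply LFAt.of_contMDiffAt
  filter_upwards [e.open_baseSet.mem_nhds h, e'.open_baseSet.mem_nhds h'] with y hye hye'
  exact (contMDiffAt_coordChangeL (n := ∞) (IB := 𝓘(ℝ, M)) hye hye').clm_apply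
    (contMDiffAt_const (c := v))

theorem lfAt_jac (hi : z ∈ i.baseSet) (hj : z ∈ j.baseSet) (t : M) :
    LFAt M (fun y => jac i j y t) z := by
  apply LFAt.of_contMDiffAt
  filter_upwards [i.chart.open_source.mem_nhds hi.1, j.chart.open_source.mem_nhds hj.1] with y hy hy'
  exact (contMDiffAt_fderiv_chart i.chart_mem hy (contMDiffAt_chart j.chart_mem hy')).clm_apply
    (contMDiffAt_const (c := t))

theorem lfAt_coordChange (hi : z ∈ i.baseSet) (hj : z ∈ j.baseSet) (u) :
    LFAt M (fun y => coordChange i j y u) z := by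
  induction u using TensorProduct.induction_on with
  | zero => simp only [map_zero]; exact LFAt.const _ _
  | add u v hu hv => simp only [map_add]; exact hu.add hv
  | tmul a p =>
    obtain ⟨⟨v₀, v₁⟩, t⟩ := p
    simp only [coordChange_tmul]
    have ha := (hasLD_algChange hi hj a).1
    refine LFAt.add ?_ (LFAt.add (LFAt.sum _ fun b _ => ?_) (LFAt.sum _ fun b _ => ?_))
    · have h0 := lfAt_coordChangeL (M := M) i.e₀ j.e₀ hi.2.1 hj.2.1 v₀
      have h1 := lfAt_coordChangeL (M := M) i.e₁ j.e₁ hi.2.2 hj.2.2 v₁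
      have h2 := lfAt_jac hi hj t
      have h3 := ((h0.map (LinearMap.inl ℝ (F₀ × F₁) M ∘ₗ LinearMap.inl ℝ F₀ F₁)).add
        (h1.map (LinearMap.inl ℝ (F₀ × F₁) M ∘ₗ LinearMap.inr ℝ F₀ F₁))).add
        (h2.map (LinearMap.inr ℝ (F₀ × F₁) M))
      refine (ha.bilin (TensorProduct.mk ℝ _ _) h3).congr (Eventually.of_forall fun y => ?_)
      simp
    · exact (ha.mul (LFAt.const (evenGen ((Module.finBasis ℝ F₀).coord b)) z)).bilin
        (TensorProduct.mk ℝ _ _)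
        ((lfAt_twistVec i.e₀ j.e₀ i.chart_mem hi.1 hi.2.1 hj.2.1 b t).map
          (LinearMap.inl ℝ (F₀ × F₁) M ∘ₗ LinearMap.inl ℝ F₀ F₁))
    · exact (ha.mul (LFAt.const (oddGen ((Module.finBasis ℝ F₁).coord b)) z)).bilin
        (TensorProduct.mk ℝ _ _)
        ((lfAt_twistVec i.e₁ j.e₁ i.chart_mem hi.1 hi.2.2 hj.2.2 b t).map
          (LinearMap.inl ℝ (F₀ × F₁) M ∘ₗ LinearMap.inr ℝ F₀ F₁))

variable (M F₀ F₁) in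
/-- The invariant finite-dimensional subspaces of the typical fibre of `𝒱_E`. -/
def fibreFiltration (n : ℕ) : Submodule ℝ (SAlg F₀ F₁ ⊗[ℝ] ((F₀ × F₁) × M)) :=
  Submodule.map₂ (TensorProduct.mk ℝ _ _) (genSpan F₀ F₁ ^ (n + 1))
      (LinearMap.range (LinearMap.inl ℝ (F₀ × F₁) M)) ⊔
    Submodule.map₂ (TensorProduct.mk ℝ _ _) (genSpan F₀ F₁ ^ n) ⊤

omit [FiniteDimensional ℝ M] [FiniteDimensional ℝ F₀] [FiniteDimensional ℝ F₁] in
theorem tmul_inl_mem_fibreFiltration {n : ℕ} {a : SAlg F₀ F₁} (ha : a ∈ genSpan F₀ F₁ ^ (n + 1))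
    (v : F₀ × F₁) : a ⊗ₜ[ℝ] (v, (0 : M)) ∈ fibreFiltration M F₀ F₁ n :=
  (le_sup_left : _ ≤ fibreFiltration M F₀ F₁ n)
    (Submodule.apply_mem_map₂ (TensorProduct.mk ℝ _ _) ha ⟨v, rfl⟩)

omit [FiniteDimensional ℝ M] [FiniteDimensional ℝ F₀] [FiniteDimensional ℝ F₁] in
theorem tmul_mem_fibreFiltration {n : ℕ} {a : SAlg F₀ F₁} (ha : a ∈ genSpan F₀ F₁ ^ n)
    (p : (F₀ × F₁) × M) : a ⊗ₜ[ℝ] p ∈ fibreFiltration M F₀ F₁ n :=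
  (le_sup_right : _ ≤ fibreFiltration M F₀ F₁ n)
    (Submodule.apply_mem_map₂ (TensorProduct.mk ℝ _ _) ha Submodule.mem_top)

omit [FiniteDimensional ℝ M] [FiniteDimensional ℝ F₀] [FiniteDimensional ℝ F₁] in
theorem monotone_fibreFiltration : Monotone (fibreFiltration M F₀ F₁) := fun _ _ h =>
  sup_le_sup (Submodule.map₂_le_map₂ (monotone_genSpan_pow (Nat.succ_le_succ h)) le_rfl)
    (Submodule.map₂_le_map₂ (monotone_genSpan_pow h) le_rfl)

theorem finite_fibreFiltration (n : ℕ) : Module.Finite ℝ (fibreFiltration M F₀ F₁ n) := by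
  rw [Module.Finite.iff_fg]
  refine Submodule.FG.sup (Submodule.FG.map₂ _ (fg_genSpan.pow _) ?_)
    (Submodule.FG.map₂ _ (fg_genSpan.pow _) Module.Finite.fg_top)
  rw [LinearMap.range_eq_map]; exact Module.Finite.fg_top.map _

omit [FiniteDimensional ℝ M] [FiniteDimensional ℝ F₀] [FiniteDimensional ℝ F₁] in
theorem iSup_fibreFiltration : ⨆ n, fibreFiltration M F₀ F₁ n = ⊤ := by
  rw [eq_top_iff]
  rintro u -
  induction u using TensorProduct.induction_on with
  | zero => exact Submodule.zero_mem _
  | add u v hu hv => exact Submodule.add_mem _ hu hv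
  | tmul a p =>
    obtain ⟨n, hn⟩ := exists_mem_genSpan_pow a
    exact Submodule.mem_iSup_of_mem n (tmul_mem_fibreFiltration hn p)

-- The twist multiplies a coefficient by one more generator and places it in a fibre direction. The
-- filtration absorbs this by allowing coefficients of fibre directions one generator more than
-- those of base directions.
omit [FiniteDimensional ℝ M] [IsManifold 𝓘(ℝ, M) ∞ Z] [ContMDiffVectorBundle ∞ F₀ E₀ 𝓘(ℝ, M)]
  [ContMDiffVectorBundle ∞ F₁ E₁ 𝓘(ℝ, M)] in
variable (i j) in
theorem map_coordChange_fibreFiltration (n : ℕ) (z : Z) :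
    (fibreFiltration M F₀ F₁ n).map (coordChange i j z) ≤ fibreFiltration M F₀ F₁ n := by
  rw [fibreFiltration, Submodule.map_sup]
  refine sup_le ?_ ?_
  · rw [Submodule.map_le_iff_le_comap, Submodule.map₂_le]
    rintro a ha _ ⟨⟨v₀, v₁⟩, rfl⟩
    rw [Submodule.mem_comap, TensorProduct.mk_apply, LinearMap.inl_apply, coordChange_tmul]
    -- A fibre direction has no component in `M`, so its twist terms vanish.
    simp only [map_zero]
    refine Submodule.add_mem _ (tmul_inl_mem_fibreFiltration (pull_mem_genSpan_pow _ _ ha) _) ?_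
    have h0 : ((((0 : F₀), (0 : F₁)), (0 : M)) : (F₀ × F₁) × M) = 0 := rfl
    simp only [h0, TensorProduct.tmul_zero, Finset.sum_const_zero, add_zero]
    exact Submodule.zero_mem _
  · rw [Submodule.map_le_iff_le_comap, Submodule.map₂_le]
    rintro a ha ⟨⟨v₀, v₁⟩, t⟩ -
    rw [Submodule.mem_comap, TensorProduct.mk_apply, coordChange_tmul]
    have ha' : algChange i j z a ∈ genSpan F₀ F₁ ^ n := pull_mem_genSpan_pow _ _ ha
    refine Submodule.add_mem _ (tmul_mem_fibreFiltration ha' _)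
      (Submodule.add_mem _ (Submodule.sum_mem _ fun b _ => ?_) (Submodule.sum_mem _ fun b _ => ?_))
    · exact tmul_inl_mem_fibreFiltration (mul_mem_submodule_pow ha'
        (mem_submodule_pow_one (evenGen_mem_genSpan _))) _
    · exact tmul_inl_mem_fibreFiltration (mul_mem_submodule_pow ha'
        (mem_submodule_pow_one (oddGen_mem_genSpan _))) _

theorem isVectorBundleCocycle_coordChange : IsVectorBundleCocycle M
    (LocTriv.baseSet (M := M) (F₀ := F₀) (F₁ := F₁) (E₀ := E₀) (E₁ := E₁)) coordChange := by
  refine ⟨LocTriv.isOpen_baseSet, ?_, ?_, ?_, ?_, ?_⟩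
  · intro z
    exact ⟨⟨chartAt M z, chart_mem_atlas M z, trivializationAt F₀ E₀ z, trivializationAt F₁ E₁ z,
    inferInstance, inferInstance⟩, mem_chart_source M z, mem_baseSet_trivializationAt F₀ E₀ z,
    mem_baseSet_trivializationAt F₁ E₁ z⟩
  · intro i z hz
    exact LinearMap.ext fun u => coordChange_self hz u
  · intro i j k z hi hj hk
    refine LinearMap.ext fun u => ?_
    rw [LinearMap.comp_apply]
    exact coordChange_coordChange hi hj hk u
  · intro i j w x
    exact (lfAt_coordChange x.2.1 x.2.2 w).lfSmoothAt ((i.isOpen_baseSet.inter j.isOpen_baseSet).mem_nhds x.2)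
  · exact ⟨fibreFiltration M F₀ F₁, monotone_fibreFiltration, finite_fibreFiltration,
    iSup_fibreFiltration, fun n i j z _ => map_coordChange_fibreFiltration i j n z⟩

end Cocycle

/-! ### The graded Leibniz rule without homogeneity assumptions. -/

section GradedAlgebra

variable {A : Type*} [Ring A] [Algebra ℝ A] {σ : A →ₐ[ℝ] A} {u : A →ₗ[ℝ] A}

/-- Every element is the sum of its even part `(f + σ f) / 2` and its odd part `(f - σ f) / 2`. By
linearity the sign rule becomes an unconditional Leibniz rule in which `f` is replaced by its even
part plus `(-1) ^ p` times its odd part: `f` itself for even `p`, and `σ f` for odd `p`. -/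
theorem gradedDer_iff (hσ : ∀ a, σ (σ a) = a) (p : ZMod 2) :
    ((∀ (q : ZMod 2) (f : A), σ f = (-1 : ℝ) ^ q.val • f → σ (u f) = (-1 : ℝ) ^ (p + q).val • u f) ∧
      ∀ (q q' : ZMod 2) (f f' : A), σ f = (-1 : ℝ) ^ q.val • f → σ f' = (-1 : ℝ) ^ q'.val • f' →
        u (f * f') = u f * f' + (-1 : ℝ) ^ (p.val * q.val) • (f * u f')) ↔
      (∀ f, σ (u f) = (-1 : ℝ) ^ p.val • u (σ f)) ∧
      ∀ f f', u (f * f') = u f * f' +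
        ((1 / 2 : ℝ) • (f + σ f) + (-1 : ℝ) ^ p.val • (1 / 2 : ℝ) • (f - σ f)) * u f' := by
  have v0 : (0 : ZMod 2).val = 0 := rfl
  have v1 : (1 : ZMod 2).val = 1 := rfl
  -- `val` reduces modulo `2`, so this sign is checked on both residues.
  have vp : (-1 : ℝ) ^ (p + 1).val = (-1) * (-1 : ℝ) ^ p.val := by
    fin_cases p
    · change (-1 : ℝ) ^ 1 = -1 * (-1) ^ 0
      norm_num
    · change (-1 : ℝ) ^ 0 = -1 * (-1) ^ 1
      norm_num
  have dec : ∀ f : A, (1 / 2 : ℝ) • (f + σ f) + (1 / 2 : ℝ) • (f - σ f) = f := fun f => by module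
  have hP0 : ∀ f : A, σ ((1 / 2 : ℝ) • (f + σ f)) = (-1 : ℝ) ^ (0 : ZMod 2).val •
      ((1 / 2 : ℝ) • (f + σ f)) := fun f => by
    rw [map_smul, map_add, hσ, v0]; module
  have hP1 : ∀ f : A, σ ((1 / 2 : ℝ) • (f - σ f)) = (-1 : ℝ) ^ (1 : ZMod 2).val •
      ((1 / 2 : ℝ) • (f - σ f)) := fun f => by
    rw [map_smul, map_sub, hσ, v1]; module
  constructor
  · rintro ⟨h1, h2⟩
    refine ⟨fun f => ?_, fun f f' => ?_⟩
    · have a0 := h1 0 _ (hP0 f)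
      have a1 := h1 1 _ (hP1 f)
      rw [add_zero] at a0
      rw [vp] at a1
      have e1 : σ f = (1 / 2 : ℝ) • (f + σ f) - (1 / 2 : ℝ) • (f - σ f) := by module
      have e2 : u f = u ((1 / 2 : ℝ) • (f + σ f)) + u ((1 / 2 : ℝ) • (f - σ f)) := by
        rw [← map_add, dec]
      rw [e2, map_add, a0, a1]
      conv_rhs => rw [e1, map_sub]
      module
    -- First free the second factor from homogeneity, with the first one still homogeneous.
    · have hom : ∀ (q : ZMod 2) (f : A), σ f = (-1 : ℝ) ^ q.val • f → ∀ f', u (f * f') = u f * f' +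
          (-1 : ℝ) ^ (p.val * q.val) • (f * u f') := by
        intro q f hf f'
        have key : ∀ a b : A, σ a = (-1 : ℝ) ^ (0 : ZMod 2).val • a →
            σ b = (-1 : ℝ) ^ (1 : ZMod 2).val • b → u (f * (a + b)) = u f * (a + b) +
              (-1 : ℝ) ^ (p.val * q.val) • (f * u (a + b)) := by
          intro a b ha hb
          rw [mul_add, map_add, h2 q 0 f a hf ha, h2 q 1 f b hf hb, map_add, mul_add, mul_add,
            smul_add, add_add_add_comm]
        simpa only [dec] using key _ _ (hP0 f') (hP1 f')
      have b0 := hom 0 _ (hP0 f) f'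
      have b1 := hom 1 _ (hP1 f) f'
      rw [v0, mul_zero, pow_zero, one_smul] at b0
      rw [v1, mul_one] at b1
      conv_lhs => rw [← dec f, add_mul, map_add, b0, b1]
      rw [add_mul _ _ (u f'), smul_mul_assoc ((-1 : ℝ) ^ p.val)]
      have e2 : u f * f' = u ((1 / 2 : ℝ) • (f + σ f)) * f' + u ((1 / 2 : ℝ) • (f - σ f)) * f' := by
        rw [← add_mul, ← map_add, dec]
      rw [e2, add_add_add_comm]
  · rintro ⟨h1, h2⟩
    refine ⟨fun q f hf => ?_, fun q q' f f' hf _ => ?_⟩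
    · rw [h1, hf, map_smul, smul_smul]
      congr 1
      fin_cases q
      · change (-1 : ℝ) ^ p.val * (-1) ^ 0 = (-1) ^ (p + 0).val
        rw [add_zero]; ring
      · change (-1 : ℝ) ^ p.val * (-1) ^ 1 = (-1) ^ (p + 1).val
        rw [vp]; ring
    · rw [h2, ← smul_mul_assoc, hf, pow_mul]
      congr 2
      fin_cases q
      · change (1 / 2 : ℝ) • (f + (-1 : ℝ) ^ 0 • f) +
          (-1 : ℝ) ^ p.val • (1 / 2 : ℝ) • (f - (-1 : ℝ) ^ 0 • f) = ((-1 : ℝ) ^ p.val) ^ 0 • f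
        simp only [pow_zero]
        module
      · change (1 / 2 : ℝ) • (f + (-1 : ℝ) ^ 1 • f) +
          (-1 : ℝ) ^ p.val • (1 / 2 : ℝ) • (f - (-1 : ℝ) ^ 1 • f) = ((-1 : ℝ) ^ p.val) ^ 1 • f
        simp only [pow_one]
        module

theorem half_smul_add_add_sub (f : A) : (1 / 2 : ℝ) • (f + σ f) +
    (-1 : ℝ) ^ (0 : ZMod 2).val • (1 / 2 : ℝ) • (f - σ f) = f := by
  have v0 : (0 : ZMod 2).val = 0 := rfl
  rw [v0]; module

theorem half_smul_add_sub_sub (f : A) : (1 / 2 : ℝ) • (f + σ f) +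
    (-1 : ℝ) ^ (1 : ZMod 2).val • (1 / 2 : ℝ) • (f - σ f) = σ f := by
  have v1 : (1 : ZMod 2).val = 1 := rfl
  rw [v1]; module

theorem gradedDer_zero_iff (hσ : ∀ a, σ (σ a) = a) :
    ((∀ (q : ZMod 2) (f : A), σ f = (-1 : ℝ) ^ q.val • f →
        σ (u f) = (-1 : ℝ) ^ ((0 : ZMod 2) + q).val • u f) ∧
      ∀ (q q' : ZMod 2) (f f' : A), σ f = (-1 : ℝ) ^ q.val • f → σ f' = (-1 : ℝ) ^ q'.val • f' →
        u (f * f') = u f * f' + (-1 : ℝ) ^ ((0 : ZMod 2).val * q.val) • (f * u f')) ↔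
      (∀ f, σ (u f) = u (σ f)) ∧ ∀ f f', u (f * f') = u f * f' + f * u f' := by
  rw [gradedDer_iff hσ]
  simp only [half_smul_add_add_sub]
  have v0 : (0 : ZMod 2).val = 0 := rfl
  simp only [v0, pow_zero, one_smul]

theorem gradedDer_one_iff (hσ : ∀ a, σ (σ a) = a) :
    ((∀ (q : ZMod 2) (f : A), σ f = (-1 : ℝ) ^ q.val • f →
        σ (u f) = (-1 : ℝ) ^ ((1 : ZMod 2) + q).val • u f) ∧
      ∀ (q q' : ZMod 2) (f f' : A), σ f = (-1 : ℝ) ^ q.val • f → σ f' = (-1 : ℝ) ^ q'.val • f' →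
        u (f * f') = u f * f' + (-1 : ℝ) ^ ((1 : ZMod 2).val * q.val) • (f * u f')) ↔
      (∀ f, σ (u f) = (-1 : ℝ) • u (σ f)) ∧ ∀ f f', u (f * f') = u f * f' + σ f * u f' := by
  rw [gradedDer_iff hσ]
  simp only [half_smul_add_sub_sub]
  have v1 : (1 : ZMod 2).val = 1 := rfl
  simp only [v1, pow_one]

end GradedAlgebra

/-! ### Local expressions of sections of `∧E*` and the parity involution of `𝒜(U)`. -/

section Derivation

variable {M : Type*} [NormedAddCommGroup M] [NormedSpace ℝ M]
  {Z : Type*} [TopologicalSpace Z] [ChartedSpace M Z]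
  {F₀ : Type*} [NormedAddCommGroup F₀] [NormedSpace ℝ F₀] [FiniteDimensional ℝ F₀]
  {F₁ : Type*} [NormedAddCommGroup F₁] [NormedSpace ℝ F₁] [FiniteDimensional ℝ F₁]
  {E₀ : Z → Type*} [TopologicalSpace (TotalSpace F₀ E₀)]
  [∀ z, AddCommGroup (E₀ z)] [∀ z, Module ℝ (E₀ z)] [∀ z, TopologicalSpace (E₀ z)]
  [FiberBundle F₀ E₀] [VectorBundle ℝ F₀ E₀]
  {E₁ : Z → Type*} [TopologicalSpace (TotalSpace F₁ E₁)]
  [∀ z, AddCommGroup (E₁ z)] [∀ z, Module ℝ (E₁ z)] [∀ z, TopologicalSpace (E₁ z)]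
  [FiberBundle F₁ E₁] [VectorBundle ℝ F₁ E₁]
  {U V : Opens Z}

theorem LFAt.lfSmoothAt_of_eventually {W : Type*} [AddCommMonoid W] [Module ℝ W] {P : Z → Prop}
    {H : Z → W} {h : {z // P z} → W} {x : {z // P z}}
    (hH : LFAt M H (x : Z)) (hP : ∀ᶠ z in 𝓝 (x : Z), P z)
    (e : ∀ᶠ y in 𝓝 (x : Z), ∀ hy : P y, h ⟨y, hy⟩ = H y) : LFSmoothAt M h x := by
  refine (lfSmoothAt_iff hP (ext0_of_mem h)).2 (hH.congr ?_)
  filter_upwards [hP, e] with y hy hy'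
  rw [← hy' hy]
  exact ext0_of_mem h ⟨y, hy⟩

theorem Opens.eventually_mem (U : Opens Z) (x : {z // z ∈ U}) : ∀ᶠ z in 𝓝 (x : Z), z ∈ U :=
  U.isOpen.mem_nhds x.2

theorem exists_mem_baseSet (z : Z) : ∃ i : LocTriv M F₀ F₁ E₀ E₁, z ∈ i.baseSet :=
  ⟨⟨chartAt M z, chart_mem_atlas M z, trivializationAt F₀ E₀ z, trivializationAt F₁ E₁ z,
    inferInstance, inferInstance⟩, mem_chart_source M z, mem_baseSet_trivializationAt F₀ E₀ z,
    mem_baseSet_trivializationAt F₁ E₁ z⟩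

/-- The local expression of a section of `∧E*`. -/
def BFun.loc (i : LocTriv M F₀ F₁ E₀ E₁) (f : BFun M F₀ F₁ E₀ E₁ U) : Z → SAlg F₀ F₁ :=
  ext0 fun z : {z // z ∈ U} => i.triv z (f.1 z)

theorem BFun.loc_apply (i : LocTriv M F₀ F₁ E₀ E₁) (f : BFun M F₀ F₁ E₀ E₁ U) (z : {z // z ∈ U}) :
    BFun.loc i f z = i.triv z (f.1 z) := ext0_of_mem _ z

theorem BFun.loc_of_notMem (i : LocTriv M F₀ F₁ E₀ E₁) (f : BFun M F₀ F₁ E₀ E₁ U) {z : Z}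
    (hz : z ∉ U) : BFun.loc i f z = 0 := dif_neg hz

theorem BFun.lfAt_loc {i : LocTriv M F₀ F₁ E₀ E₁} (f : BFun M F₀ F₁ E₀ E₁ U) {z : {z // z ∈ U}}
    (hi : (z : Z) ∈ i.baseSet) : LFAt M (BFun.loc i f) (z : Z) :=
  (f.2 i z hi).lfAt (Opens.eventually_mem U z)

theorem BFun.ext_triv {f g : BFun M F₀ F₁ E₀ E₁ U}
    (h : ∀ (z : {z // z ∈ U}) (i : LocTriv M F₀ F₁ E₀ E₁), (z : Z) ∈ i.baseSet →
      i.triv z (f.1 z) = i.triv z (g.1 z)) : f = g := by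
  refine Subtype.ext (funext fun z => ?_)
  obtain ⟨i, hi⟩ := exists_mem_baseSet (M := M) (F₀ := F₀) (F₁ := F₁) (E₀ := E₀) (E₁ := E₁) (z : Z)
  exact triv_injective hi (h z i hi)

theorem BFun.loc_add (i : LocTriv M F₀ F₁ E₀ E₁) (f g : BFun M F₀ F₁ E₀ E₁ U) (z : Z) :
    BFun.loc i (f + g) z = BFun.loc i f z + BFun.loc i g z := by
  by_cases hz : z ∈ U
  · have h := fun f : BFun M F₀ F₁ E₀ E₁ U => BFun.loc_apply i f ⟨z, hz⟩
    simp only at h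
    rw [h, h, h]; exact map_add _ _ _
  · simp only [BFun.loc_of_notMem i _ hz, add_zero]

theorem BFun.loc_mul (i : LocTriv M F₀ F₁ E₀ E₁) (f g : BFun M F₀ F₁ E₀ E₁ U) (z : Z) :
    BFun.loc i (f * g) z = BFun.loc i f z * BFun.loc i g z := by
  by_cases hz : z ∈ U
  · have h := fun f : BFun M F₀ F₁ E₀ E₁ U => BFun.loc_apply i f ⟨z, hz⟩
    simp only at h
    rw [h, h, h]; exact map_mul _ _ _
  · simp only [BFun.loc_of_notMem i _ hz, mul_zero]

theorem BFun.loc_smul (i : LocTriv M F₀ F₁ E₀ E₁) (r : ℝ) (f : BFun M F₀ F₁ E₀ E₁ U) (z : Z) :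
    BFun.loc i (r • f) z = r • BFun.loc i f z := by
  by_cases hz : z ∈ U
  · have h := fun f : BFun M F₀ F₁ E₀ E₁ U => BFun.loc_apply i f ⟨z, hz⟩
    simp only at h
    rw [h, h]; exact map_smul (i.triv z) r (f.1 ⟨z, hz⟩)
  · simp only [BFun.loc_of_notMem i _ hz, smul_zero]

theorem BFun.loc_change {i j : LocTriv M F₀ F₁ E₀ E₁} (f : BFun M F₀ F₁ E₀ E₁ U) {z : Z}
    (hi : z ∈ i.baseSet) (hj : z ∈ j.baseSet) :
    ∀ᶠ y in 𝓝 z, BFun.loc j f y = algChange i j y (BFun.loc i f y) := by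
  filter_upwards [i.isOpen_baseSet.mem_nhds hi, j.isOpen_baseSet.mem_nhds hj] with y hyi hyj
  by_cases hy : y ∈ U
  · have h := fun i => BFun.loc_apply i f ⟨y, hy⟩
    simp only at h
    rw [h, h, algChange_triv hyi hyj]
  · simp only [BFun.loc_of_notMem _ _ hy, map_zero]

/-- The parity involution of `𝒜(U)`. -/
def BFun.parity : BFun M F₀ F₁ E₀ E₁ U →ₐ[ℝ] BFun M F₀ F₁ E₀ E₁ U where
  toFun f := ⟨fun z => parityInv (f.1 z), fun i x hx => by
    have := (f.2 i x hx).map (parityInv (V₀ := F₀) (V₁ := F₁)).toLinearMap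
    simpa only [AlgHom.toLinearMap_apply, parityInv_triv] using this⟩
  map_one' := Subtype.ext (funext fun _ => map_one _)
  map_mul' _ _ := Subtype.ext (funext fun _ => map_mul _ _ _)
  map_zero' := Subtype.ext (funext fun _ => map_zero _)
  map_add' _ _ := Subtype.ext (funext fun _ => map_add _ _ _)
  commutes' _ := Subtype.ext (funext fun _ => AlgHom.commutes _ _)

theorem BFun.parity_apply (f : BFun M F₀ F₁ E₀ E₁ U) (z) :
    (BFun.parity f).1 z = parityInv (f.1 z) := rfl

theorem BFun.parity_parity (f : BFun M F₀ F₁ E₀ E₁ U) : BFun.parity (BFun.parity f) = f :=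
  Subtype.ext (funext fun _ => parityInv_parityInv _)

theorem BFun.loc_parity (i : LocTriv M F₀ F₁ E₀ E₁) (f : BFun M F₀ F₁ E₀ E₁ U) (z : Z) :
    BFun.loc i (BFun.parity f) z = parityInv (BFun.loc i f z) := by
  by_cases hz : z ∈ U
  · have h := fun f : BFun M F₀ F₁ E₀ E₁ U => BFun.loc_apply i f ⟨z, hz⟩
    simp only at h
    rw [h, h, parityInv_triv, BFun.parity_apply]
  · simp only [BFun.loc_of_notMem i _ hz, map_zero]

theorem hasParity_iff {f : BFun M F₀ F₁ E₀ E₁ U} {p : ZMod 2} :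
    HasParity p f ↔ BFun.parity f = (-1 : ℝ) ^ p.val • f :=
  ⟨fun h => Subtype.ext (funext h), fun h z => congrFun (congrArg Subtype.val h) z⟩

theorem mem_homDer_zero_iff {u : BFun M F₀ F₁ E₀ E₁ U →ₗ[ℝ] BFun M F₀ F₁ E₀ E₁ U} :
    u ∈ HomDer M F₀ F₁ E₀ E₁ U 0 ↔ (∀ f, BFun.parity (u f) = u (BFun.parity f)) ∧
      ∀ f f', u (f * f') = u f * f' + f * u f' := by
  refine Iff.trans ?_ (gradedDer_zero_iff (A := BFun M F₀ F₁ E₀ E₁ U) (σ := BFun.parity) (u := u)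
    BFun.parity_parity)
  simp only [← hasParity_iff]
  exact Iff.rfl

theorem mem_homDer_one_iff {u : BFun M F₀ F₁ E₀ E₁ U →ₗ[ℝ] BFun M F₀ F₁ E₀ E₁ U} :
    u ∈ HomDer M F₀ F₁ E₀ E₁ U 1 ↔ (∀ f, BFun.parity (u f) = (-1 : ℝ) • u (BFun.parity f)) ∧
      ∀ f f', u (f * f') = u f * f' + BFun.parity f * u f' := by
  refine Iff.trans ?_ (gradedDer_one_iff (A := BFun M F₀ F₁ E₀ E₁ U) (σ := BFun.parity) (u := u)
    BFun.parity_parity)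
  simp only [← hasParity_iff]
  exact Iff.rfl

end Derivation

/-! ### Even and odd parts of a linear endomorphism. -/

section GradedAlgebra

variable {R : Type*} [Semiring R] [Algebra ℝ R] {A : Subalgebra ℝ R} (σ : A →ₐ[ℝ] A) (D : A →ₗ[ℝ] A)

/-- Twice the even part (`ε = 1`) or the odd part (`ε = -1`) of a linear map. -/
def parityPart (ε : ℝ) : A →ₗ[ℝ] A := D + ε • σ.toLinearMap ∘ₗ D ∘ₗ σ.toLinearMap

theorem algHom_add_smul {A B : Type*} [Semiring A] [Algebra ℝ A] [Semiring B] [Algebra ℝ B]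
    (φ : A →ₐ[ℝ] B) (a b : A) (r : ℝ) : φ (a + r • b) = φ a + r • φ b := by
  rw [map_add, map_smul]

theorem algHom_mul_add_mul {A B : Type*} [Semiring A] [Algebra ℝ A] [Semiring B] [Algebra ℝ B]
    (φ : A →ₐ[ℝ] B) (a b c d : A) : φ (a * b + c * d) = φ a * φ b + φ c * φ d := by
  rw [map_add, map_mul, map_mul]

theorem linearMap_add_smul {A B : Type*} [AddCommMonoid A] [Module ℝ A] [AddCommMonoid B] [Module ℝ B]
    (φ : A →ₗ[ℝ] B) (a b : A) (r : ℝ) : φ (a + r • b) = φ a + r • φ b := by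
  rw [map_add, map_smul]

theorem parityPart_apply (ε : ℝ) (f : A) : parityPart σ D ε f = D f + ε • σ (D (σ f)) := rfl

theorem smul_parityPart_add : (1 / 2 : ℝ) • parityPart σ D 1 + (1 / 2 : ℝ) • parityPart σ D (-1) = D := by
  refine LinearMap.ext fun f => ?_
  simp only [LinearMap.add_apply, LinearMap.smul_apply, parityPart_apply]
  module

variable {σ} in
theorem map_parityPart (hσ : ∀ a, σ (σ a) = a) {ε : ℝ} (hε : ε * ε = 1) (f : A) :
    σ (parityPart σ D ε f) = ε • parityPart σ D ε (σ f) := by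
  rw [parityPart_apply, parityPart_apply, map_add, map_smul, hσ, hσ, smul_add, smul_smul, hε, one_smul,
    add_comm]

end GradedAlgebra

section FibreAction

variable {V₀ V₁ M : Type*} [AddCommGroup V₀] [Module ℝ V₀] [AddCommGroup V₁] [Module ℝ V₁]
  [AddCommGroup M] [Module ℝ M]

/-- `jetAct` as a bilinear map. -/
def jetActₗ : (SAlg V₀ V₁ × (M →ₗ[ℝ] SAlg V₀ V₁)) →ₗ[ℝ]
    SAlg V₀ V₁ ⊗[ℝ] ((V₀ × V₁) × M) →ₗ[ℝ] SAlg V₀ V₁ :=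
  LinearMap.mk₂ ℝ (fun q u => jetAct q.1 q.2 u) (fun _ _ _ => jetAct_add _ _ _ _ _)
    (fun _ _ _ => jetAct_smul _ _ _ _) (fun _ _ _ => map_add _ _ _) (fun _ _ _ => map_smul _ _ _)

end FibreAction

/-! ### From sections of `𝒱_E` to graded derivations. -/

section Derivation

variable {M : Type*} [NormedAddCommGroup M] [NormedSpace ℝ M] [FiniteDimensional ℝ M]
  {Z : Type*} [TopologicalSpace Z] [ChartedSpace M Z] [IsManifold 𝓘(ℝ, M) ∞ Z]
  {F₀ : Type*} [NormedAddCommGroup F₀] [NormedSpace ℝ F₀] [FiniteDimensional ℝ F₀]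
  {F₁ : Type*} [NormedAddCommGroup F₁] [NormedSpace ℝ F₁] [FiniteDimensional ℝ F₁]
  {E₀ : Z → Type*} [TopologicalSpace (TotalSpace F₀ E₀)]
  [∀ z, AddCommGroup (E₀ z)] [∀ z, Module ℝ (E₀ z)] [∀ z, TopologicalSpace (E₀ z)]
  [FiberBundle F₀ E₀] [VectorBundle ℝ F₀ E₀] [ContMDiffVectorBundle ∞ F₀ E₀ 𝓘(ℝ, M)]
  {E₁ : Z → Type*} [TopologicalSpace (TotalSpace F₁ E₁)]
  [∀ z, AddCommGroup (E₁ z)] [∀ z, Module ℝ (E₁ z)] [∀ z, TopologicalSpace (E₁ z)]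
  [FiberBundle F₁ E₁] [VectorBundle ℝ F₁ E₁] [ContMDiffVectorBundle ∞ F₁ E₁ 𝓘(ℝ, M)]
  {U V : Opens Z} {i j : LocTriv M F₀ F₁ E₀ E₁} {z : Z}

variable (M F₀ F₁ E₀ E₁) in
/-- A chart and trivializations at `z`. -/
def LocTriv.ofPoint (z : Z) : LocTriv M F₀ F₁ E₀ E₁ :=
  (exists_mem_baseSet z).choose

variable (M F₀ F₁ E₀ E₁) in
theorem LocTriv.mem_ofPoint (z : Z) : z ∈ (LocTriv.ofPoint M F₀ F₁ E₀ E₁ z).baseSet :=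
  (exists_mem_baseSet z).choose_spec

/-- The section of `∧E*` with the given local expressions. -/
def BFun.ofLocal (a : LocTriv M F₀ F₁ E₀ E₁ → Z → SAlg F₀ F₁)
    (ha : ∀ i j z, z ∈ U → z ∈ i.baseSet → z ∈ j.baseSet → algChange i j z (a i z) = a j z)
    (hs : ∀ (i : LocTriv M F₀ F₁ E₀ E₁) z, z ∈ U → z ∈ i.baseSet → LFAt M (a i) z) :
    BFun M F₀ F₁ E₀ E₁ U :=
  -- The trivialization chosen at each point is immaterial by `ha`; in particular the choice need
  -- not vary continuously.
  ⟨fun z => (LocTriv.ofPoint M F₀ F₁ E₀ E₁ (z : Z)).trivInv z (a (LocTriv.ofPoint M F₀ F₁ E₀ E₁ z) z),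
    fun i x hx => (hs i x x.2 hx).lfSmoothAt_of_eventually (Opens.eventually_mem U x) (by
      filter_upwards [i.isOpen_baseSet.mem_nhds hx] with y hy hyU
      have h := LocTriv.mem_ofPoint M F₀ F₁ E₀ E₁ y
      change i.triv y ((LocTriv.ofPoint M F₀ F₁ E₀ E₁ y).trivInv y _) = _
      rw [← algChange_triv h hy, triv_trivInv h, ha _ _ y hyU h hy])⟩

theorem BFun.triv_ofLocal (a : LocTriv M F₀ F₁ E₀ E₁ → Z → SAlg F₀ F₁)
    (ha : ∀ i j z, z ∈ U → z ∈ i.baseSet → z ∈ j.baseSet → algChange i j z (a i z) = a j z)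
    (hs : ∀ (i : LocTriv M F₀ F₁ E₀ E₁) z, z ∈ U → z ∈ i.baseSet → LFAt M (a i) z)
    (z : {z // z ∈ U}) (hz : (z : Z) ∈ i.baseSet) :
    i.triv z ((BFun.ofLocal a ha hs).1 z) = a i z := by
  have h := LocTriv.mem_ofPoint M F₀ F₁ E₀ E₁ (z : Z)
  change i.triv z ((LocTriv.ofPoint M F₀ F₁ E₀ E₁ (z : Z)).trivInv z _) = _
  rw [← algChange_triv h hz, triv_trivInv h, ha _ _ z z.2 h hz]

/-- The value at `z` of `u ∈ ∧F* ⊗ (F ⊕ M)`, read as a derivation in a trivialization, on a section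
of `∧E*`. -/
def secAct (i : LocTriv M F₀ F₁ E₀ E₁) (u : SAlg F₀ F₁ ⊗[ℝ] ((F₀ × F₁) × M))
    (f : BFun M F₀ F₁ E₀ E₁ U) (z : Z) : SAlg F₀ F₁ :=
  jetAct (BFun.loc i f z) (lDeriv i.chart (BFun.loc i f) z) u

theorem BFun.hasLD_loc (f : BFun M F₀ F₁ E₀ E₁ U) (hU : z ∈ U) (hi : z ∈ i.baseSet) :
    HasLD i.chart (BFun.loc i f) z (lDeriv i.chart (BFun.loc i f) z) :=
  (BFun.lfAt_loc (z := ⟨z, hU⟩) f hi).hasLD i.chart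

/-- Any local representative of `f` near `z` computes the action. The rules for sums, products,
parity and restrictions follow by taking the evident representative. -/
theorem secAct_eq_of_hasLD (f : BFun M F₀ F₁ E₀ E₁ U) (hU : z ∈ U) (hi : z ∈ i.baseSet)
    {h : Z → SAlg F₀ F₁} {D : M →ₗ[ℝ] SAlg F₀ F₁} (H : HasLD i.chart h z D)
    (e : ∀ᶠ y in 𝓝 z, BFun.loc i f y = h y) (u) : secAct i u f z = jetAct (h z) D u := by
  rw [secAct, (BFun.hasLD_loc f hU hi).unique i.chart_mem hi.1 (H.congr e), e.self_of_nhds]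

theorem secAct_coordChange (f : BFun M F₀ F₁ E₀ E₁ U) (hU : z ∈ U) (hi : z ∈ i.baseSet)
    (hj : z ∈ j.baseSet) (u) :
    secAct j (coordChange i j z u) f z = algChange i j z (secAct i u f z) :=
  jetAct_coordChange_of_eq hi hj (BFun.hasLD_loc f hU hi) (BFun.hasLD_loc f hU hj)
    (BFun.loc_change f hi hj) u

theorem secAct_add (f g : BFun M F₀ F₁ E₀ E₁ U) (hU : z ∈ U) (hi : z ∈ i.baseSet) (u) :
    secAct i u (f + g) z = secAct i u f z + secAct i u g z := by
  rw [secAct_eq_of_hasLD _ hU hi ((BFun.hasLD_loc f hU hi).add (BFun.hasLD_loc g hU hi))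
    (Eventually.of_forall fun y => BFun.loc_add i f g y), jetAct_add]
  rfl

theorem secAct_smul (r : ℝ) (f : BFun M F₀ F₁ E₀ E₁ U) (hU : z ∈ U) (hi : z ∈ i.baseSet) (u) :
    secAct i u (r • f) z = r • secAct i u f z := by
  rw [secAct_eq_of_hasLD _ hU hi ((BFun.hasLD_loc f hU hi).map (r • LinearMap.id))
    (Eventually.of_forall fun y => BFun.loc_smul i r f y)]
  exact jetAct_smul r (BFun.loc i f z) (lDeriv i.chart (BFun.loc i f) z) u

theorem secAct_parity (f : BFun M F₀ F₁ E₀ E₁ U) (hU : z ∈ U) (hi : z ∈ i.baseSet) (u) :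
    parityInv (secAct i u (BFun.parity f) z) = secAct i (parityW u) f z := by
  rw [secAct_eq_of_hasLD _ hU hi ((BFun.hasLD_loc f hU hi).map parityInv.toLinearMap)
    (Eventually.of_forall fun y => BFun.loc_parity i f y), secAct, jetAct_parityW]
  rfl

theorem secAct_mul_even (f g : BFun M F₀ F₁ E₀ E₁ U) (hU : z ∈ U) (hi : z ∈ i.baseSet) {u}
    (hu : parityW u = u) : secAct i u (f * g) z =
      secAct i u f z * BFun.loc i g z + BFun.loc i f z * secAct i u g z := by
  rw [secAct_eq_of_hasLD _ hU hi ((BFun.hasLD_loc f hU hi).mul i.chart_mem hi.1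
    (BFun.hasLD_loc g hU hi)) (Eventually.of_forall fun y => BFun.loc_mul i f g y), jetAct_mul_even hu]
  rfl

theorem secAct_mul_odd (f g : BFun M F₀ F₁ E₀ E₁ U) (hU : z ∈ U) (hi : z ∈ i.baseSet) {u}
    (hu : parityW u = (-1 : ℝ) • u) : secAct i u (f * g) z =
      secAct i u f z * BFun.loc i g z + parityInv (BFun.loc i f z) * secAct i u g z := by
  rw [secAct_eq_of_hasLD _ hU hi ((BFun.hasLD_loc f hU hi).mul i.chart_mem hi.1
    (BFun.hasLD_loc g hU hi)) (Eventually.of_forall fun y => BFun.loc_mul i f g y), jetAct_mul_odd hu]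
  rfl

theorem loc_res (h : V ≤ U) (f : BFun M F₀ F₁ E₀ E₁ U) (hV : z ∈ V) :
    ∀ᶠ y in 𝓝 z, BFun.loc i (BFun.res h f) y = BFun.loc i f y := by
  filter_upwards [V.isOpen.mem_nhds hV] with y hy
  exact (BFun.loc_apply i (BFun.res h f) ⟨y, hy⟩).trans (BFun.loc_apply i f ⟨y, h hy⟩).symm

theorem secAct_res (h : V ≤ U) (f : BFun M F₀ F₁ E₀ E₁ U) (hV : z ∈ V) (hi : z ∈ i.baseSet) (u) :
    secAct i u (BFun.res h f) z = secAct i u f z :=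
  secAct_eq_of_hasLD _ hV hi (BFun.hasLD_loc f (h hV) hi) (loc_res h f hV) u

/-- The local expression of a section of `𝒱_E`. -/
def secLoc (i : LocTriv M F₀ F₁ E₀ E₁) (s : VSections M F₀ F₁ E₀ E₁ U) :
    Z → SAlg F₀ F₁ ⊗[ℝ] ((F₀ × F₁) × M) :=
  ext0 fun z : {z // z ∈ U} => (s.1 z).1 i

theorem secLoc_apply (s : VSections M F₀ F₁ E₀ E₁ U) (z : {z // z ∈ U}) :
    secLoc i s z = (s.1 z).1 i := ext0_of_mem _ z

theorem coordChange_secLoc (s : VSections M F₀ F₁ E₀ E₁ U) (hU : z ∈ U) (hi : z ∈ i.baseSet)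
    (hj : z ∈ j.baseSet) : coordChange i j z (secLoc i s z) = secLoc j s z := by
  have h1 := secLoc_apply (i := i) s ⟨z, hU⟩
  have h2 := secLoc_apply (i := j) s ⟨z, hU⟩
  simp only at h1 h2
  rw [h1, h2]
  exact (s.1 ⟨z, hU⟩).2.2 i j hi hj

theorem lfAt_secLoc (s : VSections M F₀ F₁ E₀ E₁ U) (hU : z ∈ U) (hi : z ∈ i.baseSet) :
    LFAt M (secLoc i s) z :=
  LFSmoothAt.lfAt (x := (⟨z, hU⟩ : {z // z ∈ U})) (s.2 i ⟨z, hU⟩ hi) (U.isOpen.mem_nhds hU)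

theorem lfAt_secAct {u : Z → SAlg F₀ F₁ ⊗[ℝ] ((F₀ × F₁) × M)} (hu : LFAt M u z)
    (f : BFun M F₀ F₁ E₀ E₁ U) (hU : z ∈ U) (hi : z ∈ i.baseSet) :
    LFAt M (fun y => secAct i (u y) f y) z := by
  have h1 := BFun.lfAt_loc (z := ⟨z, hU⟩) f hi
  have h2 := h1.lDeriv i.chart_mem hi.1
  have h3 := (h1.map (LinearMap.inl ℝ (SAlg F₀ F₁) (M →ₗ[ℝ] SAlg F₀ F₁))).add
    (h2.map (LinearMap.inr ℝ (SAlg F₀ F₁) (M →ₗ[ℝ] SAlg F₀ F₁)))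
  refine (h3.bilin jetActₗ hu).congr (Eventually.of_forall fun y => ?_)
  simp [jetActₗ, secAct]

/-- The action of a section of `𝒱_E` on a section of `∧E*`. -/
def secDer (s : VSections M F₀ F₁ E₀ E₁ U) (f : BFun M F₀ F₁ E₀ E₁ U) : BFun M F₀ F₁ E₀ E₁ U :=
  BFun.ofLocal (fun i z => secAct i (secLoc i s z) f z)
    (fun i j z hU hi hj => by
      rw [← secAct_coordChange f hU hi hj, coordChange_secLoc s hU hi hj])
    (fun _ _ hU hi => lfAt_secAct (lfAt_secLoc s hU hi) f hU hi)

theorem triv_secDer (s : VSections M F₀ F₁ E₀ E₁ U) (f : BFun M F₀ F₁ E₀ E₁ U) (z : {z // z ∈ U})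
    (hi : (z : Z) ∈ i.baseSet) : i.triv z ((secDer s f).1 z) = secAct i ((s.1 z).1 i) f z := by
  rw [secDer, BFun.triv_ofLocal _ _ _ z hi, secLoc_apply]

/-- The action of a section of `𝒱_E` as a linear endomorphism of `𝒜(U)`. -/
def secDerₗ (s : VSections M F₀ F₁ E₀ E₁ U) : BFun M F₀ F₁ E₀ E₁ U →ₗ[ℝ] BFun M F₀ F₁ E₀ E₁ U where
  toFun := secDer s
  map_add' f g := BFun.ext_triv fun z i hi => by
    refine (triv_secDer s _ z hi).trans ((secAct_add f g z.2 hi _).trans ?_)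
    rw [← triv_secDer s f z hi, ← triv_secDer s g z hi]
    exact (map_add (i.triv z) _ _).symm
  map_smul' r f := BFun.ext_triv fun z i hi => by
    refine (triv_secDer s _ z hi).trans ((secAct_smul r f z.2 hi _).trans ?_)
    rw [← triv_secDer s f z hi]
    exact (map_smul (i.triv z) r _).symm

/-- Twice the even part (`ε = 1`) or the odd part (`ε = -1`) of `secDerₗ s`. -/
def secDerPart (ε : ℝ) (s : VSections M F₀ F₁ E₀ E₁ U) :
    BFun M F₀ F₁ E₀ E₁ U →ₗ[ℝ] BFun M F₀ F₁ E₀ E₁ U :=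
  parityPart (A := BFun M F₀ F₁ E₀ E₁ U) BFun.parity (secDerₗ s) ε

/-- Conjugating the derivation with the parity involution of `𝒜(U)` amounts to applying `parityW` to
its coefficients, so the parity decomposition can be made in the fibre. -/
theorem triv_secDerPart (ε : ℝ) (s : VSections M F₀ F₁ E₀ E₁ U)
    (f : BFun M F₀ F₁ E₀ E₁ U) (z : {z // z ∈ U}) (hi : (z : Z) ∈ i.baseSet) :
    i.triv z ((secDerPart ε s f).1 z) =
      secAct i ((s.1 z).1 i + ε • parityW ((s.1 z).1 i)) f z := by
  have h1 := triv_secDer s f z hi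
  have h2 := triv_secDer s (BFun.parity f) z hi
  have h3 : i.triv z ((BFun.parity (secDer s (BFun.parity f))).1 z) =
      secAct i (parityW ((s.1 z).1 i)) f z := by
    rw [BFun.parity_apply, ← parityInv_triv, h2, secAct_parity f z.2 hi]
  have h4 : secAct i ((s.1 z).1 i + ε • parityW ((s.1 z).1 i)) f z =
      secAct i ((s.1 z).1 i) f z + ε • secAct i (parityW ((s.1 z).1 i)) f z := by
    exact linearMap_add_smul (jetAct _ _) _ _ _
  rw [h4, ← h1, ← h3]
  exact algHom_add_smul (i.triv z) _ _ _

theorem parityW_parityW (u : SAlg F₀ F₁ ⊗[ℝ] ((F₀ × F₁) × M)) : parityW (parityW u) = u := by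
  induction u using TensorProduct.induction_on with
  | zero => simp only [map_zero]
  | add u v hu hv => rw [map_add, map_add, hu, hv]
  | tmul a p =>
    obtain ⟨⟨v₀, v₁⟩, t⟩ := p
    rw [parityW_tmul, parityW_tmul, parityInv_parityInv, smul_smul]
    norm_num

theorem parityW_add_smul_parityW {ε : ℝ} (hε : ε * ε = 1) (u : SAlg F₀ F₁ ⊗[ℝ] ((F₀ × F₁) × M)) :
    parityW (u + ε • parityW u) = ε • (u + ε • parityW u) := by
  rw [map_add, map_smul, parityW_parityW, smul_add, smul_smul, hε, one_smul, add_comm]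

/-- The two symmetrizations have coefficients that are fixed, respectively negated, by `parityW` at
every point. The Leibniz rules of the fibre action then apply to each, and half their sum is the
given map. -/
theorem secDerₗ_mem (s : VSections M F₀ F₁ E₀ E₁ U) : secDerₗ s ∈ GDer M F₀ F₁ E₀ E₁ U := by
  have h : (1 / 2 : ℝ) • secDerPart 1 s + (1 / 2 : ℝ) • secDerPart (-1) s = secDerₗ s :=
    smul_parityPart_add (A := BFun M F₀ F₁ E₀ E₁ U) BFun.parity (secDerₗ s)
  rw [← h]
  refine Submodule.add_mem_sup (Submodule.smul_mem _ _ (mem_homDer_zero_iff.2 ⟨fun f => ?_, fun f g => ?_⟩))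
    (Submodule.smul_mem _ _ (mem_homDer_one_iff.2 ⟨fun f => ?_, fun f g => ?_⟩))
  · exact (map_parityPart (A := BFun M F₀ F₁ E₀ E₁ U) (secDerₗ s) BFun.parity_parity
      (one_mul 1) f).trans (one_smul ℝ _)
  · refine BFun.ext_triv fun z i hi => ?_
    have hu := (parityW_add_smul_parityW (one_mul 1) ((s.1 z).1 i)).trans (one_smul ℝ _)
    refine (triv_secDerPart _ s _ z hi).trans ((secAct_mul_even f g z.2 hi hu).trans ?_)
    exact ((algHom_mul_add_mul (i.triv z) _ _ _ _).trans (congrArg₂ (· + ·)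
      (congrArg₂ (· * ·) (triv_secDerPart _ s f z hi) (BFun.loc_apply i g z).symm)
      (congrArg₂ (· * ·) (BFun.loc_apply i f z).symm (triv_secDerPart _ s g z hi)))).symm
  · exact map_parityPart (A := BFun M F₀ F₁ E₀ E₁ U) (secDerₗ s) BFun.parity_parity (by norm_num) f
  · refine BFun.ext_triv fun z i hi => ?_
    have hu := parityW_add_smul_parityW (ε := -1) (by norm_num) ((s.1 z).1 i)
    refine (triv_secDerPart _ s _ z hi).trans ((secAct_mul_odd f g z.2 hi hu).trans ?_)
    rw [← BFun.loc_parity]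
    exact ((algHom_mul_add_mul (i.triv z) _ _ _ _).trans (congrArg₂ (· + ·)
      (congrArg₂ (· * ·) (triv_secDerPart _ s f z hi) (BFun.loc_apply i g z).symm)
      (congrArg₂ (· * ·) (BFun.loc_apply i (BFun.parity f) z).symm (triv_secDerPart _ s g z hi)))).symm

/-- The graded derivation of `𝒜(U)` given by a section of `𝒱_E`. -/
def toDer (s : VSections M F₀ F₁ E₀ E₁ U) : GDer M F₀ F₁ E₀ E₁ U := ⟨secDerₗ s, secDerₗ_mem s⟩

theorem secDer_add (s t : VSections M F₀ F₁ E₀ E₁ U) (f : BFun M F₀ F₁ E₀ E₁ U) :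
    secDer (s + t) f = secDer s f + secDer t f := BFun.ext_triv fun z i hi => by
  refine (triv_secDer (s + t) f z hi).trans ?_
  have h1 := triv_secDer s f z hi
  have h2 := triv_secDer t f z hi
  refine (map_add (jetAct _ _) ((s.1 z).1 i) ((t.1 z).1 i)).trans ?_
  exact (congrArg₂ (· + ·) h1.symm h2.symm).trans (map_add (i.triv z) _ _).symm

theorem secDer_smul (r : ℝ) (s : VSections M F₀ F₁ E₀ E₁ U) (f : BFun M F₀ F₁ E₀ E₁ U) :
    secDer (r • s) f = r • secDer s f := BFun.ext_triv fun z i hi => by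
  refine (triv_secDer (r • s) f z hi).trans ?_
  have h1 := triv_secDer s f z hi
  refine (map_smul (jetAct _ _) r ((s.1 z).1 i)).trans ?_
  exact (congrArg _ h1.symm).trans (map_smul (i.triv z) r _).symm

end Derivation

/-! ### Hadamard's lemma in a normed space. -/

section Hadamard

/-- Integrals over `[0, 1]` of smooth families of smooth functions are smooth. -/
theorem contDiff_integral_unitInterval {P G : Type*} [NormedAddCommGroup P] [NormedSpace ℝ P]
    [NormedAddCommGroup G] [NormedSpace ℝ G] [CompleteSpace G] {F : P → ℝ → G}
    (hF : ContDiff ℝ ∞ fun q : P × ℝ => F q.1 q.2) :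
    ContDiff ℝ ∞ fun y => ∫ t in (0 : ℝ)..1, F y t := by
  -- The integral is the convolution at `0` of the indicator of `(0, 1]` with `g y`. The reflection
  -- in `-s` undoes that of the convolution, and the bump, equal to `1` on `[-1, 1]`, provides
  -- compact support without changing the integral.
  let ψ : ContDiffBump (0 : ℝ) := ⟨1, 2, one_pos, one_lt_two⟩
  let g : P → ℝ → G := fun y s => ψ s • F y (-s)
  have hg : ContDiff ℝ ∞ (Function.uncurry g) := by
    have h1 : ContDiff ℝ ∞ fun q : P × ℝ => ψ q.2 := ψ.contDiff.comp contDiff_snd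
    have h2 : ContDiff ℝ ∞ fun q : P × ℝ => F q.1 (-q.2) :=
      hF.comp (contDiff_fst.prodMk contDiff_snd.neg)
    exact h1.smul h2
  have hloc : MeasureTheory.LocallyIntegrable ((Ioc (0 : ℝ) 1).indicator fun _ => (1 : ℝ))
      MeasureTheory.volume := by
    apply MeasureTheory.Integrable.locallyIntegrable
    rw [MeasureTheory.integrable_indicator_iff measurableSet_Ioc]
    exact MeasureTheory.integrableOn_const (by simp) (by simp)
  have key := MeasureTheory.contDiffOn_convolution_right_with_param_comp (n := ⊤)
    (μ := MeasureTheory.volume) (ContinuousLinearMap.lsmul ℝ ℝ : ℝ →L[ℝ] G →L[ℝ] G)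
    (s := (univ : Set P)) (v := fun _ => (0 : ℝ)) contDiffOn_const isOpen_univ
    (isCompact_closedBall (0 : ℝ) 2) (f := (Ioc (0 : ℝ) 1).indicator fun _ => (1 : ℝ)) (g := g)
    (fun p x _ hx => by
      have : ψ x = 0 := ψ.zero_of_le_dist (by
        rw [Metric.mem_closedBall, not_le] at hx; exact hx.le)
      simp [g, this]) hloc hg.contDiffOn
  rw [contDiffOn_univ] at key
  convert key using 2 with y
  rw [intervalIntegral.integral_of_le zero_le_one, MeasureTheory.convolution,
    ← MeasureTheory.integral_indicator measurableSet_Ioc]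
  congr 1
  ext t
  by_cases ht : t ∈ Ioc (0 : ℝ) 1
  · have : ψ (-t) = 1 := ψ.one_of_mem_closedBall (by
      rw [mem_closedBall_zero_iff, norm_neg, Real.norm_eq_abs, abs_of_pos ht.1]; exact ht.2)
    simp [ht, g, this]
  · simp [ht]

/-- Hadamard's lemma. -/
theorem exists_contDiff_eq_add_apply_sub {M : Type*} [NormedAddCommGroup M] [NormedSpace ℝ M]
    {f : M → ℝ} (hf : ContDiff ℝ ∞ f) (p : M) :
    ∃ h : M → M →L[ℝ] ℝ, ContDiff ℝ ∞ h ∧ ∀ y, f y = f p + h y (y - p) := by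
  have hd : ContDiff ℝ ∞ (fderiv ℝ f) := hf.fderiv_right (by simp)
  have hl : ContDiff ℝ ∞ fun q : M × ℝ => p + q.2 • (q.1 - p) :=
    contDiff_const.add (contDiff_snd.smul (contDiff_fst.sub contDiff_const))
  -- Integrate the derivative of `f` along the segment from `p` to `y`.
  refine ⟨fun y => ∫ t in (0 : ℝ)..1, fderiv ℝ f (p + t • (y - p)),
    contDiff_integral_unitInterval (hd.comp hl), fun y => ?_⟩
  have hc : Continuous fun t : ℝ => fderiv ℝ f (p + t • (y - p)) :=
    hd.continuous.comp (by fun_prop)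
  rw [ContinuousLinearMap.intervalIntegral_apply (hc.intervalIntegrable 0 1)]
  have h1 : ∀ t ∈ uIcc (0 : ℝ) 1, HasDerivAt (fun t : ℝ => f (p + t • (y - p)))
      (fderiv ℝ f (p + t • (y - p)) (y - p)) t := fun t _ => by
    have h2 : HasDerivAt (fun t : ℝ => p + t • (y - p)) (y - p) t := by
      simpa using ((hasDerivAt_id t).smul_const (y - p)).const_add p
    exact ((hf.differentiable (by simp)) _).hasFDerivAt.comp_hasDerivAt t h2
  rw [intervalIntegral.integral_eq_sub_of_hasDerivAt h1
    ((hc.clm_apply continuous_const).intervalIntegrable 0 1)]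
  simp

end Hadamard

/-! ### Bump functions and Hadamard's lemma on a manifold. -/

section Bump

variable {M : Type*} [NormedAddCommGroup M] [NormedSpace ℝ M] [FiniteDimensional ℝ M]
  {Z : Type*} [TopologicalSpace Z] [ChartedSpace M Z] [IsManifold 𝓘(ℝ, M) ∞ Z]

/-- With these functions local data near a point are realized by sections over all of `U`. -/
theorem exists_bump [T2Space Z] {x : Z} {N : Set Z} (hN : N ∈ 𝓝 x) : ∃ χ : Z → ℝ,
    ContMDiff 𝓘(ℝ, M) 𝓘(ℝ, ℝ) ∞ χ ∧ tsupport χ ⊆ N ∧ χ =ᶠ[𝓝 x] 1 := by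
  obtain ⟨χ, -, h⟩ := (SmoothBumpFunction.nhds_basis_tsupport (I := 𝓘(ℝ, M)) x).mem_iff.1 hN
  exact ⟨χ, χ.contMDiff, h, χ.eventuallyEq_one⟩

/-- Away from the support the product vanishes on a neighbourhood, whatever `g` does there. -/
theorem contMDiff_bump_smul {G : Type*} [NormedAddCommGroup G] [NormedSpace ℝ G] {χ : Z → ℝ}
    (hχ : ContMDiff 𝓘(ℝ, M) 𝓘(ℝ, ℝ) ∞ χ) {g : Z → G}
    (hg : ∀ y ∈ tsupport χ, ContMDiffAt 𝓘(ℝ, M) 𝓘(ℝ, G) ∞ g y) :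
    ContMDiff 𝓘(ℝ, M) 𝓘(ℝ, G) ∞ fun y => χ y • g y := by
  intro y
  by_cases hy : y ∈ tsupport χ
  · exact (hχ y).smul (hg y hy)
  · have : (fun y => χ y • g y) =ᶠ[𝓝 y] fun _ => 0 := by
      filter_upwards [notMem_tsupport_iff_eventuallyEq.1 hy] with z hz
      rw [hz]; simp
    exact contMDiffAt_const.congr_of_eventuallyEq this

/-- Hadamard's lemma on a manifold: near `x`, a smooth function is a constant plus a sum of smooth
functions times chart coordinates vanishing at `x`. -/
theorem exists_hadamard [T2Space Z] {φ : OpenPartialHomeomorph Z M} (hφ : φ ∈ atlas M Z) {x : Z}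
    (hx : x ∈ φ.source) {g : Z → ℝ} (hg : ∀ᶠ y in 𝓝 x, ContMDiffAt 𝓘(ℝ, M) 𝓘(ℝ, ℝ) ∞ g y) :
    ∃ h : Fin (Module.finrank ℝ M) → Z → ℝ,
      (∀ b, ContMDiff 𝓘(ℝ, M) 𝓘(ℝ, ℝ) ∞ (h b)) ∧ ∀ᶠ y in 𝓝 x,
        g y = g x + ∑ b, h b y * (Module.finBasis ℝ M).coord b (φ y - φ x) := by
  -- extend `g` from a neighbourhood of `x` to a function on the model space
  have h1 : ∀ᶠ y in 𝓝 (φ x), y ∈ φ.target ∧ ContMDiffAt 𝓘(ℝ, M) 𝓘(ℝ, ℝ) ∞ g (φ.symm y) :=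
    Filter.Eventually.and (φ.open_target.mem_nhds (φ.map_source hx)) ((φ.tendsto_symm hx).eventually hg)
  obtain ⟨θ, hθ, hθs, hθ1⟩ := exists_bump (M := M) (Z := M) h1
  have hf : ContDiff ℝ ∞ fun y => θ y • g (φ.symm y) := by
    rw [← contMDiff_iff_contDiff]
    refine contMDiff_bump_smul hθ fun y hy => ?_
    have h2 := hθs hy
    rw [contMDiffAt_iff_contDiffAt]
    have := contDiffAt_comp_chart_symm hφ (φ.map_target h2.1) h2.2
    rwa [φ.right_inv h2.1] at this
  obtain ⟨k, hk, hfk⟩ := exists_contDiff_eq_add_apply_sub hf (φ x)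
  -- A second cutoff, on `Z`, makes the pulled-back coefficients smooth on the whole manifold.
  obtain ⟨χ, hχ, hχs, hχ1⟩ := exists_bump (M := M) (φ.open_source.mem_nhds hx)
  refine ⟨fun b y => χ y • k (φ y) (Module.finBasis ℝ M b), fun b => contMDiff_bump_smul hχ fun y hy =>
    ?_, ?_⟩
  · have h2 : ContDiff ℝ ∞ fun y => k y (Module.finBasis ℝ M b) := hk.clm_apply contDiff_const
    exact (h2.contMDiff _).comp y (contMDiffAt_chart hφ (hχs hy))
  · filter_upwards [hχ1, (φ.continuousAt hx).eventually hθ1, φ.open_source.mem_nhds hx] with y hy1 hy2 hy3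
    have h3 := hfk (φ y)
    simp only [hy2, hθ1.self_of_nhds, Pi.one_apply, one_smul, φ.left_inv hx, φ.left_inv hy3] at h3
    rw [h3]
    congr 1
    conv_lhs => rw [← (Module.finBasis ℝ M).sum_repr (φ y - φ x), map_sum]
    refine Finset.sum_congr rfl fun b _ => ?_
    simp [hy1, mul_comm]

end Bump

section Algebra

variable {A : Type*} [Ring A]

theorem eq_zero_of_eq_mul_one_add {a : A} (h : a = a * 1 + 1 * a) : a = 0 := by
  rwa [mul_one, one_mul, left_eq_add] at h

theorem eq_of_mul_add_one_mul_eq {a b c c' : A} (h : a * b + 1 * c = a * b + 1 * c') : c = c' := by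
  rwa [one_mul, one_mul, add_right_inj] at h

end Algebra

section JetAct

variable {V₀ V₁ M : Type*} [AddCommGroup V₀] [Module ℝ V₀] [AddCommGroup V₁] [Module ℝ V₁]
  [AddCommGroup M] [Module ℝ M]

theorem jetAct_smul_one_zero (r : ℝ) (u : SAlg V₀ V₁ ⊗[ℝ] ((V₀ × V₁) × M)) :
    jetAct (r • (1 : SAlg V₀ V₁)) (0 : M →ₗ[ℝ] SAlg V₀ V₁) u = 0 := by
  induction u using TensorProduct.induction_on with
  | zero => simp only [map_zero]
  | add u v hu hv => rw [map_add, hu, hv, add_zero]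
  | tmul a p => rw [jetAct_tmul, LinearMap.map_smul, contract_one, smul_zero, LinearMap.zero_apply,
      add_zero, mul_zero]

/-- Contractions annihilate multiples of `1`, so for a real function only the differential matters.
-/
theorem jetAct_smul_one (r : ℝ) (D : M →ₗ[ℝ] SAlg V₀ V₁) (u : SAlg V₀ V₁ ⊗[ℝ] ((V₀ × V₁) × M)) :
    jetAct (r • (1 : SAlg V₀ V₁)) D u = jetAct 0 D u := by
  have h := jetAct_add (r • (1 : SAlg V₀ V₁)) 0 0 D u
  rwa [jetAct_smul_one_zero, zero_add, zero_add, add_zero] at h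

end JetAct

/-! ### Cut-off constants and coordinates as elements of `𝒜(U)`. -/

section Cutoff

variable {M : Type*} [NormedAddCommGroup M] [NormedSpace ℝ M] [FiniteDimensional ℝ M]
  {Z : Type*} [TopologicalSpace Z] [ChartedSpace M Z] [IsManifold 𝓘(ℝ, M) ∞ Z]
  {F₀ : Type*} [NormedAddCommGroup F₀] [NormedSpace ℝ F₀] [FiniteDimensional ℝ F₀]
  {F₁ : Type*} [NormedAddCommGroup F₁] [NormedSpace ℝ F₁] [FiniteDimensional ℝ F₁]
  {E₀ : Z → Type*} [TopologicalSpace (TotalSpace F₀ E₀)]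
  [∀ z, AddCommGroup (E₀ z)] [∀ z, Module ℝ (E₀ z)] [∀ z, TopologicalSpace (E₀ z)]
  [FiberBundle F₀ E₀] [VectorBundle ℝ F₀ E₀] [ContMDiffVectorBundle ∞ F₀ E₀ 𝓘(ℝ, M)]
  {E₁ : Z → Type*} [TopologicalSpace (TotalSpace F₁ E₁)]
  [∀ z, AddCommGroup (E₁ z)] [∀ z, Module ℝ (E₁ z)] [∀ z, TopologicalSpace (E₁ z)]
  [FiberBundle F₁ E₁] [VectorBundle ℝ F₁ E₁] [ContMDiffVectorBundle ∞ F₁ E₁ 𝓘(ℝ, M)]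
  {U V : Opens Z} {i j : LocTriv M F₀ F₁ E₀ E₁} {z x : Z}

theorem BFun.loc_ofLocal (a : LocTriv M F₀ F₁ E₀ E₁ → Z → SAlg F₀ F₁)
    (ha : ∀ i j z, z ∈ U → z ∈ i.baseSet → z ∈ j.baseSet → algChange i j z (a i z) = a j z)
    (hs : ∀ (i : LocTriv M F₀ F₁ E₀ E₁) z, z ∈ U → z ∈ i.baseSet → LFAt M (a i) z)
    (hU : z ∈ U) (hi : z ∈ i.baseSet) : BFun.loc i (BFun.ofLocal a ha hs) z = a i z :=
  (BFun.loc_apply i _ ⟨z, hU⟩).trans (BFun.triv_ofLocal a ha hs ⟨z, hU⟩ hi)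

theorem BFun.ext_loc {f g : BFun M F₀ F₁ E₀ E₁ U}
    (h : ∀ (i : LocTriv M F₀ F₁ E₀ E₁) (z : Z), z ∈ U → z ∈ i.baseSet →
      BFun.loc i f z = BFun.loc i g z) : f = g :=
  BFun.ext_triv fun z i hi => by
    rw [← BFun.loc_apply, ← BFun.loc_apply]; exact h i z z.2 hi

theorem BFun.loc_one (hU : z ∈ U) : BFun.loc i (1 : BFun M F₀ F₁ E₀ E₁ U) z = 1 :=
  (BFun.loc_apply i _ ⟨z, hU⟩).trans (map_one (i.triv z))

theorem BFun.loc_sum {κ : Type*} (s : Finset κ) (f : κ → BFun M F₀ F₁ E₀ E₁ U) :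
    BFun.loc i (∑ k ∈ s, f k) z = ∑ k ∈ s, BFun.loc i (f k) z := by
  classical
  induction s using Finset.induction_on with
  | empty =>
    have h := BFun.loc_smul i 0 (0 : BFun M F₀ F₁ E₀ E₁ U) z
    rw [zero_smul, zero_smul] at h
    simp only [Finset.sum_empty, h]
  | insert a s ha ih => rw [Finset.sum_insert ha, Finset.sum_insert ha, BFun.loc_add, ih]

/-- A smooth real function as an element of `𝒜(U)`. -/
def BFun.ofReal (g : Z → ℝ) (hg : ContMDiff 𝓘(ℝ, M) 𝓘(ℝ, ℝ) ∞ g) : BFun M F₀ F₁ E₀ E₁ U :=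
  BFun.ofLocal (fun _ z => g z • (1 : SAlg F₀ F₁))
    (fun i j z _ _ _ => by rw [map_smul, map_one])
    (fun _ _ _ _ => LFAt.smul_const (Eventually.of_forall fun y => hg y) _)

theorem BFun.loc_ofReal (g : Z → ℝ) (hg : ContMDiff 𝓘(ℝ, M) 𝓘(ℝ, ℝ) ∞ g) (hU : z ∈ U)
    (hi : z ∈ i.baseSet) :
    BFun.loc i (BFun.ofReal g hg : BFun M F₀ F₁ E₀ E₁ U) z = g z • (1 : SAlg F₀ F₁) :=
  BFun.loc_ofLocal _ _ _ hU hi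

/-- On the support of `χ` the point lies in the domain of `i` and the cocycle relation applies; off
the support both sides vanish. Hence `z` itself need not be assumed to lie in that domain. -/
theorem bump_smul_algChange {χ : Z → ℝ} (hs : tsupport χ ⊆ i.baseSet) {j k : LocTriv M F₀ F₁ E₀ E₁}
    (hj : z ∈ j.baseSet) (hk : z ∈ k.baseSet) (w : SAlg F₀ F₁) :
    algChange j k z (χ z • algChange i j z w) = χ z • algChange i k z w := by
  by_cases hz : z ∈ tsupport χ
  · rw [map_smul, algChange_algChange (hs hz) hj hk]
  · rw [image_eq_zero_of_notMem_tsupport hz, zero_smul, zero_smul, map_zero]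

theorem lfAt_bump_smul_algChange {χ : Z → ℝ} (hχ : ContMDiff 𝓘(ℝ, M) 𝓘(ℝ, ℝ) ∞ χ)
    (hs : tsupport χ ⊆ i.baseSet) (hj : z ∈ j.baseSet) (w : SAlg F₀ F₁) :
    LFAt M (fun y => χ y • algChange i j y w) z := by
  by_cases hz : z ∈ tsupport χ
  · exact LFAt.smul (Eventually.of_forall fun y => hχ y) (hasLD_algChange (hs hz) hj w).1
  · refine (LFAt.const (0 : SAlg F₀ F₁) z).congr ?_
    filter_upwards [notMem_tsupport_iff_eventuallyEq.1 hz] with y hy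
    rw [hy, Pi.zero_apply, zero_smul]

/-- The section of `∧E*` which is a constant times a cutoff function in a trivialization. -/
def BFun.cut {χ : Z → ℝ} (hχ : ContMDiff 𝓘(ℝ, M) 𝓘(ℝ, ℝ) ∞ χ) (hs : tsupport χ ⊆ i.baseSet)
    (w : SAlg F₀ F₁) : BFun M F₀ F₁ E₀ E₁ U :=
  BFun.ofLocal (fun j z => χ z • algChange i j z w)
    (fun _ _ _ _ hj hk => bump_smul_algChange hs hj hk w)
    (fun _ _ _ hj => lfAt_bump_smul_algChange hχ hs hj w)

theorem BFun.loc_cut {χ : Z → ℝ} (hχ : ContMDiff 𝓘(ℝ, M) 𝓘(ℝ, ℝ) ∞ χ)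
    (hs : tsupport χ ⊆ i.baseSet) (w : SAlg F₀ F₁) (hU : z ∈ U) (hj : z ∈ j.baseSet) :
    BFun.loc j (BFun.cut hχ hs w : BFun M F₀ F₁ E₀ E₁ U) z = χ z • algChange i j z w :=
  BFun.loc_ofLocal _ _ _ hU hj

/-- `BFun.cut` as a linear map. -/
def BFun.cutₗ {χ : Z → ℝ} (hχ : ContMDiff 𝓘(ℝ, M) 𝓘(ℝ, ℝ) ∞ χ) (hs : tsupport χ ⊆ i.baseSet) :
    SAlg F₀ F₁ →ₗ[ℝ] BFun M F₀ F₁ E₀ E₁ U where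
  toFun w := BFun.cut hχ hs w
  map_add' w w' := BFun.ext_loc fun j z hU hj => by
    rw [BFun.loc_add, BFun.loc_cut hχ hs _ hU hj, BFun.loc_cut hχ hs _ hU hj,
      BFun.loc_cut hχ hs _ hU hj, map_add, smul_add]
  map_smul' r w := BFun.ext_loc fun j z hU hj => by
    rw [RingHom.id_apply, BFun.loc_smul, BFun.loc_cut hχ hs _ hU hj, BFun.loc_cut hχ hs _ hU hj,
      map_smul, smul_comm]

theorem BFun.parity_cut {χ : Z → ℝ} (hχ : ContMDiff 𝓘(ℝ, M) 𝓘(ℝ, ℝ) ∞ χ)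
    (hs : tsupport χ ⊆ i.baseSet) (w : SAlg F₀ F₁) :
    BFun.parity (BFun.cut hχ hs w : BFun M F₀ F₁ E₀ E₁ U) = BFun.cut hχ hs (parityInv w) :=
  BFun.ext_loc fun j z hU hj => by
    rw [BFun.loc_parity, BFun.loc_cut hχ hs _ hU hj, BFun.loc_cut hχ hs _ hU hj, map_smul, algChange,
      parityInv_pull]

theorem contMDiff_bump_smul_chart {χ : Z → ℝ} (hχ : ContMDiff 𝓘(ℝ, M) 𝓘(ℝ, ℝ) ∞ χ)
    (hs : tsupport χ ⊆ i.baseSet) (l : Module.Dual ℝ M) :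
    ContMDiff 𝓘(ℝ, M) 𝓘(ℝ, ℝ) ∞ fun y => χ y • l (i.chart y) :=
  contMDiff_bump_smul hχ fun y hy => (l.toContinuousLinearMap.contMDiff.contMDiffAt).comp y
    (contMDiffAt_chart i.chart_mem (hs hy).1)

/-- Linear functions of the chart coordinates, times a cutoff function. -/
def BFun.coordₗ {χ : Z → ℝ} (hχ : ContMDiff 𝓘(ℝ, M) 𝓘(ℝ, ℝ) ∞ χ) (hs : tsupport χ ⊆ i.baseSet) :
    Module.Dual ℝ M →ₗ[ℝ] BFun M F₀ F₁ E₀ E₁ U where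
  toFun l := BFun.ofReal _ (contMDiff_bump_smul_chart hχ hs l)
  map_add' l l' := BFun.ext_loc fun j z hU hj => by
    rw [BFun.loc_add, BFun.loc_ofReal _ _ hU hj, BFun.loc_ofReal _ _ hU hj,
      BFun.loc_ofReal _ _ hU hj, LinearMap.add_apply, smul_add, add_smul]
  map_smul' r l := BFun.ext_loc fun j z hU hj => by
    rw [RingHom.id_apply, BFun.loc_smul, BFun.loc_ofReal _ _ hU hj, BFun.loc_ofReal _ _ hU hj,
      LinearMap.smul_apply, smul_comm, smul_assoc]

theorem BFun.coordₗ_apply {χ : Z → ℝ} (hχ : ContMDiff 𝓘(ℝ, M) 𝓘(ℝ, ℝ) ∞ χ)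
    (hs : tsupport χ ⊆ i.baseSet) (l : Module.Dual ℝ M) :
    (BFun.coordₗ hχ hs l : BFun M F₀ F₁ E₀ E₁ U) = BFun.ofReal _ (contMDiff_bump_smul_chart hχ hs l) :=
  rfl

theorem BFun.parity_ofReal (g : Z → ℝ) (hg : ContMDiff 𝓘(ℝ, M) 𝓘(ℝ, ℝ) ∞ g) :
    BFun.parity (BFun.ofReal g hg : BFun M F₀ F₁ E₀ E₁ U) = BFun.ofReal g hg :=
  BFun.ext_loc fun j z hU hj => by
    rw [BFun.loc_parity, BFun.loc_ofReal _ _ hU hj, map_smul, map_one]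

variable {χ : Z → ℝ} (hχ : ContMDiff 𝓘(ℝ, M) 𝓘(ℝ, ℝ) ∞ χ) (hs : tsupport χ ⊆ i.baseSet)
  (h1 : χ =ᶠ[𝓝 x] 1) (hU : x ∈ U) (hi : x ∈ i.baseSet)
include h1 hU hi

theorem BFun.eventually_loc_cutₗ (w : SAlg F₀ F₁) : ∀ᶠ y in 𝓝 x,
    BFun.loc i (BFun.cutₗ hχ hs w : BFun M F₀ F₁ E₀ E₁ U) y = w := by
  filter_upwards [h1, U.isOpen.mem_nhds hU, i.isOpen_baseSet.mem_nhds hi] with y hy hyU hyi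
  exact (BFun.loc_cut hχ hs w hyU hyi).trans (by rw [hy, algChange_self hyi, Pi.one_apply, one_smul])

theorem BFun.eventually_loc_coordₗ (l : Module.Dual ℝ M) : ∀ᶠ y in 𝓝 x,
    BFun.loc i (BFun.coordₗ hχ hs l : BFun M F₀ F₁ E₀ E₁ U) y =
      l (i.chart y) • (1 : SAlg F₀ F₁) := by
  filter_upwards [h1, U.isOpen.mem_nhds hU, i.isOpen_baseSet.mem_nhds hi] with y hy hyU hyi
  rw [BFun.coordₗ_apply, BFun.loc_ofReal _ _ hyU hyi, hy, Pi.one_apply, one_smul]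

theorem secAct_cutₗ (w : SAlg F₀ F₁) (u) :
    secAct i u (BFun.cutₗ hχ hs w : BFun M F₀ F₁ E₀ E₁ U) x = jetAct w 0 u :=
  secAct_eq_of_hasLD _ hU hi (HasLD.const i.chart w x) (BFun.eventually_loc_cutₗ hχ hs h1 hU hi w) u

theorem secAct_coordₗ (l : Module.Dual ℝ M) (u) :
    secAct i u (BFun.coordₗ hχ hs l : BFun M F₀ F₁ E₀ E₁ U) x = jetAct 0 (l.smulRight 1) u := by
  -- Near `x` the section is the coordinate centred at `x` plus a constant, and the constant does
  -- not contribute.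
  have h := (hasLD_chart_smul i.chart_mem hi.1 l (1 : SAlg F₀ F₁)).add
    (HasLD.const i.chart (l (i.chart x) • (1 : SAlg F₀ F₁)) x)
  rw [secAct_eq_of_hasLD _ hU hi h, ← add_smul, add_zero, jetAct_smul_one]
  filter_upwards [BFun.eventually_loc_coordₗ hχ hs h1 hU hi l] with y hy
  rw [hy, ← add_smul, ← map_add, sub_add_cancel]

end Cutoff

/-! ### Point derivations of `𝒜(U)` and their representation by fibre elements. -/

section PointDerivation

variable {M : Type*} [NormedAddCommGroup M] [NormedSpace ℝ M] [FiniteDimensional ℝ M]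
  {Z : Type*} [TopologicalSpace Z] [T2Space Z] [ChartedSpace M Z] [IsManifold 𝓘(ℝ, M) ∞ Z]
  {F₀ : Type*} [NormedAddCommGroup F₀] [NormedSpace ℝ F₀] [FiniteDimensional ℝ F₀]
  {F₁ : Type*} [NormedAddCommGroup F₁] [NormedSpace ℝ F₁] [FiniteDimensional ℝ F₁]
  {E₀ : Z → Type*} [TopologicalSpace (TotalSpace F₀ E₀)]
  [∀ z, AddCommGroup (E₀ z)] [∀ z, Module ℝ (E₀ z)] [∀ z, TopologicalSpace (E₀ z)]
  [FiberBundle F₀ E₀] [VectorBundle ℝ F₀ E₀] [ContMDiffVectorBundle ∞ F₀ E₀ 𝓘(ℝ, M)]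
  {E₁ : Z → Type*} [TopologicalSpace (TotalSpace F₁ E₁)]
  [∀ z, AddCommGroup (E₁ z)] [∀ z, Module ℝ (E₁ z)] [∀ z, TopologicalSpace (E₁ z)]
  [FiberBundle F₁ E₁] [VectorBundle ℝ F₁ E₁] [ContMDiffVectorBundle ∞ F₁ E₁ 𝓘(ℝ, M)]
  {U V : Opens Z} {i j : LocTriv M F₀ F₁ E₀ E₁} {z x : Z}

/-- The Leibniz rule, twisted by `τ`, at a point. -/
def IsPointDer (i : LocTriv M F₀ F₁ E₀ E₁) (x : Z) (τ : SAlg F₀ F₁ →ₐ[ℝ] SAlg F₀ F₁)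
    (ev : BFun M F₀ F₁ E₀ E₁ U →ₗ[ℝ] SAlg F₀ F₁) : Prop :=
  ∀ f g, ev (f * g) = ev f * BFun.loc i g x + τ (BFun.loc i f x) * ev g

section IsPointDer

variable {τ : SAlg F₀ F₁ →ₐ[ℝ] SAlg F₀ F₁} {ev ev' : BFun M F₀ F₁ E₀ E₁ U →ₗ[ℝ] SAlg F₀ F₁}

theorem IsPointDer.map_one (H : IsPointDer i x τ ev) (hU : x ∈ U) : ev 1 = 0 := by
  have h := H 1 1
  rw [BFun.loc_one hU, _root_.map_one τ, mul_one (1 : BFun M F₀ F₁ E₀ E₁ U)] at h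
  exact eq_zero_of_eq_mul_one_add h

theorem IsPointDer.map_smul_one (H : IsPointDer i x τ ev) (hU : x ∈ U) (r : ℝ) :
    ev (r • (1 : BFun M F₀ F₁ E₀ E₁ U)) = 0 := by
  rw [ev.map_smul, H.map_one hU, smul_zero]

/-- Point derivations are local. -/
theorem IsPointDer.congr (H : IsPointDer i x τ ev) (hU : x ∈ U) (hi : x ∈ i.baseSet)
    {f g : BFun M F₀ F₁ E₀ E₁ U} (h : ∀ᶠ y in 𝓝 x, BFun.loc i f y = BFun.loc i g y) : ev f = ev g := by
  -- With `χ` supported where `f` and `g` agree, `χ f = χ g` on all of `U`. Since `χ = 1` at `x`,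
  -- the Leibniz rule for both products leaves `ev f = ev g`.
  obtain ⟨χ, hχ, hs, h1⟩ := exists_bump (M := M) (inter_mem h (i.isOpen_baseSet.mem_nhds hi))
  have e : (BFun.ofReal χ hχ : BFun M F₀ F₁ E₀ E₁ U) * f = BFun.ofReal χ hχ * g := by
    refine BFun.ext_loc fun j z hzU hj => ?_
    rw [BFun.loc_mul, BFun.loc_mul, BFun.loc_ofReal χ hχ hzU hj]
    by_cases hz : z ∈ tsupport χ
    · have hzi := (hs hz).2
      rw [(BFun.loc_change f hzi hj).self_of_nhds, (BFun.loc_change g hzi hj).self_of_nhds,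
        show BFun.loc i f z = BFun.loc i g z from (hs hz).1]
    · rw [image_eq_zero_of_notMem_tsupport hz, zero_smul, zero_mul, zero_mul]
  have h2 := H (BFun.ofReal χ hχ) f
  have h3 := H (BFun.ofReal χ hχ) g
  rw [e, h3] at h2
  rw [BFun.loc_ofReal χ hχ hU hi, h1.self_of_nhds, Pi.one_apply, one_smul, _root_.map_one τ,
    h.self_of_nhds] at h2
  exact (eq_of_mul_add_one_mul_eq h2).symm

section Ext

variable {χ : Z → ℝ} (hχ : ContMDiff 𝓘(ℝ, M) 𝓘(ℝ, ℝ) ∞ χ) (hs : tsupport χ ⊆ i.baseSet)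
  (h1 : χ =ᶠ[𝓝 x] 1) (hU : x ∈ U) (hi : x ∈ i.baseSet)
  (H : IsPointDer i x τ ev) (H' : IsPointDer i x τ ev')
include h1 hU hi H H'

/-- Where `χ = 1`, cutting off is multiplicative. Locality and the Leibniz rule then allow induction
over generators. -/
theorem IsPointDer.eq_of_cutₗ (h₀ : ∀ c, ev (BFun.cutₗ hχ hs (evenGen c)) = ev' (BFun.cutₗ hχ hs (evenGen c)))
    (h₁ : ∀ c, ev (BFun.cutₗ hχ hs (oddGen c)) = ev' (BFun.cutₗ hχ hs (oddGen c))) (w : SAlg F₀ F₁) :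
    ev (BFun.cutₗ hχ hs w) = ev' (BFun.cutₗ hχ hs w) := by
  have hc := fun w => BFun.eventually_loc_cutₗ (E₀ := E₀) (E₁ := E₁) hχ hs h1 hU hi w
  induction w using SAlg.induction with
  | smul_one r =>
    have e : ∀ᶠ y in 𝓝 x, BFun.loc i (BFun.cutₗ hχ hs (r • 1) : BFun M F₀ F₁ E₀ E₁ U) y =
        BFun.loc i (r • (1 : BFun M F₀ F₁ E₀ E₁ U)) y := by
      filter_upwards [hc (r • 1), U.isOpen.mem_nhds hU] with y hy hyU
      rw [hy, BFun.loc_smul, BFun.loc_one hyU]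
    rw [H.congr hU hi e, H'.congr hU hi e, H.map_smul_one hU, H'.map_smul_one hU]
  | even c => exact h₀ c
  | odd c => exact h₁ c
  | mul a b ha hb =>
    have e : ∀ᶠ y in 𝓝 x, BFun.loc i (BFun.cutₗ hχ hs (a * b) : BFun M F₀ F₁ E₀ E₁ U) y =
        BFun.loc i (BFun.cutₗ hχ hs a * BFun.cutₗ hχ hs b : BFun M F₀ F₁ E₀ E₁ U) y := by
      filter_upwards [hc (a * b), hc a, hc b] with y hy hya hyb
      rw [hy, BFun.loc_mul, hya, hyb]
    rw [H.congr hU hi e, H'.congr hU hi e, H, H', ha, hb]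
  | add a b ha hb =>
    rw [LinearMap.map_add (BFun.cutₗ hχ hs), LinearMap.map_add ev, LinearMap.map_add ev', ha, hb]

theorem IsPointDer.exists_coord (h : ∀ l, ev (BFun.coordₗ hχ hs l) = ev' (BFun.coordₗ hχ hs l))
    (l : Module.Dual ℝ M) : ∃ X : BFun M F₀ F₁ E₀ E₁ U,
      (∀ᶠ y in 𝓝 x, BFun.loc i X y = l (i.chart y - i.chart x) • (1 : SAlg F₀ F₁)) ∧ ev X = ev' X := by
  refine ⟨BFun.coordₗ hχ hs l + (-(l (i.chart x))) • (1 : BFun M F₀ F₁ E₀ E₁ U), ?_, ?_⟩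
  · filter_upwards [BFun.eventually_loc_coordₗ (E₀ := E₀) (E₁ := E₁) hχ hs h1 hU hi l,
      U.isOpen.mem_nhds hU] with y hy hyU
    rw [BFun.loc_add, BFun.loc_smul, hy, BFun.loc_one hyU, ← add_smul, map_sub, sub_eq_add_neg]
  · rw [ev.map_add, ev'.map_add, h, H.map_smul_one hU, H'.map_smul_one hU]

/-- By Hadamard's lemma `g` is near `x` a constant plus a sum of products `k X` with `X` a centred
coordinate. As `X` vanishes at `x`, the Leibniz rule drops the unknown value on `k` and keeps only
the values on coordinates. -/
theorem IsPointDer.eq_ofReal (h : ∀ l, ev (BFun.coordₗ hχ hs l) = ev' (BFun.coordₗ hχ hs l))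
    {g : Z → ℝ} (hg : ContMDiff 𝓘(ℝ, M) 𝓘(ℝ, ℝ) ∞ g) :
    ev (BFun.ofReal g hg) = ev' (BFun.ofReal g hg) := by
  obtain ⟨k, hk, e⟩ := exists_hadamard i.chart_mem hi.1 (Eventually.of_forall fun y => hg y)
  obtain ⟨X, hX, hev⟩ : ∃ X : Fin (Module.finrank ℝ M) → BFun M F₀ F₁ E₀ E₁ U,
      (∀ b, ∀ᶠ y in 𝓝 x, BFun.loc i (X b) y =
        (Module.finBasis ℝ M).coord b (i.chart y - i.chart x) • (1 : SAlg F₀ F₁)) ∧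
      ∀ b, ev (X b) = ev' (X b) := by
    choose X hX hev using fun b =>
      IsPointDer.exists_coord hχ hs h1 hU hi H H' h ((Module.finBasis ℝ M).coord b)
    exact ⟨X, hX, hev⟩
  have hX0 : ∀ b, BFun.loc i (X b) x = 0 := fun b => by
    rw [(hX b).self_of_nhds, sub_self, map_zero, zero_smul]
  have e' : ∀ᶠ y in 𝓝 x, BFun.loc i (BFun.ofReal g hg : BFun M F₀ F₁ E₀ E₁ U) y =
      BFun.loc i (g x • (1 : BFun M F₀ F₁ E₀ E₁ U) + ∑ b, BFun.ofReal (k b) (hk b) * X b) y := by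
    filter_upwards [e, eventually_all.2 hX, U.isOpen.mem_nhds hU, i.isOpen_baseSet.mem_nhds hi]
      with y hy hyX hyU hyi
    rw [BFun.loc_ofReal g hg hyU hyi, hy, BFun.loc_add, BFun.loc_smul, BFun.loc_one hyU, add_smul,
      Finset.sum_smul, BFun.loc_sum]
    refine congrArg _ (Finset.sum_congr rfl fun b _ => ?_)
    rw [BFun.loc_mul, BFun.loc_ofReal _ _ hyU hyi, hyX b, smul_mul_assoc, one_mul, smul_smul]
  rw [H.congr hU hi e', H'.congr hU hi e', ev.map_add, ev'.map_add, H.map_smul_one hU,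
    H'.map_smul_one hU, map_sum ev, map_sum ev']
  refine congrArg _ (Finset.sum_congr rfl fun b _ => ?_)
  rw [H, H', hX0, mul_zero, mul_zero, hev]

/-- Point derivations with the same twist are determined by their values on generators. -/
theorem IsPointDer.ext
    (h₀ : ∀ c, ev (BFun.cutₗ hχ hs (evenGen c)) = ev' (BFun.cutₗ hχ hs (evenGen c)))
    (h₁ : ∀ c, ev (BFun.cutₗ hχ hs (oddGen c)) = ev' (BFun.cutₗ hχ hs (oddGen c)))
    (h : ∀ l, ev (BFun.coordₗ hχ hs l) = ev' (BFun.coordₗ hχ hs l)) : ev = ev' := by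
  refine LinearMap.ext fun f => ?_
  -- Decompose `f` near `x` and cut off both factors of each term: by locality only the products of
  -- real functions with cut-off constants remain.
  obtain ⟨κ, _, g, w, hg, e⟩ := BFun.lfAt_loc (z := ⟨x, hU⟩) f hi
  obtain ⟨θ, hθ, hθs, hθ1⟩ := exists_bump (M := M) (eventually_all.2 hg)
  have hG : ∀ k, ContMDiff 𝓘(ℝ, M) 𝓘(ℝ, ℝ) ∞ fun y => θ y • g k y := fun k =>
    contMDiff_bump_smul hθ fun y hy => hθs hy k
  have e' : ∀ᶠ y in 𝓝 x, BFun.loc i f y =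
      BFun.loc i (∑ k, BFun.ofReal _ (hG k) * BFun.cutₗ hχ hs (w k) : BFun M F₀ F₁ E₀ E₁ U) y := by
    have hc := fun w => BFun.eventually_loc_cutₗ (E₀ := E₀) (E₁ := E₁) hχ hs h1 hU hi w
    filter_upwards [e, hθ1, eventually_all.2 fun k => hc (w k), U.isOpen.mem_nhds hU,
      i.isOpen_baseSet.mem_nhds hi] with y hy hyθ hyw hyU hyi
    rw [hy, BFun.loc_sum]
    refine Finset.sum_congr rfl fun k _ => ?_
    rw [BFun.loc_mul, BFun.loc_ofReal _ _ hyU hyi, hyw, hyθ, Pi.one_apply, one_smul, smul_mul_assoc,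
      one_mul]
  rw [H.congr hU hi e', H'.congr hU hi e', map_sum ev, map_sum ev']
  refine Finset.sum_congr rfl fun k _ => ?_
  rw [H, H', IsPointDer.eq_ofReal hχ hs h1 hU hi H H' h, IsPointDer.eq_of_cutₗ hχ hs h1 hU hi H H' h₀ h₁]

end Ext

end IsPointDer

/-- The action of an element of the fibre as a linear map. -/
def secActₗ (hU : x ∈ U) (hi : x ∈ i.baseSet) (u : SAlg F₀ F₁ ⊗[ℝ] ((F₀ × F₁) × M)) :
    BFun M F₀ F₁ E₀ E₁ U →ₗ[ℝ] SAlg F₀ F₁ where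
  toFun f := secAct i u f x
  map_add' f g := secAct_add f g hU hi u
  map_smul' r f := secAct_smul r f hU hi u

theorem BFun.parity_cutₗ {χ : Z → ℝ} (hχ : ContMDiff 𝓘(ℝ, M) 𝓘(ℝ, ℝ) ∞ χ)
    (hs : tsupport χ ⊆ i.baseSet) (w : SAlg F₀ F₁) :
    BFun.parity (BFun.cutₗ hχ hs w : BFun M F₀ F₁ E₀ E₁ U) = BFun.cutₗ hχ hs (parityInv w) :=
  BFun.parity_cut hχ hs w

theorem BFun.parity_coordₗ {χ : Z → ℝ} (hχ : ContMDiff 𝓘(ℝ, M) 𝓘(ℝ, ℝ) ∞ χ)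
    (hs : tsupport χ ⊆ i.baseSet) (l : Module.Dual ℝ M) :
    BFun.parity (BFun.coordₗ hχ hs l : BFun M F₀ F₁ E₀ E₁ U) = BFun.coordₗ hχ hs l :=
  (congrArg BFun.parity (BFun.coordₗ_apply hχ hs l)).trans
    ((BFun.parity_ofReal _ _).trans (BFun.coordₗ_apply hχ hs l).symm)

/-- Sections that are constant, respectively linear in the chart coordinates, near a point. -/
theorem exists_generators (hU : x ∈ U) (hi : x ∈ i.baseSet) :
    ∃ (C : SAlg F₀ F₁ →ₗ[ℝ] BFun M F₀ F₁ E₀ E₁ U)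
      (X : Module.Dual ℝ M →ₗ[ℝ] BFun M F₀ F₁ E₀ E₁ U),
      (∀ w, BFun.parity (C w) = C (parityInv w)) ∧ (∀ l, BFun.parity (X l) = X l) ∧
      (∀ᶠ y in 𝓝 x, (∀ w u, secAct i u (C w) y = jetAct w 0 u) ∧
        ∀ l u, secAct i u (X l) y = jetAct 0 (l.smulRight 1) u) ∧
      ∀ (τ : SAlg F₀ F₁ →ₐ[ℝ] SAlg F₀ F₁) (ev ev' : BFun M F₀ F₁ E₀ E₁ U →ₗ[ℝ] SAlg F₀ F₁),
        IsPointDer i x τ ev → IsPointDer i x τ ev' →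
        (∀ c, ev (C (evenGen c)) = ev' (C (evenGen c))) →
        (∀ c, ev (C (oddGen c)) = ev' (C (oddGen c))) → (∀ l, ev (X l) = ev' (X l)) → ev = ev' := by
  obtain ⟨χ, hχ, hs, h1⟩ := exists_bump (M := M) (i.isOpen_baseSet.mem_nhds hi)
  refine ⟨BFun.cutₗ hχ hs, BFun.coordₗ hχ hs, BFun.parity_cutₗ hχ hs, BFun.parity_coordₗ hχ hs, ?_,
    fun τ ev ev' H H' h₀ h₁ h => IsPointDer.ext hχ hs h1 hU hi H H' h₀ h₁ h⟩
  -- The cutoff is `1` around every point near `x`, so the formulas hold at neighbouring points too;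
  -- the smoothness of coefficients depends on this.
  filter_upwards [h1.eventually_nhds, U.isOpen.mem_nhds hU, i.isOpen_baseSet.mem_nhds hi] with y hy hyU hyi
  exact ⟨secAct_cutₗ hχ hs hy hyU hyi, secAct_coordₗ hχ hs hy hyU hyi⟩

/-- Homogeneous point derivations are given by elements of the fibre of `𝒱_E`. -/
theorem IsPointDer.exists_secAct {τ : SAlg F₀ F₁ →ₐ[ℝ] SAlg F₀ F₁}
    {ev : BFun M F₀ F₁ E₀ E₁ U →ₗ[ℝ] SAlg F₀ F₁} (hU : x ∈ U) (hi : x ∈ i.baseSet) {ε : ℝ}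
    (H : IsPointDer i x τ ev) (hev : ∀ f, parityInv (ev f) = ε • ev (BFun.parity f))
    (hτ : ∀ w, parityW w = ε • w → IsPointDer i x τ
      (secActₗ hU hi w : BFun M F₀ F₁ E₀ E₁ U →ₗ[ℝ] SAlg F₀ F₁)) :
    ∃ w, ∀ f, ev f = secAct i w f x := by
  obtain ⟨C, X, hC, hX, hCX, hext⟩ := exists_generators (E₀ := E₀) (E₁ := E₁) hU hi
  obtain ⟨hC', hX'⟩ := hCX.self_of_nhds
  -- The candidate takes the values of `ev` on generators and coordinates. Its parity is inherited
  -- from `ev`, with an extra sign on odd generators.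
  have hw : parityW (ofValues (ev ∘ₗ C ∘ₗ evenGen) (ev ∘ₗ C ∘ₗ oddGen) (ev ∘ₗ X)) =
      ε • ofValues (ev ∘ₗ C ∘ₗ evenGen) (ev ∘ₗ C ∘ₗ oddGen) (ev ∘ₗ X) := by
    refine parityW_ofValues ε (fun c => ?_) (fun c => ?_) fun l => ?_
    · rw [LinearMap.comp_apply, LinearMap.comp_apply, hev, hC, parityInv_evenGen]
    · rw [LinearMap.comp_apply, LinearMap.comp_apply, hev, hC, parityInv_oddGen, C.map_smul,
        ev.map_smul, smul_smul, mul_neg_one]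
    · rw [LinearMap.comp_apply, hev, hX]
  have hv := jetAct_ofValues (ev ∘ₗ C ∘ₗ evenGen) (ev ∘ₗ C ∘ₗ oddGen) (ev ∘ₗ X)
  generalize ofValues (ev ∘ₗ C ∘ₗ evenGen) (ev ∘ₗ C ∘ₗ oddGen) (ev ∘ₗ X) = w at hw hv
  refine ⟨w, fun f => ?_⟩
  -- By `hτ` the candidate is a point derivation with the same twist, so agreement on generators is
  -- enough.
  have key : ev = secActₗ hU hi w :=
    hext τ ev _ H (hτ w hw) (fun c => ((hC' _ w).trans (hv.1 c)).symm)
      (fun c => ((hC' _ w).trans (hv.2.1 c)).symm) fun l => ((hX' _ w).trans (hv.2.2 l)).symm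
  exact LinearMap.congr_fun key f

/-- Elements of the fibre of `𝒱_E` are determined by their action. -/
theorem secAct_injective (hU : x ∈ U) (hi : x ∈ i.baseSet)
    {u u' : SAlg F₀ F₁ ⊗[ℝ] ((F₀ × F₁) × M)}
    (h : ∀ f : BFun M F₀ F₁ E₀ E₁ U, secAct i u f x = secAct i u' f x) : u = u' := by
  obtain ⟨C, X, -, -, hCX, -⟩ := exists_generators (E₀ := E₀) (E₁ := E₁) hU hi
  obtain ⟨hC, hX⟩ := hCX.self_of_nhds
  exact jetAct_ext (fun c => by rw [← hC, ← hC, h]) (fun c => by rw [← hC, ← hC, h])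
    fun l => by rw [← hX, ← hX, h]

variable (i) in
/-- Evaluation at a point in a trivialization. -/
def BFun.evalₗ (x : Z) : BFun M F₀ F₁ E₀ E₁ U →ₗ[ℝ] SAlg F₀ F₁ where
  toFun f := BFun.loc i f x
  map_add' f g := BFun.loc_add i f g x
  map_smul' r f := BFun.loc_smul i r f x

/-- Graded derivations are pointwise given by elements of the fibre of `𝒱_E`. -/
theorem exists_secAct_of_mem_gDer {u : BFun M F₀ F₁ E₀ E₁ U →ₗ[ℝ] BFun M F₀ F₁ E₀ E₁ U}
    (hu : u ∈ GDer M F₀ F₁ E₀ E₁ U) (hU : x ∈ U) (hi : x ∈ i.baseSet) :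
    ∃ w, ∀ f, BFun.loc i (u f) x = secAct i w f x := by
  -- The even and the odd component have different twists, the identity and `parityInv`, so each is
  -- represented separately and the fibre elements are added.
  obtain ⟨a, ha, b, hb, rfl⟩ := Submodule.mem_sup.1 hu
  rw [mem_homDer_zero_iff] at ha
  rw [mem_homDer_one_iff] at hb
  obtain ⟨w, hw⟩ := IsPointDer.exists_secAct (ε := 1) (τ := AlgHom.id ℝ _) (ev := BFun.evalₗ i x ∘ₗ a) hU hi
    (fun f g => by
      refine (congrArg (BFun.evalₗ i x) (ha.2 f g)).trans ?_
      exact (BFun.loc_add i _ _ x).trans (by rw [BFun.loc_mul, BFun.loc_mul]; rfl))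
    (fun f => by
      rw [one_smul]
      exact (BFun.loc_parity i _ x).symm.trans (congrArg (BFun.evalₗ i x) (ha.1 f)))
    (fun w hw f g => secAct_mul_even f g hU hi (hw.trans (one_smul ℝ _)))
  obtain ⟨w', hw'⟩ := IsPointDer.exists_secAct (ε := -1) (τ := parityInv) (ev := BFun.evalₗ i x ∘ₗ b) hU hi
    (fun f g => by
      refine (congrArg (BFun.evalₗ i x) (hb.2 f g)).trans ?_
      exact (BFun.loc_add i _ _ x).trans (by rw [BFun.loc_mul, BFun.loc_mul, BFun.loc_parity]; rfl))
    (fun f => (BFun.loc_parity i _ x).symm.trans ((congrArg (BFun.evalₗ i x) (hb.1 f)).trans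
      (BFun.loc_smul i _ _ x)))
    (fun w hw f g => secAct_mul_odd f g hU hi hw)
  refine ⟨w + w', fun f => (BFun.loc_add i _ _ x).trans ?_⟩
  exact (congrArg₂ (· + ·) (hw f) (hw' f)).trans (map_add (jetAct _ _) w w').symm

end PointDerivation

/-! ### The coefficients of a derivation as a section of `𝒱_E`. -/

section MainProof

variable {M : Type*} [NormedAddCommGroup M] [NormedSpace ℝ M] [FiniteDimensional ℝ M]
  {Z : Type*} [TopologicalSpace Z] [T2Space Z] [ChartedSpace M Z] [IsManifold 𝓘(ℝ, M) ∞ Z]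
  {F₀ : Type*} [NormedAddCommGroup F₀] [NormedSpace ℝ F₀] [FiniteDimensional ℝ F₀]
  {F₁ : Type*} [NormedAddCommGroup F₁] [NormedSpace ℝ F₁] [FiniteDimensional ℝ F₁]
  {E₀ : Z → Type*} [TopologicalSpace (TotalSpace F₀ E₀)]
  [∀ z, AddCommGroup (E₀ z)] [∀ z, Module ℝ (E₀ z)] [∀ z, TopologicalSpace (E₀ z)]
  [FiberBundle F₀ E₀] [VectorBundle ℝ F₀ E₀] [ContMDiffVectorBundle ∞ F₀ E₀ 𝓘(ℝ, M)]
  {E₁ : Z → Type*} [TopologicalSpace (TotalSpace F₁ E₁)]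
  [∀ z, AddCommGroup (E₁ z)] [∀ z, Module ℝ (E₁ z)] [∀ z, TopologicalSpace (E₁ z)]
  [FiberBundle F₁ E₁] [VectorBundle ℝ F₁ E₁] [ContMDiffVectorBundle ∞ F₁ E₁ 𝓘(ℝ, M)]
  {U V : Opens Z} {i j : LocTriv M F₀ F₁ E₀ E₁} {z x : Z}

theorem vSections_ext {s t : VSections M F₀ F₁ E₀ E₁ U}
    (h : ∀ (z : {z // z ∈ U}) (i : LocTriv M F₀ F₁ E₀ E₁), (z : Z) ∈ i.baseSet →
      (s.1 z).1 i = (t.1 z).1 i) : s = t := by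
  refine Subtype.ext (funext fun z => Subtype.ext (funext fun i => ?_))
  by_cases hi : (z : Z) ∈ i.baseSet
  · exact h z i hi
  · exact ((s.1 z).2.1 i hi).trans ((t.1 z).2.1 i hi).symm

open Classical in
/-- The section of `𝒱_E` with the given local expressions. -/
def vSectionsOfLocal (a : LocTriv M F₀ F₁ E₀ E₁ → Z → SAlg F₀ F₁ ⊗[ℝ] ((F₀ × F₁) × M))
    (ha : ∀ i j z, z ∈ U → z ∈ i.baseSet → z ∈ j.baseSet → coordChange i j z (a i z) = a j z)
    (hs : ∀ (i : LocTriv M F₀ F₁ E₀ E₁) z, z ∈ U → z ∈ i.baseSet → LFAt M (a i) z) :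
    VSections M F₀ F₁ E₀ E₁ U :=
  ⟨fun z => ⟨fun i => if (z : Z) ∈ i.baseSet then a i z else 0, fun i hi => if_neg hi,
    fun i j hi hj => by
    simp only [if_pos hi, if_pos hj]
    exact ha i j z z.2 hi hj⟩,
    fun i x hx => (hs i x x.2 hx).lfSmoothAt_of_eventually (Opens.eventually_mem U x) (by
      filter_upwards [i.isOpen_baseSet.mem_nhds hx] with y hy hyU
      exact if_pos hy)⟩

theorem vSectionsOfLocal_apply (a : LocTriv M F₀ F₁ E₀ E₁ → Z → SAlg F₀ F₁ ⊗[ℝ] ((F₀ × F₁) × M))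
    (ha : ∀ i j z, z ∈ U → z ∈ i.baseSet → z ∈ j.baseSet → coordChange i j z (a i z) = a j z)
    (hs : ∀ (i : LocTriv M F₀ F₁ E₀ E₁) z, z ∈ U → z ∈ i.baseSet → LFAt M (a i) z)
    (z : {z // z ∈ U}) (hi : (z : Z) ∈ i.baseSet) :
    ((vSectionsOfLocal a ha hs).1 z).1 i = a i z := if_pos hi

theorem eq_of_secDer_eq {s t : VSections M F₀ F₁ E₀ E₁ U}
    (h : ∀ f : BFun M F₀ F₁ E₀ E₁ U, secDer s f = secDer t f) : s = t := by
  refine vSections_ext fun z i hi => secAct_injective (E₀ := E₀) (E₁ := E₁) z.2 hi fun f => ?_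
  rw [← triv_secDer s f z hi, ← triv_secDer t f z hi, h]

theorem LFAt.ofValues {p : Module.Dual ℝ F₀ → Z → SAlg F₀ F₁} {q : Module.Dual ℝ F₁ → Z → SAlg F₀ F₁}
    {r : Module.Dual ℝ M → Z → SAlg F₀ F₁} (hp : ∀ c, LFAt M (p c) x) (hq : ∀ c, LFAt M (q c) x)
    (hr : ∀ l, LFAt M (r l) x) :
    LFAt M (fun y => ofValues (fun c => p c y) (fun c => q c y) fun l => r l y) x := by
  have h : ∀ {g : Z → SAlg F₀ F₁} (v : (F₀ × F₁) × M), LFAt M g x → LFAt M (fun y => g y ⊗ₜ[ℝ] v) x :=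
    fun v hg => hg.map ((TensorProduct.mk ℝ (SAlg F₀ F₁) ((F₀ × F₁) × M)).flip v)
  exact ((LFAt.sum _ fun b _ => h _ (hp _)).add (LFAt.sum _ fun b _ => h _ (hq _))).add
    (LFAt.sum _ fun b _ => h _ (hr _))

open Classical in
/-- The local expression of the section of `𝒱_E` given by a derivation. -/
def derCoeff (u : BFun M F₀ F₁ E₀ E₁ U →ₗ[ℝ] BFun M F₀ F₁ E₀ E₁ U) (i : LocTriv M F₀ F₁ E₀ E₁)
    (x : Z) : SAlg F₀ F₁ ⊗[ℝ] ((F₀ × F₁) × M) :=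
  -- For a graded derivation the default `0` does not occur at points of `U` in the domain of `i`.
  if h : ∃ w, ∀ f, BFun.loc i (u f) x = secAct i w f x then h.choose else 0

theorem secAct_derCoeff {u : BFun M F₀ F₁ E₀ E₁ U →ₗ[ℝ] BFun M F₀ F₁ E₀ E₁ U}
    (hu : u ∈ GDer M F₀ F₁ E₀ E₁ U) (hU : x ∈ U) (hi : x ∈ i.baseSet) (f) :
    secAct i (derCoeff u i x) f x = BFun.loc i (u f) x := by
  have h := exists_secAct_of_mem_gDer hu hU hi
  rw [derCoeff, dif_pos h]
  exact (h.choose_spec f).symm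

/-- Both sides act on sections in the same way, namely as `u` read in the trivialization `j`, and
the action is faithful. -/
theorem coordChange_derCoeff {u : BFun M F₀ F₁ E₀ E₁ U →ₗ[ℝ] BFun M F₀ F₁ E₀ E₁ U}
    (hu : u ∈ GDer M F₀ F₁ E₀ E₁ U) (hU : x ∈ U) (hi : x ∈ i.baseSet) (hj : x ∈ j.baseSet) :
    coordChange i j x (derCoeff u i x) = derCoeff u j x := by
  refine secAct_injective (E₀ := E₀) (E₁ := E₁) hU hj fun f => ?_
  rw [secAct_coordChange f hU hi hj, secAct_derCoeff hu hU hi, secAct_derCoeff hu hU hj,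
    (BFun.loc_change (u f) hi hj).self_of_nhds]

/-- The coefficients are chosen point by point, but near `x` they equal `ofValues` of the functions
`u (C c)` and `u (X l)` for one fixed family of test sections, and these are smooth. -/
theorem lfAt_derCoeff {u : BFun M F₀ F₁ E₀ E₁ U →ₗ[ℝ] BFun M F₀ F₁ E₀ E₁ U}
    (hu : u ∈ GDer M F₀ F₁ E₀ E₁ U) (hU : x ∈ U) (hi : x ∈ i.baseSet) :
    LFAt M (derCoeff u i) x := by
  obtain ⟨C, X, -, -, hCX, -⟩ := exists_generators (E₀ := E₀) (E₁ := E₁) hU hi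
  have hl : ∀ f, LFAt M (BFun.loc i (u f)) x := fun f => BFun.lfAt_loc (z := ⟨x, hU⟩) (u f) hi
  refine (LFAt.ofValues (fun c => hl (C (evenGen c))) (fun c => hl (C (oddGen c)))
    fun l => hl (X l)).congr ?_
  filter_upwards [hCX, U.isOpen.mem_nhds hU, i.isOpen_baseSet.mem_nhds hi] with y hy hyU hyi
  simp only [← secAct_derCoeff hu hyU hyi, hy.1, hy.2]
  exact (ofValues_jetAct _).symm

end MainProof

/-! ### Surjectivity, restrictions and the local formula. -/

section MainProof

variable {M : Type*} [NormedAddCommGroup M] [NormedSpace ℝ M] [FiniteDimensional ℝ M]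
  {Z : Type*} [TopologicalSpace Z] [T2Space Z] [ChartedSpace M Z] [IsManifold 𝓘(ℝ, M) ∞ Z]
  {F₀ : Type*} [NormedAddCommGroup F₀] [NormedSpace ℝ F₀] [FiniteDimensional ℝ F₀]
  {F₁ : Type*} [NormedAddCommGroup F₁] [NormedSpace ℝ F₁] [FiniteDimensional ℝ F₁]
  {E₀ : Z → Type*} [TopologicalSpace (TotalSpace F₀ E₀)]
  [∀ z, AddCommGroup (E₀ z)] [∀ z, Module ℝ (E₀ z)] [∀ z, TopologicalSpace (E₀ z)]
  [FiberBundle F₀ E₀] [VectorBundle ℝ F₀ E₀] [ContMDiffVectorBundle ∞ F₀ E₀ 𝓘(ℝ, M)]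
  {E₁ : Z → Type*} [TopologicalSpace (TotalSpace F₁ E₁)]
  [∀ z, AddCommGroup (E₁ z)] [∀ z, Module ℝ (E₁ z)] [∀ z, TopologicalSpace (E₁ z)]
  [FiberBundle F₁ E₁] [VectorBundle ℝ F₁ E₁] [ContMDiffVectorBundle ∞ F₁ E₁ 𝓘(ℝ, M)]
  {U V : Opens Z} {i j : LocTriv M F₀ F₁ E₀ E₁} {z x : Z}

/-- Graded derivations are given by sections of `𝒱_E`. -/
theorem exists_secDer_eq {u : BFun M F₀ F₁ E₀ E₁ U →ₗ[ℝ] BFun M F₀ F₁ E₀ E₁ U}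
    (hu : u ∈ GDer M F₀ F₁ E₀ E₁ U) : ∃ s : VSections M F₀ F₁ E₀ E₁ U, ∀ f, secDer s f = u f := by
  refine ⟨vSectionsOfLocal (fun i x => derCoeff u i x)
    (fun _ _ _ hU hi hj => coordChange_derCoeff hu hU hi hj)
    (fun _ _ hU hi => lfAt_derCoeff hu hU hi), fun f => BFun.ext_triv fun z i hi => ?_⟩
  rw [triv_secDer _ f z hi, vSectionsOfLocal_apply _ _ _ z hi, secAct_derCoeff hu z.2 hi,
    BFun.loc_apply]

theorem secDer_res (h : V ≤ U) (s : VSections M F₀ F₁ E₀ E₁ U) (f : BFun M F₀ F₁ E₀ E₁ U) :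
    secDer (Sections.res M h s) (BFun.res h f) = BFun.res h (secDer s f) := by
  refine BFun.ext_triv fun z i hi => ?_
  rw [triv_secDer _ _ z hi, secAct_res h f z.2 hi]
  exact (triv_secDer s f ⟨z, h z.2⟩ hi).symm

/-- A section of `𝒱_E` is determined by its action on sections of `∧E*` over a larger set. -/
theorem eq_of_secDer_res_eq (h : V ≤ U) {s t : VSections M F₀ F₁ E₀ E₁ V}
    (e : ∀ f : BFun M F₀ F₁ E₀ E₁ U, secDer s (BFun.res h f) = secDer t (BFun.res h f)) :
    s = t :=
  -- Faithfulness at a point of `V` is used with test sections over `U`, which is why restricted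
  -- functions suffice.
  vSections_ext fun z i hi => secAct_injective (E₀ := E₀) (E₁ := E₁) (h z.2) hi fun f => by
    rw [← secAct_res h f z.2 hi, ← secAct_res h f z.2 hi, ← triv_secDer s _ z hi,
      ← triv_secDer t _ z hi, e f]

/-- The given decomposition of `f` serves as local representative, and its differential is read off
term by term. -/
theorem triv_secDer_of_eq_sum (s : VSections M F₀ F₁ E₀ E₁ U) (f : BFun M F₀ F₁ E₀ E₁ U)
    {O : Set Z} {κ : Type} [Fintype κ] {g : κ → Z → ℝ} {w : κ → SAlg F₀ F₁} (hO : IsOpen O)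
    (hOi : O ⊆ i.baseSet) (hg : ∀ k, ContMDiffOn 𝓘(ℝ, M) 𝓘(ℝ, ℝ) ∞ (g k) O)
    (hf : ∀ z : {z // z ∈ U}, (z : Z) ∈ O → i.triv z (f.1 z) = ∑ k, g k z • w k)
    (z : {z // z ∈ U}) (hz : (z : Z) ∈ O) :
    i.triv z ((secDer s f).1 z) =
      ∑ k, act (chartDeriv i.chart (g k) z) (g k z) (w k) ((s.1 z).1 i) := by
  have hd : HasLD i.chart (fun y => ∑ k, g k y • w k) (z : Z)
      (∑ k, (chartDeriv i.chart (g k) z).smulRight (w k)) :=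
    ⟨κ, inferInstance, g, w, fun k => (hg k).contMDiffAt (hO.mem_nhds hz),
      Eventually.of_forall fun _ => rfl, rfl⟩
  rw [triv_secDer s f z (hOi hz), sum_act, secAct_eq_of_hasLD f z.2 (hOi hz) hd]
  filter_upwards [hO.mem_nhds hz, U.isOpen.mem_nhds z.2] with y hy hyU
  exact (BFun.loc_apply i f ⟨y, hyU⟩).trans (hf ⟨y, hyU⟩ hy)

theorem secAct_rTensor_mulLeft (a : SAlg F₀ F₁) (u : SAlg F₀ F₁ ⊗[ℝ] ((F₀ × F₁) × M))
    (g : BFun M F₀ F₁ E₀ E₁ U) :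
    secAct i (LinearMap.rTensor _ (LinearMap.mulLeft ℝ a) u) g z = a * secAct i u g z :=
  jetAct_rTensor_mulLeft _ _ a u

end MainProof

/-- A bijective additive and homogeneous map as a linear isomorphism. -/
def linearEquivOfBijective {A B : Type*} [AddCommMonoid A] [Module ℝ A] [AddCommMonoid B]
    [Module ℝ B] (φ : A → B) (hadd : ∀ a b, φ (a + b) = φ a + φ b)
    (hsmul : ∀ (r : ℝ) a, φ (r • a) = r • φ a) (hinj : ∀ a b, φ a = φ b → a = b)
    (hsurj : ∀ b, ∃ a, φ a = b) : A ≃ₗ[ℝ] B :=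
  LinearEquiv.ofBijective { toFun := φ, map_add' := hadd, map_smul' := hsmul } ⟨hinj, hsurj⟩

/-- If `Φ` is a family of linear isomorphisms from a presheaf `S` to spaces `G i`, then `S i` is
isomorphic to the space of the families in `∏ j ≤ i, G j` that are compatible with restrictions. -/
theorem exists_linearEquiv_compatible {I : Type*} [Preorder I] {S G : I → Type*}
    [∀ i, AddCommMonoid (S i)] [∀ i, Module ℝ (S i)] [∀ i, AddCommMonoid (G i)]
    [∀ i, Module ℝ (G i)] (Φ : ∀ i, S i ≃ₗ[ℝ] G i) (r : ∀ {i j : I}, j ≤ i → S i →ₗ[ℝ] S j)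
    (r_refl : ∀ i (s : S i), r le_rfl s = s)
    (r_comp : ∀ {i j k : I} (h : j ≤ i) (h' : k ≤ j) (s : S i), r h' (r h s) = r (h'.trans h) s)
    (D : ∀ i, Submodule ℝ (∀ j : {j // j ≤ i}, G j.1))
    (hD : ∀ i (u : ∀ j : {j // j ≤ i}, G j.1), u ∈ D i ↔
      ∀ (j k : {j // j ≤ i}) (h : k.1 ≤ j.1) (s : S j.1), Φ j.1 s = u j → Φ k.1 (r h s) = u k) :
    ∃ Ψ : ∀ i, S i ≃ₗ[ℝ] D i, ∀ i (s : S i) (j : {j // j ≤ i}),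
      (Ψ i s).1 j = Φ j.1 (r j.2 s) := by
  have mem (i) (s : S i) : (fun j : {j // j ≤ i} => Φ j.1 (r j.2 s)) ∈ D i := by
    refine (hD i _).2 fun j k h t ht => ?_
    rw [(Φ j.1).injective ht, r_comp]
  refine ⟨fun i => linearEquivOfBijective (fun s => ⟨_, mem i s⟩) (fun s t => ?_) (fun c s => ?_)
    (fun s t h => ?_) (fun u => ?_), fun i s j => rfl⟩
  · exact Subtype.ext (funext fun j => by simp)
  · exact Subtype.ext (funext fun j => by simp)
  · have h1 := (Φ i).injective (congrFun (congrArg Subtype.val h) ⟨i, le_rfl⟩)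
    rwa [r_refl, r_refl] at h1
  -- A compatible family is determined by its component at `i` itself.
  · refine ⟨(Φ i).symm (u.1 ⟨i, le_rfl⟩), Subtype.ext (funext fun j => ?_)⟩
    exact (hD i u.1).1 u.2 ⟨i, le_rfl⟩ j j.2 _ ((Φ i).apply_symm_apply _)

/-! ### The module structure over `𝒜(U)` and the isomorphism with derivations. -/

section MainProof

variable {M : Type*} [NormedAddCommGroup M] [NormedSpace ℝ M] [FiniteDimensional ℝ M]
  {Z : Type*} [TopologicalSpace Z] [T2Space Z] [ChartedSpace M Z] [IsManifold 𝓘(ℝ, M) ∞ Z]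
  {F₀ : Type*} [NormedAddCommGroup F₀] [NormedSpace ℝ F₀] [FiniteDimensional ℝ F₀]
  {F₁ : Type*} [NormedAddCommGroup F₁] [NormedSpace ℝ F₁] [FiniteDimensional ℝ F₁]
  {E₀ : Z → Type*} [TopologicalSpace (TotalSpace F₀ E₀)]
  [∀ z, AddCommGroup (E₀ z)] [∀ z, Module ℝ (E₀ z)] [∀ z, TopologicalSpace (E₀ z)]
  [FiberBundle F₀ E₀] [VectorBundle ℝ F₀ E₀] [ContMDiffVectorBundle ∞ F₀ E₀ 𝓘(ℝ, M)]
  {E₁ : Z → Type*} [TopologicalSpace (TotalSpace F₁ E₁)]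
  [∀ z, AddCommGroup (E₁ z)] [∀ z, Module ℝ (E₁ z)] [∀ z, TopologicalSpace (E₁ z)]
  [FiberBundle F₁ E₁] [VectorBundle ℝ F₁ E₁] [ContMDiffVectorBundle ∞ F₁ E₁ 𝓘(ℝ, M)]
  {U V : Opens Z} {i j : LocTriv M F₀ F₁ E₀ E₁} {z x : Z}

/-- The product of a section of `∧E*` and a section of `𝒱_E`. -/
def smulSection (f : BFun M F₀ F₁ E₀ E₁ U) (s : VSections M F₀ F₁ E₀ E₁ U) :
    VSections M F₀ F₁ E₀ E₁ U :=
  vSectionsOfLocal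
    (fun i z => LinearMap.rTensor _ (LinearMap.mulLeft ℝ (BFun.loc i f z)) (secLoc i s z))
    (fun i j z hU hi hj => by
      -- Compatibility with `coordChange` is tested through the action, where it reduces to
      -- multiplicativity of `algChange`.
      refine secAct_injective (E₀ := E₀) (E₁ := E₁) hU hj fun g => ?_
      rw [secAct_coordChange g hU hi hj, secAct_rTensor_mulLeft, secAct_rTensor_mulLeft, map_mul,
        ← secAct_coordChange g hU hi hj, coordChange_secLoc s hU hi hj,
        (BFun.loc_change f hi hj).self_of_nhds])
    (fun i z hU hi => (BFun.lfAt_loc (z := ⟨z, hU⟩) f hi).bilin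
      (LinearMap.rTensorHom (R := ℝ) ((F₀ × F₁) × M) ∘ₗ LinearMap.mul ℝ (SAlg F₀ F₁))
      (lfAt_secLoc s hU hi))

theorem smulSection_apply (f : BFun M F₀ F₁ E₀ E₁ U) (s : VSections M F₀ F₁ E₀ E₁ U)
    (z : {z // z ∈ U}) (hi : (z : Z) ∈ i.baseSet) : ((smulSection f s).1 z).1 i =
      LinearMap.rTensor _ (LinearMap.mulLeft ℝ (i.triv z (f.1 z))) ((s.1 z).1 i) := by
  refine (vSectionsOfLocal_apply _ _ _ z hi).trans ?_
  rw [secLoc_apply, BFun.loc_apply]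

theorem secDer_smulSection (f : BFun M F₀ F₁ E₀ E₁ U) (s : VSections M F₀ F₁ E₀ E₁ U)
    (h : BFun M F₀ F₁ E₀ E₁ U) : secDer (smulSection f s) h = f * secDer s h := by
  refine BFun.ext_triv fun z i hi => ?_
  rw [triv_secDer _ _ z hi, smulSection_apply f s z hi, secAct_rTensor_mulLeft,
    ← triv_secDer s h z hi]
  exact (map_mul (i.triv z) _ _).symm

variable (M F₀ F₁ E₀ E₁) in
/-- Sections of `𝒱_E` are the same as graded derivations. -/
def sectionsEquivDer (U : Opens Z) : VSections M F₀ F₁ E₀ E₁ U ≃ₗ[ℝ] GDer M F₀ F₁ E₀ E₁ U :=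
  linearEquivOfBijective toDer (fun s t => Subtype.ext (LinearMap.ext (secDer_add s t)))
    (fun r s => Subtype.ext (LinearMap.ext (secDer_smul r s)))
    (fun _ _ h => eq_of_secDer_eq (LinearMap.congr_fun (congrArg Subtype.val h)))
    (fun u => (exists_secDer_eq u.2).imp fun _ h => Subtype.ext (LinearMap.ext h))

end MainProof

end BRST

end

theorem mainTheorem12
    {M : Type*} [NormedAddCommGroup M] [NormedSpace ℝ M] [FiniteDimensional ℝ M]
    {Z : Type*} [TopologicalSpace Z] [T2Space Z] [ParacompactSpace Z]
    [ChartedSpace M Z] [IsManifold 𝓘(ℝ, M) ∞ Z]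
    {F₀ : Type*} [NormedAddCommGroup F₀] [NormedSpace ℝ F₀] [FiniteDimensional ℝ F₀]
    {F₁ : Type*} [NormedAddCommGroup F₁] [NormedSpace ℝ F₁] [FiniteDimensional ℝ F₁]
    {E₀ : Z → Type*} [TopologicalSpace (TotalSpace F₀ E₀)]
    [∀ z, AddCommGroup (E₀ z)] [∀ z, Module ℝ (E₀ z)] [∀ z, TopologicalSpace (E₀ z)]
    [FiberBundle F₀ E₀] [VectorBundle ℝ F₀ E₀] [ContMDiffVectorBundle ∞ F₀ E₀ 𝓘(ℝ, M)]
    {E₁ : Z → Type*} [TopologicalSpace (TotalSpace F₁ E₁)]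
    [∀ z, AddCommGroup (E₁ z)] [∀ z, Module ℝ (E₁ z)] [∀ z, TopologicalSpace (E₁ z)]
    [FiberBundle F₁ E₁] [VectorBundle ℝ F₁ E₁] [ContMDiffVectorBundle ∞ F₁ E₁ 𝓘(ℝ, M)] :
    -- the domains and transition functions define a smooth vector bundle `𝒱_E`
    BRST.IsVectorBundleCocycle M
      (BRST.LocTriv.baseSet (M := M) (F₀ := F₀) (F₁ := F₁) (E₀ := E₀) (E₁ := E₁))
      BRST.coordChange ∧
    -- its sections over every open set `U` are the graded derivations of `𝒜(U)`
    ∃ Φ : ∀ U : Opens Z, BRST.VSections M F₀ F₁ E₀ E₁ U ≃ₗ[ℝ] BRST.GDer M F₀ F₁ E₀ E₁ U,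
      -- the local formula for the derivation `Φ U s`, on a local expression of a function `f`
      (∀ (U : Opens Z) (s : BRST.VSections M F₀ F₁ E₀ E₁ U) (f : BRST.BFun M F₀ F₁ E₀ E₁ U)
        (i : BRST.LocTriv M F₀ F₁ E₀ E₁) (O : Set Z) (κ : Type) [Fintype κ]
        (g : κ → Z → ℝ) (w : κ → BRST.SAlg F₀ F₁),
        IsOpen O → O ⊆ U → O ⊆ i.baseSet →
        (∀ k, ContMDiffOn 𝓘(ℝ, M) 𝓘(ℝ, ℝ) ∞ (g k) O) →
        (∀ z : {z // z ∈ U}, (z : Z) ∈ O → i.triv z (f.1 z) = ∑ k, g k z • w k) →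
        ∀ z : {z // z ∈ U}, (z : Z) ∈ O →
          i.triv z (((Φ U s).1 f).1 z) =
            ∑ k, BRST.act (fderiv ℝ (fun y => g k (i.chart.symm y)) (i.chart z) : M →ₗ[ℝ] ℝ)
              (g k z) (w k) ((s.1 z).1 i)) ∧
      -- `Φ U` is linear over `𝒜(U)`
      (∀ (U : Opens Z) (f : BRST.BFun M F₀ F₁ E₀ E₁ U) (s : BRST.VSections M F₀ F₁ E₀ E₁ U),
        ∃ t : BRST.VSections M F₀ F₁ E₀ E₁ U,
          (∀ (z : {z // z ∈ U}) (i : BRST.LocTriv M F₀ F₁ E₀ E₁), (z : Z) ∈ i.baseSet →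
            (t.1 z).1 i = LinearMap.rTensor _ (LinearMap.mulLeft ℝ (i.triv z (f.1 z)))
              ((s.1 z).1 i)) ∧
          ∀ h, (Φ U t).1 h = f * (Φ U s).1 h) ∧
      -- derivations restrict uniquely to smaller open sets, and `Φ` commutes with restrictions
      (∀ (U V : Opens Z) (hVU : V ≤ U),
        (∀ u : BRST.GDer M F₀ F₁ E₀ E₁ U, ∃! v : BRST.GDer M F₀ F₁ E₀ E₁ V,
          ∀ f, v.1 (BRST.BFun.res hVU f) = BRST.BFun.res hVU (u.1 f)) ∧
        ∀ s f, (Φ V (BRST.Sections.res M hVU s)).1 (BRST.BFun.res hVU f) =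
          BRST.BFun.res hVU ((Φ U s).1 f)) ∧
      -- the sheaf of sections of `𝒱_E` is isomorphic to the sheaf of graded derivations of `𝒜`
      ∃ Ψ : ∀ U : Opens Z, BRST.VSections M F₀ F₁ E₀ E₁ U ≃ₗ[ℝ] BRST.DerSheaf M F₀ F₁ E₀ E₁ U,
        ∀ (U : Opens Z) (s : BRST.VSections M F₀ F₁ E₀ E₁ U) (V : {V : Opens Z // V ≤ U}),
          (Ψ U s).1 V = Φ V.1 (BRST.Sections.res M V.2 s) := by
  have hex (U : Opens Z) (u : BRST.GDer M F₀ F₁ E₀ E₁ U) :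
      ∃ s : BRST.VSections M F₀ F₁ E₀ E₁ U, BRST.toDer s = u :=
    (BRST.exists_secDer_eq u.2).imp fun _ h => Subtype.ext (LinearMap.ext h)
  refine ⟨BRST.isVectorBundleCocycle_coordChange, BRST.sectionsEquivDer M F₀ F₁ E₀ E₁,
    fun U s f i O κ _ g w hO _ hOi hg hf z hz =>
      BRST.triv_secDer_of_eq_sum s f hO hOi hg hf z hz,
    fun U f s => ⟨BRST.smulSection f s, fun z i hi => BRST.smulSection_apply f s z hi,
      BRST.secDer_smulSection f s⟩,
    fun U V hVU => ⟨fun u => (hex U u).elim fun s hs =>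
      ⟨BRST.toDer (BRST.Sections.res M hVU s), fun f => (BRST.secDer_res hVU s f).trans
        (congrArg (fun w : BRST.GDer M F₀ F₁ E₀ E₁ U => BRST.BFun.res hVU (w.1 f)) hs),
        -- Uniqueness: `v` also comes from a section, and that section agrees with the restriction
        -- of `s` on restricted functions.
        fun v hv => (hex V v).elim fun t ht => ht.symm.trans (congrArg BRST.toDer
          (BRST.eq_of_secDer_res_eq hVU fun f => ?_))⟩,
      BRST.secDer_res hVU⟩, ?_⟩
  · exact (congrArg (fun w : BRST.GDer M F₀ F₁ E₀ E₁ V => w.1 (BRST.BFun.res hVU f)) ht).trans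
      ((hv f).trans ((BRST.secDer_res hVU s f).trans (congrArg
        (fun w : BRST.GDer M F₀ F₁ E₀ E₁ U => BRST.BFun.res hVU (w.1 f)) hs)).symm)
  -- It remains to match two notions of compatibility: that of derivations evaluated on restricted
  -- functions, and that of the corresponding sections of `𝒱_E`.
  refine BRST.exists_linearEquiv_compatible (BRST.sectionsEquivDer M F₀ F₁ E₀ E₁)
    (fun h => BRST.Sections.res M h) (fun _ _ => rfl) (fun _ _ _ => rfl)
    (BRST.DerSheaf M F₀ F₁ E₀ E₁) fun U u => ⟨fun hu V V' h s hs => ?_, fun H V V' h f => ?_⟩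
  · refine (hex V'.1 (u V')).elim fun t ht => (congrArg BRST.toDer
      (BRST.eq_of_secDer_res_eq h fun f => ?_)).trans ht
    exact (BRST.secDer_res h s f).trans
      ((congrArg (fun w : BRST.GDer M F₀ F₁ E₀ E₁ V.1 => BRST.BFun.res h (w.1 f)) hs).trans
      ((hu V V' h f).symm.trans
      (congrArg (fun w : BRST.GDer M F₀ F₁ E₀ E₁ V'.1 => w.1 (BRST.BFun.res h f)) ht).symm))
  · refine (hex V.1 (u V)).elim fun s hs => ?_
    exact (congrArg (fun w : BRST.GDer M F₀ F₁ E₀ E₁ V'.1 => w.1 (BRST.BFun.res h f))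
      (H V V' h s hs).symm).trans ((BRST.secDer_res h s f).trans
      (congrArg (fun w : BRST.GDer M F₀ F₁ E₀ E₁ V.1 => BRST.BFun.res h (w.1 f)) hs))
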